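/- **Theorem 2.2.** Let $\nu\in(0,1]$. For $\alpha>0$ and $n=\lceil\alpha\rceil$ let $$\frac{d^{\alpha}f}{dt^{\alpha}}(t)=\frac1{\Gamma(n-\alpha)}\int_0^t\frac{f^{(n)}(s)}{(t-s)^{\alpha+1-n}}\,ds\quad(\alpha\ne n),\qquad \frac{d^{\alpha}f}{dt^{\alpha}}=f^{(n)}\quad(\alpha=n),$$ denote the Dzhrbashyan–Caputo derivative. **(1)** There is exactly one family $(q(\cdot,t))_{t\ge0}$ of probability distributions on $\mathbb R$ solving $$\frac{\partial^{2\nu}}{\partial t^{2\nu}}q(s,t)=\frac{\partial^2}{\partial s^2}q(s,t)\quad(t>0),\qquad q(s,0)=\delta(s),$$ with the additional condition $q_t(s,0)=0$ if $\nu\in(1/2,1]$. The problem is understood in the sense of distributions in $s$: for every $\varphi\in C_c^\infty(\mathbb R)$ the function $F_\varphi(t)=\int\varphi(s)\,q(ds,t)$ is continuous on $[0,\infty)$, has a Caputo derivative of order $2\nu$ (it is $\lceil2\nu\rceil$ times differentiable on $(0,\infty)$, the derivative of order $\lceil 2\nu\rceil$ is integrable on $(0,t)$ for each $t>0$, and,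 if $2\nu$ is not an integer, so is the integrand defining the Caputo derivative), and $\frac{d^{2\nu}}{dt^{2\nu}}F_\varphi(t)=F_{\varphi''}(t)$ for $t>0$; the additional condition reads $F_\varphi'(t)\to0$ as $t\to0^+$. **(2)** For $t>0$ let $\rho_t$ be the folded solution, i.e. the image of $q(\cdot,t)$ under $s\mapsto|s|$. If $\nu<1$, there is a nonnegative, jointly measurable function $f(s,t)$ such that $\rho_t(ds)=f(s,t)\,ds$ on $(0,\infty)$ for every $t>0$ and $$\int_0^\infty e^{-zt}f(s,t)\,dt=z^{\nu-1}e^{-sz^{\nu}},\qquad s>0,\ z>0 .$$ For all $\nu\in(0,1]$ (including $\nu=1$, where $\rho_t=\delta_t$) and $z>0$ this holds as an identity of measures in $s$ on the Borel sets: $\int_0^\infty e^{-zt}\rho_t(B)\,dt=\int_{B\cap(0,\infty)} z^{\nu-1}e^{-sz^\nu}\,ds$. **(3)** Let $\mu>0$ and $n_0\in\{0,1,2,\dots\}$. Let $M^\nu(t)$, $t\ge0$, be a fractional linear death process with $n_0$ initial individuals, i.e. a process with values in $\{0,\dots,n_0\}$ (almost surely, at each time) whose state probabilities $p_k(t)=\Pr\{M^\nu(t)=k\}$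 are continuous on $[0,\infty)$, have a Caputo derivative of order $\nu$ (in the sense made precise in (1) for order $2\nu$), and satisfy $$\frac{d^\nu p_k}{dt^\nu}=\mu(k+1)p_{k+1}-\mu k\,p_k\quad(0\le k\le n_0,\ t>0),\qquad p_{n_0+1}=0,\qquad p_k(0)=\begin{cases}1,&k=n_0,\\0,&k<n_0.\end{cases}$$ Let $M(t)$, $t\ge0$, be the classical linear death process with $n_0$ initial individuals: the time-homogeneous Markov chain with $M(0)=n_0$ and almost surely right-continuous paths whose transition probabilities from each state $i$ solve the same system with $\nu=1$ and $n_0$ replaced by $i$. Let $T_{2\nu}(t)\ge 0$, $t>0$, be random times, defined on the same probability space as $M$, such that for each $t>0$ the variable $T_{2\nu}(t)$ is independent of $M$ and has the distribution $\rho_t$. Then, for every $t>0$, $M^\nu(t)$ and $M(T_{2\nu}(t))$ have the same distribution: $$M^\nu(t)\overset{i.d.}{=}M(T_{2\nu}(t)).$$ -/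

import Mathlib

open MeasureTheory ProbabilityTheory Filter Topology Set
open scoped NNReal ENNReal

noncomputable section

/-- The Dzhrbashyan-Caputo derivative of order `α > 0` of `f`, started at time `0`. With
`n = ⌈α⌉` it is the ordinary derivative `f⁽ⁿ⁾(t)` when `α = n`, and
`1 / Γ(n - α) * ∫₀ᵗ f⁽ⁿ⁾(s) (t - s)^(n - α - 1) ds` otherwise. For `t > 0` it depends only on the
values of `f` on `(0, ∞)`. -/
def caputoDeriv (α : ℝ) (f : ℝ → ℝ) (t : ℝ) : ℝ :=
  if α = (⌈α⌉₊ : ℝ) then iteratedDeriv ⌈α⌉₊ f t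
  else 1 / Real.Gamma ((⌈α⌉₊ : ℝ) - α) *
    ∫ s in (0 : ℝ)..t, iteratedDeriv ⌈α⌉₊ f s * (t - s) ^ ((⌈α⌉₊ : ℝ) - α - 1)

/-- The expression `caputoDeriv α f t` is meaningful for every `t > 0`: `f` is continuous on
`[0, ∞)` and `n = ⌈α⌉` times differentiable on `(0, ∞)`, its `n`-th derivative is integrable on
`(0, t)` for every `t > 0` (so that `f⁽ᵏ⁾(0+)` exists for `k < n`), and so is, for noninteger `α`,
the integrand of the fractional derivative. -/
structure CaputoDifferentiable (α : ℝ) (f : ℝ → ℝ) : Prop where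
  continuousOn : ContinuousOn f (Ici 0)
  differentiableOn : ∀ k < ⌈α⌉₊, DifferentiableOn ℝ (iteratedDeriv k f) (Ioi 0)
  integrable : ∀ t > 0, IntervalIntegrable (iteratedDeriv ⌈α⌉₊ f) volume 0 t
  integrable_kernel : α ≠ (⌈α⌉₊ : ℝ) → ∀ t > 0,
    IntervalIntegrable
      (fun s => iteratedDeriv ⌈α⌉₊ f s * (t - s) ^ ((⌈α⌉₊ : ℝ) - α - 1)) volume 0 t

/-- The family `(p k)` of functions of time solves the Cauchy problem for the state
probabilities of the linear death process of order `ν`, rate `μ` and `n₀` initial individuals: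
`d^ν p_k / dt^ν = μ (k + 1) p_{k+1} - μ k p_k` for `0 ≤ k ≤ n₀` and `t > 0`,
with `p_k(0) = 1` if `k = n₀`, `p_k(0) = 0` if `k < n₀`, and `p_k = 0` for `k > n₀`. -/
structure SolvesLinearDeathSystem (ν μ : ℝ) (n₀ : ℕ) (p : ℕ → ℝ → ℝ) : Prop where
  regular : ∀ k ≤ n₀, CaputoDifferentiable ν (p k)
  initial : ∀ k ≤ n₀, p k 0 = if k = n₀ then 1 else 0
  zero_above : ∀ k > n₀, ∀ t ≥ 0, p k t = 0
  equation : ∀ k ≤ n₀, ∀ t > 0,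
    caputoDeriv ν (p k) t = μ * ((k : ℝ) + 1) * p (k + 1) t - μ * (k : ℝ) * p k t

/-- `M` is a fractional linear death process of order `ν`, with death rates `μ k` and `n₀`
initial individuals: its state probabilities `p_k(t) = P(M(t) = k)` solve the Cauchy problem
with the Dzhrbashyan-Caputo derivative of order `ν`. (This prescribes its one-dimensional
distributions, and nothing else.) -/
structure IsFractionalLinearDeathProcess {Ω : Type*} [MeasurableSpace Ω] (ν μ : ℝ) (n₀ : ℕ)
    (M : ℝ≥0 → Ω → ℕ) (P : Measure Ω) : Prop where
  measurable : ∀ t, Measurable (M t)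
  state_prob : SolvesLinearDeathSystem ν μ n₀ (fun k t => P.real {ω | M t.toNNReal ω = k})

/-- `M` is the classical linear death process with death rates `μ k` and `n₀` initial individuals:
the time-homogeneous Markov chain in continuous time with almost surely right-continuous paths
which starts at `n₀` and whose transition probabilities `p i k t` (from `i` to `k` in time `t`)
solve the forward equations `d/dt p i k = μ (k + 1) p i (k + 1) - μ k p i k`. The Markov property
is expressed through the finite-dimensional distributions. -/
structure IsLinearDeathProcess {Ω : Type*} [MeasurableSpace Ω] (μ : ℝ) (n₀ : ℕ)
    (M : ℝ≥0 → Ω → ℕ) (P : Measure Ω) : Prop where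
  measurable : ∀ t, Measurable (M t)
  right_continuous : ∀ᵐ ω ∂P, ∀ t, ContinuousWithinAt (fun s => M s ω) (Ici t) t
  markov : ∃ p : ℕ → ℕ → ℝ → ℝ, (∀ i, SolvesLinearDeathSystem 1 μ i (p i)) ∧
    ∀ (m : ℕ) (t : Fin (m + 1) → ℝ≥0) (k : Fin (m + 1) → ℕ), Monotone t → t 0 = 0 →
      P.real {ω | ∀ i, M (t i) ω = k i} =
        (if k 0 = n₀ then 1 else 0) *
          ∏ i : Fin m, p (k i.castSucc) (k i.succ) ((t i.succ : ℝ) - (t i.castSucc : ℝ))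

/-- The family `u t = q(·, t)`, `t ≥ 0`, of probability distributions on the line solves the Cauchy
problem `∂^{2ν} q / ∂t^{2ν} = ∂² q / ∂s²`, `q(s, 0) = δ(s)`, with the additional condition
`q_t(s, 0) = 0` when `ν > 1/2`. The time derivative is the Dzhrbashyan-Caputo derivative; the
equation is understood in the sense of distributions in the space variable `s`, that is, after
pairing with an arbitrary test function `φ`. Measures are used instead of functions because of the
initial datum, and because for `ν = 1` the solution is not a function. -/
structure IsFractionalDiffusion (ν : ℝ) (u : ℝ≥0 → Measure ℝ) : Prop where
  isProbabilityMeasure : ∀ t, IsProbabilityMeasure (u t)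
  initial : u 0 = Measure.dirac 0
  regular : ∀ φ : ℝ → ℝ, ContDiff ℝ (⊤ : ℕ∞) φ → HasCompactSupport φ →
    CaputoDifferentiable (2 * ν) (fun t => ∫ s, φ s ∂(u t.toNNReal))
  initial_deriv : 1 / 2 < ν → ∀ φ : ℝ → ℝ, ContDiff ℝ (⊤ : ℕ∞) φ → HasCompactSupport φ →
    Tendsto (deriv (fun t : ℝ => ∫ s, φ s ∂(u t.toNNReal))) (𝓝[>] 0) (𝓝 0)
  equation : ∀ φ : ℝ → ℝ, ContDiff ℝ (⊤ : ℕ∞) φ → HasCompactSupport φ → ∀ t > 0,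
    caputoDeriv (2 * ν) (fun t => ∫ s, φ s ∂(u t.toNNReal)) t =
      ∫ s, iteratedDeriv 2 φ s ∂(u t.toNNReal)

/-- The folding of a distribution on the line at the origin: the law of `|X|` when `X` has law `ρ`.
If `ρ` has an even density `q`, the folded distribution has the density `2 q` on `(0, ∞)`. -/
def folded (ρ : Measure ℝ) : Measure ℝ := ρ.map (fun s => |s|)

end

/-! ### Uniqueness for Laplace transforms of bounded functions -/

noncomputable section

/-! Everything rests on one substitution: replacing the Laplace variable `z` by `z ^ ν` turns a
classical equation into its fractional counterpart. On the probabilistic side this is done by the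
inverse of the stable subordinator of index `ν`, which at time `t` is distributed as `t ^ ν X` and
whose law has Laplace transform `z ^ (ν - 1) * exp (-s * z ^ ν)` in `t`. The predicate
`IsMittagLefflerLaw` records exactly this property of the law of `X`.

Such a law is constructed by hand. Suitably rescaled sums of Sibuya variables converge to the
one-sided stable law (`exists_stable_law`). Its characteristic function is integrable, so it has a
density `g` (`exists_stable_density`), and a change of variables in `g` gives the density of the
inverse subordinator (`exists_isMittagLefflerLaw_density`). For `ν = 1` the law is a Dirac mass.

Uniqueness for the diffusion equation: a Caputo equation with the given initial data is a Volterra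
equation with the fractional integral (`CaputoDifferentiable.eq_add_fracInt`). Cutoffs extend it
from test functions to `cos (ξ s)` and `sin (ξ s)`, which are eigenfunctions of the second
derivative, so the difference of two solutions satisfies `D = -ξ² I^{2ν} D`. The Laplace transform
forces `D = 0`, and the characteristic functions agree (`IsFractionalDiffusion.unique`).

Existence: the law of `t ^ ν X` with a symmetric random sign is a solution
(`isFractionalDiffusion_diffusionLaw`). Against a test function only the even part `ψ` matters; two
integrations by parts with `ψ'(0) = 0` match the Laplace transforms of the two sides. By uniqueness
every solution folds to the law of `t ^ ν X`, which gives the density and the transform.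

Subordination: the Laplace transforms of the death probabilities satisfy a triangular linear system
in which `ν` enters only through `z ^ ν` and a factor `z ^ (ν - 1)`. Hence the fractional
probabilities are the averages of the classical ones over the law of `t ^ ν X`
(`SolvesLinearDeathSystem.eq_integral`). These averages are the state probabilities of the classical
process at an independent time, because its paths are right-continuous (`measure_eval`). -/

theorem integrableOn_exp_neg_mul {z : ℝ} (hz : 0 < z) :
    IntegrableOn (fun t : ℝ => Real.exp (-z * t)) (Ioi 0) :=
  integrableOn_exp_mul_Ioi (by linarith) 0

theorem integrableOn_exp_neg_mul_of_bounded {z C : ℝ} (hz : 0 < z) {D : ℝ → ℝ}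
    (hD : AEStronglyMeasurable D (volume.restrict (Ioi 0))) (hC : ∀ t > 0, |D t| ≤ C) :
    IntegrableOn (fun t : ℝ => Real.exp (-z * t) * D t) (Ioi 0) := by
  refine (integrableOn_exp_neg_mul hz).mul_bdd (c := C) hD ?_
  filter_upwards [ae_restrict_mem measurableSet_Ioi] with t ht using hC t ht

theorem integral_exp_neg_mul_Ioi {z : ℝ} (hz : 0 < z) :
    ∫ t in Ioi (0 : ℝ), Real.exp (-z * t) = 1 / z := by
  rw [integral_exp_mul_Ioi (by linarith)]
  simp

/-- A bounded function on `(0, ∞)` whose Laplace transform vanishes is zero almost everywhere. -/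
theorem ae_eq_zero_of_laplace_eq_zero {C : ℝ} {D : ℝ → ℝ}
    (hD : AEStronglyMeasurable D (volume.restrict (Ioi 0))) (hC : ∀ t > 0, |D t| ≤ C)
    (h0 : ∀ z > 0, ∫ t in Ioi (0 : ℝ), Real.exp (-z * t) * D t = 0) :
    ∀ᵐ t ∂(volume.restrict (Ioi (0 : ℝ))), D t = 0 := by
  have hint := fun z (hz : (0 : ℝ) < z) => integrableOn_exp_neg_mul_of_bounded hz hD hC
  have hC0 : 0 ≤ C := (abs_nonneg _).trans (hC 1 one_pos)
  -- The extra factor `exp (-t)` shifts the exponent of a monomial to `n + 1 > 0`, where `h0`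
  -- applies even for constants.
  have hpoly : ∀ p : Polynomial ℝ,
      IntegrableOn (fun t : ℝ => p.eval (Real.exp (-t)) * (Real.exp (-1 * t) * D t)) (Ioi 0) ∧
      ∫ t in Ioi (0 : ℝ), p.eval (Real.exp (-t)) * (Real.exp (-1 * t) * D t) = 0 := by
    intro p
    induction p using Polynomial.induction_on' with
    | add p q hp hq =>
      simp only [Polynomial.eval_add, add_mul]
      exact ⟨hp.1.add hq.1, by rw [integral_add hp.1 hq.1, hp.2, hq.2, add_zero]⟩
    | monomial n a =>
      have : ∀ t : ℝ, (Polynomial.monomial n a).eval (Real.exp (-t)) * (Real.exp (-1 * t) * D t) =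
          a * (Real.exp (-((n : ℝ) + 1) * t) * D t) := by
        intro t
        rw [Polynomial.eval_monomial, ← Real.exp_nat_mul]
        rw [show -((n : ℝ) + 1) * t = n * -t + -1 * t by ring, Real.exp_add]
        ring
      simp only [this]
      refine ⟨(hint _ (by positivity)).const_mul a, ?_⟩
      rw [integral_const_mul, h0 _ (by positivity), mul_zero]
  have hcont : ∀ h : ℝ → ℝ, ContinuousOn h (Icc 0 1) →
      ∫ t in Ioi (0 : ℝ), h (Real.exp (-t)) * (Real.exp (-1 * t) * D t) = 0 := by
    intro h hh
    have hbound : ∀ ε > 0,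
        |∫ t in Ioi (0 : ℝ), h (Real.exp (-t)) * (Real.exp (-1 * t) * D t)| ≤ ε * C := by
      intro ε hε
      obtain ⟨p, hp⟩ := exists_polynomial_near_of_continuousOn 0 1 h hh ε hε
      have hmem : ∀ t ∈ Ioi (0 : ℝ), Real.exp (-t) ∈ Icc (0 : ℝ) 1 := fun t ht =>
        ⟨(Real.exp_pos _).le, Real.exp_le_one_iff.2 (by simpa using (le_of_lt ht))⟩
      have hmeas : AEStronglyMeasurable (fun t : ℝ => h (Real.exp (-t)))
          (volume.restrict (Ioi 0)) :=
        ContinuousOn.aestronglyMeasurable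
          (hh.comp (by fun_prop) hmem) measurableSet_Ioi
      obtain ⟨K, hK⟩ := isCompact_Icc.exists_bound_of_continuousOn hh
      have hi : IntegrableOn (fun t : ℝ => h (Real.exp (-t)) * (Real.exp (-1 * t) * D t))
          (Ioi 0) := by
        refine (hint 1 one_pos).bdd_mul (c := K) hmeas ?_
        filter_upwards [ae_restrict_mem measurableSet_Ioi] with t ht using hK _ (hmem t ht)
      have heq : ∫ t in Ioi (0 : ℝ), h (Real.exp (-t)) * (Real.exp (-1 * t) * D t) =
          ∫ t in Ioi (0 : ℝ),
            (h (Real.exp (-t)) - p.eval (Real.exp (-t))) * (Real.exp (-1 * t) * D t) := by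
        simp only [sub_mul]
        rw [integral_sub hi (hpoly p).1, (hpoly p).2, sub_zero]
      rw [heq, ← Real.norm_eq_abs]
      calc _ ≤ ∫ t in Ioi (0 : ℝ), ε * C * Real.exp (-1 * t) := by
            refine norm_integral_le_of_norm_le
              ((integrableOn_exp_neg_mul one_pos).const_mul _) ?_
            filter_upwards [ae_restrict_mem measurableSet_Ioi] with t ht
            rw [norm_mul, norm_mul, Real.norm_eq_abs, Real.norm_eq_abs, Real.norm_eq_abs,
              Real.abs_exp]
            have h1 := (hp _ (hmem t ht)).le
            rw [abs_sub_comm] at h1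
            have h2 := hC t ht
            have := mul_le_mul h1 h2 (abs_nonneg _) hε.le
            nlinarith [Real.exp_pos (-1 * t)]
        _ = ε * C := by
            rw [integral_const_mul, integral_exp_neg_mul_Ioi one_pos]; ring
    by_contra hne
    have hpos := abs_pos.2 hne
    -- With this `ε` a nonzero integral would be at most half of itself; `C + 1` avoids division by
    -- zero.
    have := hbound (|∫ t in Ioi (0 : ℝ), h (Real.exp (-t)) * (Real.exp (-1 * t) * D t)| /
      (2 * (C + 1))) (by positivity)
    rw [div_mul_eq_mul_div, le_div_iff₀ (by positivity)] at this
    nlinarith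
  have hloc : LocallyIntegrableOn D (Ioi 0) := by
    rw [locallyIntegrableOn_iff isOpen_Ioi.isLocallyClosed]
    intro k hk hkc
    have := hkc.measure_lt_top (μ := (volume : Measure ℝ))
    refine IntegrableOn.of_bound this (hD.mono_measure (Measure.restrict_mono hk le_rfl)) C ?_
    filter_upwards [ae_restrict_mem hkc.measurableSet] with t ht using hC t (hk ht)
  have := isOpen_Ioi.ae_eq_zero_of_integral_contDiff_smul_eq_zero hloc (fun g hg hgc hgs => ?_)
  · rwa [ae_restrict_iff' measurableSet_Ioi]
  · have hg0 : ∀ t ∉ Ioi (0 : ℝ), g t = 0 := fun t ht => by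
      by_contra hne
      exact ht (hgs (subset_tsupport _ hne))
    obtain ⟨T, hT⟩ := hgc.isCompact.bddAbove
    have hgT : ∀ t > T, g t = 0 := fun t ht => by
      by_contra hne
      exact absurd (hT (subset_tsupport _ hne)) (not_le.2 ht)
    -- Under `y = exp (-t)` this function is `g t * exp t`, which cancels the weight. It vanishes
    -- near `y = 0` because `g` vanishes for large `t`.
    have key := hcont (fun y => g (-Real.log y) / y) (by
      intro y hy
      rcases hy.1.eq_or_lt with rfl | hy0
      · have : (fun y => g (-Real.log y) / y) =ᶠ[𝓝[Icc 0 1] (0 : ℝ)] fun _ => 0 := by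
          have h1 : ∀ᶠ y in 𝓝[Icc 0 1] (0 : ℝ), y < Real.exp (-T) :=
            mem_nhdsWithin_of_mem_nhds (Iio_mem_nhds (Real.exp_pos _))
          filter_upwards [h1, self_mem_nhdsWithin] with y hy1 hy2
          rcases hy2.1.eq_or_lt with rfl | hy0
          · simp
          · rw [hgT, zero_div]
            have := (Real.log_lt_iff_lt_exp hy0).2 hy1
            linarith
        exact ContinuousWithinAt.congr_of_eventuallyEq continuousWithinAt_const this (by simp)
      · refine ContinuousAt.continuousWithinAt ?_
        exact (ContinuousAt.comp (f := fun y => -Real.log y) hg.continuous.continuousAt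
          (Real.continuousAt_log hy0.ne').neg).div continuousAt_id hy0.ne')
    rw [← key, ← setIntegral_eq_integral_of_forall_compl_eq_zero (s := Ioi (0 : ℝ))
      (fun t ht => by simp [hg0 t ht])]
    refine setIntegral_congr_fun measurableSet_Ioi fun t _ => ?_
    simp only [Real.log_exp, neg_neg, smul_eq_mul, neg_one_mul]
    field_simp

theorem eq_zero_of_ae_eq_zero_of_continuousOn {D : ℝ → ℝ} (hD : ContinuousOn D (Ioi 0))
    (h : ∀ᵐ t ∂(volume.restrict (Ioi (0 : ℝ))), D t = 0) : ∀ t > 0, D t = 0 := by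
  have := Measure.eqOn_open_of_ae_eq (f := D) (g := fun _ => 0) h isOpen_Ioi hD continuousOn_const
  exact fun t ht => this ht

theorem eq_of_laplace_eq {C : ℝ} {F G : ℝ → ℝ} (hF : ContinuousOn F (Ioi 0))
    (hG : ContinuousOn G (Ioi 0)) (hFC : ∀ t > 0, |F t| ≤ C) (hGC : ∀ t > 0, |G t| ≤ C)
    (h : ∀ z > 0, ∫ t in Ioi (0 : ℝ), Real.exp (-z * t) * F t =
      ∫ t in Ioi (0 : ℝ), Real.exp (-z * t) * G t) : ∀ t > 0, F t = G t := by
  have hFm := hF.aestronglyMeasurable (μ := volume) measurableSet_Ioi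
  have hGm := hG.aestronglyMeasurable (μ := volume) measurableSet_Ioi
  have hsub := ae_eq_zero_of_laplace_eq_zero (D := fun t => F t - G t) (C := C + C) (hFm.sub hGm)
    (fun t ht => (abs_sub _ _).trans (add_le_add (hFC t ht) (hGC t ht))) (fun z hz => by
      simp only [mul_sub]
      rw [integral_sub (integrableOn_exp_neg_mul_of_bounded hz hFm hFC)
        (integrableOn_exp_neg_mul_of_bounded hz hGm hGC), h z hz, sub_self])
  intro t ht
  exact sub_eq_zero.1 (eq_zero_of_ae_eq_zero_of_continuousOn (hF.sub hG) hsub t ht)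

end

/-! ### Riemann-Liouville integrals: beta integral, semigroup property, Laplace transform -/

noncomputable section

/-- The Riemann-Liouville fractional integral of order `a`. -/
def fracInt (a : ℝ) (ψ : ℝ → ℝ) (t : ℝ) : ℝ :=
  1 / Real.Gamma a * ∫ s in (0 : ℝ)..t, ψ s * (t - s) ^ (a - 1)

/-- The power kernel `x ^ (a - 1)` on the half-line, extended by zero. -/
def powKernel (a x : ℝ) : ℝ := if 0 < x then x ^ (a - 1) else 0

theorem powKernel_nonneg (a x : ℝ) : 0 ≤ powKernel a x := by
  unfold powKernel; split_ifs with h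
  · positivity
  · exact le_rfl

theorem measurable_powKernel (a : ℝ) : Measurable (powKernel a) :=
  Measurable.ite measurableSet_Ioi (by fun_prop) measurable_const

theorem powKernel_of_pos {x : ℝ} (a : ℝ) (h : 0 < x) : powKernel a x = x ^ (a - 1) := if_pos h

theorem powKernel_of_nonpos {x : ℝ} (a : ℝ) (h : x ≤ 0) : powKernel a x = 0 :=
  if_neg (not_lt.2 h)

theorem intervalIntegrable_beta {a b y : ℝ} (ha : 0 < a) (hb : 0 < b) (hy : 0 < y) :
    IntervalIntegrable (fun x : ℝ => x ^ (b - 1) * (y - x) ^ (a - 1)) volume 0 y := by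
  have h1 : IntervalIntegrable (fun x : ℝ => x ^ (b - 1) * (1 - x) ^ (a - 1)) volume 0 1 := by
    have := (Complex.betaIntegral_convergent (u := b) (v := a) (by simpa) (by simpa))
    rw [intervalIntegrable_iff_integrableOn_Ioc_of_le zero_le_one] at this ⊢
    refine (IntegrableOn.congr_fun this.re (fun x hx => ?_) measurableSet_Ioc)
    have h2 : (x : ℂ) ^ ((b : ℂ) - 1) * (1 - (x : ℂ)) ^ ((a : ℂ) - 1) =
        ((x ^ (b - 1) * (1 - x) ^ (a - 1) : ℝ) : ℂ) := by
      rw [Complex.ofReal_mul, Complex.ofReal_cpow hx.1.le, Complex.ofReal_cpow (by linarith [hx.2])]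
      simp
    simp [h2]
  have h2 := (h1.comp_mul_left (c := y⁻¹)).const_mul (y ^ (b - 1) * y ^ (a - 1))
  simp only [zero_div, one_div, inv_inv] at h2
  refine h2.congr ?_
  rw [uIoc_of_le hy.le]
  intro x hx
  have h3 : 1 - y⁻¹ * x = y⁻¹ * (y - x) := by field_simp
  beta_reduce
  rw [h3, Real.mul_rpow (by positivity) hx.1.le, Real.mul_rpow (by positivity)
    (by linarith [hx.2]), Real.inv_rpow hy.le, Real.inv_rpow hy.le]
  have := Real.rpow_pos_of_pos hy (b - 1)
  have := Real.rpow_pos_of_pos hy (a - 1)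
  field_simp

theorem integral_beta {a b y : ℝ} (ha : 0 < a) (hb : 0 < b) (hy : 0 < y) :
    ∫ x in (0 : ℝ)..y, x ^ (b - 1) * (y - x) ^ (a - 1) =
      Real.Gamma a * Real.Gamma b / Real.Gamma (a + b) * y ^ (a + b - 1) := by
  have h1 := Complex.betaIntegral_scaled b a hy
  have h2 := Complex.Gamma_mul_Gamma_eq_betaIntegral (s := b) (t := a) (by simpa) (by simpa)
  have h3 : ∫ x in (0 : ℝ)..y, (x : ℂ) ^ ((b : ℂ) - 1) * ((y : ℂ) - x) ^ ((a : ℂ) - 1) =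
      ((∫ x in (0 : ℝ)..y, x ^ (b - 1) * (y - x) ^ (a - 1) : ℝ) : ℂ) := by
    rw [← intervalIntegral.integral_ofReal]
    refine intervalIntegral.integral_congr fun x hx => ?_
    rw [uIcc_of_le hy.le] at hx
    simp only [Complex.ofReal_mul]
    rw [Complex.ofReal_cpow hx.1, Complex.ofReal_cpow (by linarith [hx.2])]
    simp
  have hG : Real.Gamma (b + a) ≠ 0 := (Real.Gamma_pos_of_pos (by linarith)).ne'
  have h4 : (b : ℂ) + a = ((b + a : ℝ) : ℂ) := by simp
  have h5 : (b : ℂ) + a - 1 = ((b + a - 1 : ℝ) : ℂ) := by simp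
  rw [h3, h5, ← Complex.ofReal_cpow hy.le] at h1
  rw [h4, Complex.Gamma_ofReal, Complex.Gamma_ofReal, Complex.Gamma_ofReal] at h2
  have h6 : Complex.betaIntegral b a =
      ((Real.Gamma b * Real.Gamma a / Real.Gamma (b + a) : ℝ) : ℂ) := by
    rw [Complex.ofReal_div, eq_div_iff (by exact_mod_cast hG), Complex.ofReal_mul, h2, mul_comm]
  rw [h6, ← Complex.ofReal_mul] at h1
  rw [Complex.ofReal_injective h1, add_comm b a]
  ring

/-- The beta integral in convolution form. With kernels extended by zero all integrals run over the
whole line, so Fubini can be used without tracking variable limits. -/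
theorem integral_powKernel_mul {a b : ℝ} (ha : 0 < a) (hb : 0 < b) (t r : ℝ) :
    Integrable (fun s => powKernel a (t - s) * powKernel b (s - r)) ∧
    ∫ s, powKernel a (t - s) * powKernel b (s - r) =
      Real.Gamma a * Real.Gamma b / Real.Gamma (a + b) * powKernel (a + b) (t - r) := by
  set f : ℝ → ℝ := fun x => powKernel a ((t - r) - x) * powKernel b x with hf
  have hfs : (fun s => powKernel a (t - s) * powKernel b (s - r)) = fun s => f (s - r) := by
    funext s; simp [hf]
  have key : Integrable f ∧ ∫ x, f x =
      Real.Gamma a * Real.Gamma b / Real.Gamma (a + b) * powKernel (a + b) (t - r) := by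
    rcases le_or_gt (t - r) 0 with h | h
    · have : f = fun _ => 0 := by
        funext x
        rcases le_or_gt x 0 with hx | hx
        · simp [hf, powKernel_of_nonpos b hx]
        · simp [hf, powKernel_of_nonpos a (show t - r - x ≤ 0 by linarith)]
      rw [this]
      simp [powKernel_of_nonpos _ h]
    · set y := t - r
      have hind : f = indicator (Ioo 0 y) (fun x => x ^ (b - 1) * (y - x) ^ (a - 1)) := by
        funext x
        by_cases hx : x ∈ Ioo 0 y
        · rw [indicator_of_mem hx, hf]
          simp only [powKernel_of_pos b hx.1, powKernel_of_pos a (show 0 < y - x by linarith [hx.2])]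
          ring
        · rw [indicator_of_notMem hx, hf]
          rcases le_or_gt x 0 with hx0 | hx0
          · simp [powKernel_of_nonpos b hx0]
          · have : y ≤ x := by by_contra hc; exact hx ⟨hx0, not_le.1 hc⟩
            simp [powKernel_of_nonpos a (show y - x ≤ 0 by linarith)]
      rw [hind, integrable_indicator_iff measurableSet_Ioo, integral_indicator measurableSet_Ioo,
        ← integral_Ioc_eq_integral_Ioo, ← integrableOn_Ioc_iff_integrableOn_Ioo,
        ← intervalIntegral.integral_of_le h.le, integral_beta ha hb h, powKernel_of_pos _ h,
        ← intervalIntegrable_iff_integrableOn_Ioc_of_le h.le]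
      exact ⟨intervalIntegrable_beta ha hb h, rfl⟩
  rw [hfs]
  refine ⟨key.1.comp_sub_right r, ?_⟩
  rw [integral_sub_right_eq_self f r, key.2]

theorem fracInt_eq_integral (a : ℝ) (ψ : ℝ → ℝ) {t T : ℝ} (ht : 0 ≤ t) (hT : t ≤ T) :
    fracInt a ψ t =
      1 / Real.Gamma a * ∫ s, indicator (Ioc 0 T) ψ s * powKernel a (t - s) := by
  unfold fracInt
  congr 1
  rw [intervalIntegral.integral_of_le ht, integral_Ioc_eq_integral_Ioo,
    ← integral_indicator measurableSet_Ioo]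
  congr 1
  funext s
  by_cases hs : s ∈ Ioo 0 t
  · rw [indicator_of_mem hs, indicator_of_mem (show s ∈ Ioc 0 T from ⟨hs.1, hs.2.le.trans hT⟩),
      powKernel_of_pos _ (by linarith [hs.2])]
  · rw [indicator_of_notMem hs]
    by_cases hs0 : 0 < s
    · have : t ≤ s := by by_contra hc; exact hs ⟨hs0, not_le.1 hc⟩
      rw [powKernel_of_nonpos _ (by linarith), mul_zero]
    · rw [indicator_of_notMem (fun h => hs0 h.1), zero_mul]

/-- The semigroup property of fractional integration. -/
theorem fracInt_fracInt {a b t : ℝ} (ha : 0 < a) (hb : 0 < b) (hab : 1 ≤ a + b) (ht : 0 < t)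
    {ψ : ℝ → ℝ} (hψ : IntervalIntegrable ψ volume 0 t) :
    fracInt a (fracInt b ψ) t = fracInt (a + b) ψ t := by
  have hGa := (Real.Gamma_pos_of_pos ha).ne'
  have hGb := (Real.Gamma_pos_of_pos hb).ne'
  have hGab := (Real.Gamma_pos_of_pos (add_pos ha hb)).ne'
  set Ψ := indicator (Ioc 0 t) ψ with hΨdef
  have hΨ : Integrable Ψ := by
    rw [integrable_indicator_iff measurableSet_Ioc]
    exact (intervalIntegrable_iff_integrableOn_Ioc_of_le ht.le).1 hψ
  have hprod : Integrable (Function.uncurry fun s r =>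
      powKernel a (t - s) * powKernel b (s - r) * Ψ r) (volume.prod volume) := by
    have hm : AEStronglyMeasurable (Function.uncurry fun s r =>
        powKernel a (t - s) * powKernel b (s - r) * Ψ r) (volume.prod volume) := by
      refine AEStronglyMeasurable.mul (Measurable.aestronglyMeasurable ?_)
        hΨ.aestronglyMeasurable.comp_snd
      have h1 := measurable_powKernel a
      have h2 := measurable_powKernel b
      exact (h1.comp (by fun_prop)).mul (h2.comp (by fun_prop))
    rw [integrable_prod_iff' hm]
    refine ⟨ae_of_all _ fun r => (integral_powKernel_mul ha hb t r).1.mul_const (Ψ r), ?_⟩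
    simp only [Function.uncurry_apply_pair, norm_mul, Real.norm_of_nonneg (powKernel_nonneg _ _)]
    simp only [integral_mul_const, (integral_powKernel_mul ha hb t _).2]
    have hB : 0 ≤ Real.Gamma a * Real.Gamma b / Real.Gamma (a + b) :=
      div_nonneg (mul_nonneg (Real.Gamma_pos_of_pos ha).le (Real.Gamma_pos_of_pos hb).le)
        (Real.Gamma_pos_of_pos (add_pos ha hb)).le
    -- Since `1 ≤ a + b`, the composed kernel is not singular: on `(0, t]` it is at most `t ^ (a + b
    -- - 1)`.
    refine (hΨ.norm.const_mul (Real.Gamma a * Real.Gamma b / Real.Gamma (a + b) *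
      t ^ (a + b - 1))).mono' ?_ (ae_of_all _ fun r => ?_)
    · have h1 := measurable_powKernel (a + b)
      exact AEStronglyMeasurable.mul
        (((h1.comp (by fun_prop : Measurable fun r : ℝ => t - r)).const_mul _).aestronglyMeasurable)
        hΨ.aestronglyMeasurable.norm
    · rw [norm_mul, norm_norm, norm_mul, Real.norm_of_nonneg hB,
        Real.norm_of_nonneg (powKernel_nonneg _ _)]
      by_cases hr : r ∈ Ioc 0 t
      · gcongr
        rcases hr.2.eq_or_lt with rfl | hlt
        · rw [powKernel_of_nonpos _ (by simp)]; positivity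
        · rw [powKernel_of_pos _ (by linarith)]
          exact Real.rpow_le_rpow (by linarith) (by linarith [hr.1]) (by linarith)
      · rw [hΨdef, indicator_of_notMem hr]; simp
  have h1 : fracInt a (fracInt b ψ) t = 1 / Real.Gamma a * (1 / Real.Gamma b) *
      ∫ s, ∫ r, powKernel a (t - s) * powKernel b (s - r) * Ψ r := by
    rw [fracInt_eq_integral a _ ht.le le_rfl, mul_assoc]
    congr 1
    rw [← integral_const_mul]
    congr 1
    funext s
    by_cases hs : s ∈ Ioc 0 t
    · rw [indicator_of_mem hs, fracInt_eq_integral b ψ hs.1.le hs.2, mul_assoc,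
        ← integral_mul_const]
      congr 2
      funext r
      rw [hΨdef]
      ring
    · rw [indicator_of_notMem hs, zero_mul]
      symm
      rw [mul_eq_zero]; right
      refine integral_eq_zero_of_ae (ae_of_all _ fun r => ?_)
      simp only [Pi.zero_apply]
      by_cases hs0 : 0 < s
      · have : t < s := by by_contra hc; exact hs ⟨hs0, not_lt.1 hc⟩
        rw [powKernel_of_nonpos _ (by linarith)]; simp
      · by_cases hr : r ∈ Ioc 0 t
        · rw [powKernel_of_nonpos b (by linarith [hr.1, not_lt.1 hs0])]; simp
        · rw [hΨdef, indicator_of_notMem hr]; simp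
  rw [h1, integral_integral_swap hprod, fracInt_eq_integral _ ψ ht.le le_rfl]
  simp only [integral_mul_const, (integral_powKernel_mul ha hb t _).2]
  rw [← integral_const_mul, ← integral_const_mul]
  congr 1
  funext r
  rw [← hΨdef]
  field_simp

/-- The Laplace transform of a fractional integral. -/
theorem laplace_fracInt {a z C : ℝ} (ha : 0 < a) (hz : 0 < z) {ψ : ℝ → ℝ}
    (hψ : AEStronglyMeasurable ψ (volume.restrict (Ioi 0))) (hC : ∀ t > 0, |ψ t| ≤ C) :
    IntegrableOn (fun t => Real.exp (-z * t) * fracInt a ψ t) (Ioi 0) ∧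
    ∫ t in Ioi (0 : ℝ), Real.exp (-z * t) * fracInt a ψ t =
      z ^ (-a) * ∫ t in Ioi (0 : ℝ), Real.exp (-z * t) * ψ t := by
  have h1 := integrableOn_exp_neg_mul_of_bounded hz hψ hC
  have h2 : IntegrableOn (fun t : ℝ => Real.exp (-z * t) * t ^ (a - 1)) (Ioi 0) := by
    have := integrableOn_rpow_mul_exp_neg_mul_rpow (p := 1) (s := a - 1) (by linarith) one_pos hz
    refine this.congr_fun (fun t _ => ?_) measurableSet_Ioi
    simp [mul_comm]
  have h3 : ∫ t in Ioi (0 : ℝ), Real.exp (-z * t) * t ^ (a - 1) = z ^ (-a) * Real.Gamma a := by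
    have := Real.integral_rpow_mul_exp_neg_mul_Ioi ha hz
    rw [Real.rpow_neg hz.le, ← Real.inv_rpow hz.le, ← one_div, ← this]
    refine setIntegral_congr_fun measurableSet_Ioi fun t _ => ?_
    simp [mul_comm]
  have hG := (Real.Gamma_pos_of_pos ha).ne'
  -- The weight is multiplicative, `exp (-z x) = exp (-z t) exp (-z (x - t))`, so the weighted
  -- fractional integral is itself a convolution of weighted functions.
  have heq : ∀ x : ℝ, ∫ t in (0 : ℝ)..x, (ContinuousLinearMap.mul ℝ ℝ (Real.exp (-z * t) * ψ t))
      (Real.exp (-z * (x - t)) * (x - t) ^ (a - 1)) =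
      Real.Gamma a * (Real.exp (-z * x) * fracInt a ψ x) := by
    intro x
    unfold fracInt
    rw [mul_left_comm, ← mul_assoc _ (1 / Real.Gamma a), mul_one_div, div_self hG, one_mul,
      ← intervalIntegral.integral_const_mul]
    refine intervalIntegral.integral_congr fun t _ => ?_
    simp only [ContinuousLinearMap.mul_apply']
    rw [show -z * x = -z * t + -z * (x - t) by ring, Real.exp_add]
    ring
  constructor
  · have := integrable_posConvolution h1 h2 (ContinuousLinearMap.mul ℝ ℝ)
    unfold posConvolution at this
    rw [integrable_indicator_iff measurableSet_Ioi] at this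
    simp only [heq] at this
    refine (this.const_mul (Real.Gamma a)⁻¹).congr (ae_of_all _ fun t => ?_)
    beta_reduce
    field_simp
  · have := integral_posConvolution h1 h2 (ContinuousLinearMap.mul ℝ ℝ)
    simp only [heq, integral_const_mul, h3] at this
    refine mul_left_cancel₀ hG (this.trans ?_)
    rw [ContinuousLinearMap.mul_apply']
    ring

end

/-! ### From Caputo equations to Volterra equations -/

noncomputable section

theorem fracInt_congr {a t : ℝ} (ht : 0 ≤ t) {ψ φ : ℝ → ℝ} (h : ∀ s ∈ Ioc 0 t, ψ s = φ s) :
    fracInt a ψ t = fracInt a φ t := by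
  unfold fracInt
  congr 1
  refine intervalIntegral.integral_congr_ae (ae_of_all _ fun s hs => ?_)
  rw [uIoc_of_le ht] at hs
  simp only [h s hs]

theorem fracInt_congr_ae {a t : ℝ} (ht : 0 ≤ t) {ψ φ : ℝ → ℝ}
    (h : ∀ᵐ s ∂(volume.restrict (Ioi (0 : ℝ))), ψ s = φ s) :
    fracInt a ψ t = fracInt a φ t := by
  unfold fracInt
  congr 1
  rw [ae_restrict_iff' measurableSet_Ioi] at h
  refine intervalIntegral.integral_congr_ae (h.mono fun s hs hst => ?_)
  rw [uIoc_of_le ht] at hst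
  simp only [hs hst.1]

theorem fracInt_one (ψ : ℝ → ℝ) (t : ℝ) : fracInt 1 ψ t = ∫ s in (0 : ℝ)..t, ψ s := by
  simp [fracInt]

theorem fracInt_const_mul (a c t : ℝ) (ψ : ℝ → ℝ) :
    fracInt a (fun s => c * ψ s) t = c * fracInt a ψ t := by
  simp only [fracInt, mul_assoc, intervalIntegral.integral_const_mul]
  ring

theorem fracInt_zero (a t : ℝ) : fracInt a (fun _ => 0) t = 0 := by simp [fracInt]

theorem intervalIntegrable_const_sub_rpow {a t : ℝ} (ha : 0 < a) :
    IntervalIntegrable (fun s : ℝ => (t - s) ^ (a - 1)) volume 0 t := by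
  have := (intervalIntegral.intervalIntegrable_rpow' (a := 0) (b := t)
    (show -1 < a - 1 by linarith)).comp_sub_left t
  simpa using this.symm

/-- A bounded measurable function has an absolutely convergent fractional integral. -/
theorem intervalIntegrable_fracInt_integrand {a t C : ℝ} (ha : 0 < a) (ht : 0 ≤ t) {ψ : ℝ → ℝ}
    (hψ : AEStronglyMeasurable ψ (volume.restrict (Ioi 0))) (hC : ∀ t > 0, |ψ t| ≤ C) :
    IntervalIntegrable (fun s => ψ s * (t - s) ^ (a - 1)) volume 0 t := by
  have h := intervalIntegrable_const_sub_rpow (t := t) ha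
  rw [intervalIntegrable_iff_integrableOn_Ioc_of_le ht] at h ⊢
  refine h.bdd_mul (c := C) (hψ.mono_measure (Measure.restrict_mono (fun s hs => hs.1) le_rfl)) ?_
  filter_upwards [ae_restrict_mem measurableSet_Ioc] with s hs using hC s hs.1

theorem caputoDeriv_of_eq {α : ℝ} (h : α = (⌈α⌉₊ : ℝ)) (f : ℝ → ℝ) (t : ℝ) :
    caputoDeriv α f t = iteratedDeriv ⌈α⌉₊ f t := if_pos h

theorem caputoDeriv_of_ne {α : ℝ} (h : α ≠ (⌈α⌉₊ : ℝ)) (f : ℝ → ℝ) (t : ℝ) :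
    caputoDeriv α f t = fracInt (⌈α⌉₊ - α) (iteratedDeriv ⌈α⌉₊ f) t := if_neg h

/-- The orders `α` and `⌈α⌉ - α` add up to the integer `⌈α⌉`, so the semigroup property leaves an
ordinary repeated integral, from which `F` is recovered by the fundamental theorem of calculus. -/
theorem fracInt_caputoDeriv {α t : ℝ} (hα : 0 < α) (ht : 0 < t) {F : ℝ → ℝ}
    (hF : IntervalIntegrable (iteratedDeriv ⌈α⌉₊ F) volume 0 t) :
    fracInt α (caputoDeriv α F) t = fracInt ⌈α⌉₊ (iteratedDeriv ⌈α⌉₊ F) t := by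
  by_cases h : α = (⌈α⌉₊ : ℝ)
  · rw [fracInt_congr ht.le (fun s _ => caputoDeriv_of_eq h F s), ← h]
  · rw [fracInt_congr ht.le (fun s _ => caputoDeriv_of_ne h F s)]
    have h1 : α < ⌈α⌉₊ := lt_of_le_of_ne (Nat.le_ceil α) h
    have h2 : (1 : ℝ) ≤ ⌈α⌉₊ := by exact_mod_cast Nat.one_le_ceil_iff.2 hα
    rw [fracInt_fracInt hα (sub_pos.2 h1) (by linarith) ht hF]
    congr 1
    ring

theorem eq_add_integral_deriv {F F' : ℝ → ℝ} {t : ℝ} (ht : 0 < t) (hF : ContinuousOn F (Ici 0))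
    (hd : ∀ s > 0, HasDerivAt F (F' s) s)
    (hi : IntervalIntegrable F' volume 0 t) : F t = F 0 + ∫ s in (0 : ℝ)..t, F' s := by
  rw [intervalIntegral.integral_eq_sub_of_hasDerivAt_of_le ht.le (hF.mono Icc_subset_Ici_self)
    (fun s hs => hd s hs.1) hi]
  ring

/-- The integral form of an equation with a Dzhrbashyan-Caputo derivative of order at most `2`. -/
theorem CaputoDifferentiable.eq_add_fracInt {α : ℝ} (hα : 0 < α) (hα2 : α ≤ 2) {F : ℝ → ℝ}
    (hF : CaputoDifferentiable α F) (hF0 : 1 < α → Tendsto (deriv F) (𝓝[>] 0) (𝓝 0))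
    {t : ℝ} (ht : 0 < t) : F t = F 0 + fracInt α (caputoDeriv α F) t := by
  rw [fracInt_caputoDeriv hα ht (hF.integrable t ht)]
  rcases le_or_gt α 1 with h1 | h1
  · have hn : ⌈α⌉₊ = 1 := by
      rw [Nat.ceil_eq_iff one_ne_zero]; simpa using ⟨hα, h1⟩
    rw [hn, Nat.cast_one, fracInt_one]
    refine eq_add_integral_deriv ht hF.continuousOn (fun s hs => ?_) (hn ▸ hF.integrable t ht)
    rw [iteratedDeriv_one]
    have := hF.differentiableOn 0 (by omega)
    rw [iteratedDeriv_zero] at this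
    exact (this.differentiableAt (Ioi_mem_nhds hs)).hasDerivAt
  · have hn : ⌈α⌉₊ = 2 := by
      rw [Nat.ceil_eq_iff two_ne_zero]; simpa using ⟨h1, hα2⟩
    have hint := fun t ht => hF.integrable t ht
    have hd0 := hF.differentiableOn 0 (by omega)
    have hd1 := hF.differentiableOn 1 (by omega)
    rw [iteratedDeriv_zero] at hd0
    rw [iteratedDeriv_one] at hd1
    rw [hn] at hint ⊢
    have hF2 : iteratedDeriv 2 F = deriv (deriv F) := by
      rw [iteratedDeriv_succ, iteratedDeriv_one]
    -- Here `hF0` enters: it removes the term `t * F'(0+)` of Taylor's formula.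
    have hF' : ∀ s > 0, deriv F s = fracInt 1 (iteratedDeriv 2 F) s := by
      intro s hs
      have hds : ∀ r > 0, HasDerivAt (deriv F) (deriv (deriv F) r) r := fun r hr =>
        (hd1.differentiableAt (Ioi_mem_nhds hr)).hasDerivAt
      rw [fracInt_one, hF2, intervalIntegral.integral_eq_sub_of_hasDerivAt_of_tendsto hs
        (fun r hr => hds r hr.1) (hF2 ▸ hint s hs) (hF0 h1)
        ((hds s hs).continuousAt.tendsto.mono_left nhdsWithin_le_nhds), sub_zero]
    have hi : IntervalIntegrable (deriv F) volume 0 t := by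
      have : IntervalIntegrable (fun s => ∫ r in (0 : ℝ)..s, iteratedDeriv 2 F r) volume 0 t :=
        (intervalIntegral.continuousOn_primitive_interval (by
          rw [uIcc_of_le ht.le, integrableOn_Icc_iff_integrableOn_Ioc]
          exact (intervalIntegrable_iff_integrableOn_Ioc_of_le ht.le).1
            (hint t ht))).intervalIntegrable
      refine this.congr fun s hs => ?_
      rw [uIoc_of_le ht.le] at hs
      simp only [hF' s hs.1, fracInt_one]
    rw [show ((2 : ℕ) : ℝ) = 1 + 1 by norm_num,
      ← fracInt_fracInt one_pos one_pos (by norm_num) ht (hint t ht),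
      ← fracInt_congr ht.le (fun s hs => hF' s hs.1), fracInt_one]
    exact eq_add_integral_deriv ht hF.continuousOn
      (fun s hs => (hd0.differentiableAt (Ioi_mem_nhds hs)).hasDerivAt) hi

/-- A bounded solution of the homogeneous Volterra equation `D = -c I^α D`, `c ≥ 0`, vanishes. -/
theorem eq_zero_of_eq_neg_mul_fracInt {α c C : ℝ} (hα : 0 < α) (hc : 0 ≤ c) {D : ℝ → ℝ}
    (hD : AEStronglyMeasurable D (volume.restrict (Ioi 0))) (hC : ∀ t > 0, |D t| ≤ C)
    (h : ∀ t > 0, D t = -c * fracInt α D t) : ∀ t > 0, D t = 0 := by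
  have hae := ae_eq_zero_of_laplace_eq_zero hD hC fun z hz => by
    have h1 := (laplace_fracInt hα hz hD hC).2
    have h2 : ∫ t in Ioi (0 : ℝ), Real.exp (-z * t) * D t =
        -c * ∫ t in Ioi (0 : ℝ), Real.exp (-z * t) * fracInt α D t := by
      rw [← integral_const_mul]
      refine setIntegral_congr_fun measurableSet_Ioi fun t ht => ?_
      rw [h t ht]; ring
    rw [h1] at h2
    have h3 : (1 + c * z ^ (-α)) * ∫ t in Ioi (0 : ℝ), Real.exp (-z * t) * D t = 0 := by
      linear_combination h2
    have : 0 < z ^ (-α) := Real.rpow_pos_of_pos hz _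
    exact (mul_eq_zero.1 h3).resolve_left (by positivity)
  intro t ht
  -- The equation expresses each value of `D` by an integral, so vanishing almost everywhere gives
  -- vanishing everywhere without continuity.
  rw [h t ht, fracInt_congr_ae ht.le hae, fracInt_zero, mul_zero]

end

/-! ### Uniqueness for the fractional diffusion equation -/

noncomputable section

theorem ContDiff.iteratedDeriv_two {φ : ℝ → ℝ} (hφ : ContDiff ℝ (⊤ : ℕ∞) φ) :
    ContDiff ℝ (⊤ : ℕ∞) (iteratedDeriv 2 φ) := by
  rw [iteratedDeriv_succ, iteratedDeriv_one]
  exact (contDiff_infty_iff_deriv.1 (contDiff_infty_iff_deriv.1 hφ).2).2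

theorem HasCompactSupport.iteratedDeriv_two {φ : ℝ → ℝ} (hφ : HasCompactSupport φ) :
    HasCompactSupport (iteratedDeriv 2 φ) := by
  rw [iteratedDeriv_succ, iteratedDeriv_one]
  exact hφ.deriv.deriv

/-- A smooth function with bounded derivatives is approximated by test functions, with locally
eventual equality and uniform bounds up to the second derivative. -/
theorem exists_testFunction_approx {θ : ℝ → ℝ} (hθ : ContDiff ℝ (⊤ : ℕ∞) θ) {K : ℝ}
    (hK : ∀ i ≤ 2, ∀ s, |iteratedDeriv i θ s| ≤ K) :
    ∃ (φ : ℕ → ℝ → ℝ) (K' : ℝ), (∀ n, ContDiff ℝ (⊤ : ℕ∞) (φ n)) ∧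
      (∀ n, HasCompactSupport (φ n)) ∧ (∀ n s, |φ n s| ≤ K') ∧
      (∀ n s, |iteratedDeriv 2 (φ n) s| ≤ K') ∧
      (∀ (n : ℕ) (s : ℝ), |s| < n → φ n s = θ s ∧ iteratedDeriv 2 (φ n) s = iteratedDeriv 2 θ s) := by
  have hle : ((2 : ℕ) : WithTop ℕ∞) ≤ ((⊤ : ℕ∞) : WithTop ℕ∞) := WithTop.coe_le_coe.2 le_top
  let b : ContDiffBump (0 : ℝ) := ⟨1, 2, one_pos, one_lt_two⟩
  have hb : ContDiff ℝ (⊤ : ℕ∞) (fun s => b s) := b.contDiff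
  have hbc : HasCompactSupport (fun s => b s) := b.hasCompactSupport
  have hbd : ∀ i : ℕ, ∃ B, ∀ s, |iteratedDeriv i (fun s => b s) s| ≤ B := fun i => by
    have h1 : HasCompactSupport (iteratedDeriv i fun s => b s) := by
      induction i with
      | zero => simpa using hbc
      | succ k ih => rw [iteratedDeriv_succ]; exact ih.deriv
    exact h1.exists_bound_of_continuous (hb.continuous_iteratedDeriv i (by exact_mod_cast le_top))
  choose B hB using hbd
  have hB0 : ∀ i, 0 ≤ B i := fun i => (abs_nonneg _).trans (hB i 0)
  have hK0 : 0 ≤ K := (abs_nonneg _).trans (hK 0 (by norm_num) 0)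
  let c : ℕ → ℝ := fun n => 1 / ((n : ℝ) + 1)
  have hc0 : ∀ n, 0 < c n := fun n => by positivity
  have hc1 : ∀ n, c n ≤ 1 := fun n => by
    simp only [c]; rw [div_le_one (by positivity)]; linarith [(Nat.cast_nonneg n : (0 : ℝ) ≤ n)]
  -- Stretching a fixed bump by `1 / c n = n + 1 ≥ 1` only shrinks its derivatives, so the bounds `B
  -- i` are uniform in `n`.
  let η : ℕ → ℝ → ℝ := fun n s => b (c n * s)
  have hη : ∀ n, ContDiff ℝ (⊤ : ℕ∞) (η n) := fun n => hb.comp (by fun_prop)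
  have hηd : ∀ n i s, |iteratedDeriv i (η n) s| ≤ B i := fun n i s => by
    have := iteratedDeriv_comp_const_mul (n := i) (f := fun s => b s)
      (hb.of_le (by exact_mod_cast le_top)) (c n)
    simp only [η]
    simp only [this]
    rw [abs_mul, abs_pow, abs_of_pos (hc0 n)]
    calc c n ^ i * |iteratedDeriv i (fun s => b s) (c n * s)| ≤ 1 * B i :=
          mul_le_mul (pow_le_one₀ (hc0 n).le (hc1 n)) (hB i _) (abs_nonneg _) zero_le_one
      _ = B i := one_mul _
  -- One constant for both bounds: the first summand controls the product, the bracket its second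
  -- derivative by Leibniz' formula.
  refine ⟨fun n => θ * η n, K * B 0 + (K * B 2 + 2 * K * B 1 + K * B 0), fun n => hθ.mul (hη n),
    fun n => ?_, fun n s => ?_, fun n s => ?_, fun n s hs => ?_⟩
  · refine HasCompactSupport.mul_left ?_
    exact hbc.comp_homeomorph (Homeomorph.mulLeft₀ (c n) (hc0 n).ne')
  · have h1 := hK 0 (by norm_num) s
    have h2 := hηd n 0 s
    rw [iteratedDeriv_zero] at h1 h2
    simp only [Pi.mul_apply, abs_mul]
    have := mul_le_mul h1 h2 (abs_nonneg _) hK0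
    have := mul_nonneg hK0 (hB0 0)
    have := mul_nonneg hK0 (hB0 1)
    have := mul_nonneg hK0 (hB0 2)
    linarith
  · rw [iteratedDeriv_mul (hθ.of_le hle).contDiffAt ((hη n).of_le hle).contDiffAt]
    simp only [Finset.sum_range_succ, Finset.sum_range_zero, zero_add]
    have e : ∀ i ≤ 2, ∀ j, |iteratedDeriv i θ s * iteratedDeriv j (η n) s| ≤ K * B j :=
      fun i hi j => by
        rw [abs_mul]
        exact mul_le_mul (hK i hi s) (hηd n j s) (abs_nonneg _) hK0
    have e0 := abs_le.1 (e 0 (by norm_num) 2)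
    have e1 := abs_le.1 (e 1 (by norm_num) 1)
    have e2 := abs_le.1 (e 2 (by norm_num) 0)
    have := mul_nonneg hK0 (hB0 0)
    norm_num
    rw [abs_le]
    simp only [iteratedDeriv_zero, iteratedDeriv_one] at e0 e1 e2
    constructor <;> nlinarith
  · have h1 : ∀ r : ℝ, |r| < n → η n r = 1 := fun r hr => by
      refine b.one_of_mem_closedBall ?_
      simp only [Metric.mem_closedBall, dist_zero_right, Real.norm_eq_abs, abs_mul,
        abs_of_pos (hc0 n), b, c]
      rw [one_div, inv_mul_le_iff₀ (by positivity)]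
      linarith
    have h2 : θ * η n =ᶠ[𝓝 s] θ := by
      have : {r : ℝ | |r| < n} ∈ 𝓝 s := (isOpen_lt continuous_abs continuous_const).mem_nhds hs
      filter_upwards [this] with r hr
      simp [h1 r hr]
    exact ⟨h2.eq_of_nhds, h2.iteratedDeriv_eq 2⟩

variable {ν : ℝ} {u : ℝ≥0 → Measure ℝ}

theorem IsFractionalDiffusion.eq_add_fracInt (hν : 0 < ν) (hν' : ν ≤ 1)
    (hu : IsFractionalDiffusion ν u) {φ : ℝ → ℝ} (hφ : ContDiff ℝ (⊤ : ℕ∞) φ)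
    (hφc : HasCompactSupport φ) {t : ℝ} (ht : 0 < t) :
    ∫ s, φ s ∂(u t.toNNReal) =
      φ 0 + fracInt (2 * ν) (fun t => ∫ s, iteratedDeriv 2 φ s ∂(u t.toNNReal)) t := by
  have h := (hu.regular φ hφ hφc).eq_add_fracInt (by linarith) (by linarith)
    (fun h => hu.initial_deriv (by linarith) φ hφ hφc) ht
  rw [h, Real.toNNReal_zero, hu.initial, integral_dirac]
  congr 1
  exact fracInt_congr ht.le fun s hs => hu.equation φ hφ hφc s hs.1

theorem abs_integral_le_of_bounded {m : Measure ℝ} [IsProbabilityMeasure m] {φ : ℝ → ℝ} {K : ℝ}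
    (h : ∀ s, |φ s| ≤ K) : |∫ s, φ s ∂m| ≤ K := by
  have := norm_integral_le_of_norm_le_const (μ := m) (f := φ) (ae_of_all _ h)
  simpa using this

/-- The integral form of the fractional diffusion equation holds for smooth functions with bounded
derivatives. -/
theorem IsFractionalDiffusion.eq_add_fracInt_of_bounded (hν : 0 < ν) (hν' : ν ≤ 1)
    (hu : IsFractionalDiffusion ν u) {θ : ℝ → ℝ} (hθ : ContDiff ℝ (⊤ : ℕ∞) θ) {K : ℝ}
    (hK : ∀ i ≤ 2, ∀ s, |iteratedDeriv i θ s| ≤ K) :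
    AEStronglyMeasurable (fun t : ℝ => ∫ s, θ s ∂(u t.toNNReal)) (volume.restrict (Ioi 0)) ∧
    ∀ t > 0, ∫ s, θ s ∂(u t.toNNReal) =
      θ 0 + fracInt (2 * ν) (fun t => ∫ s, iteratedDeriv 2 θ s ∂(u t.toNNReal)) t := by
  obtain ⟨φ, K', hφ, hφc, hφb, hφb2, hφe⟩ := exists_testFunction_approx hθ hK
  have := hu.isProbabilityMeasure
  have hev : ∀ s : ℝ, ∀ᶠ n : ℕ in atTop, φ n s = θ s ∧
      iteratedDeriv 2 (φ n) s = iteratedDeriv 2 θ s := fun s => by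
    obtain ⟨N, hN⟩ := exists_nat_gt |s|
    filter_upwards [eventually_ge_atTop N] with n hn
    exact hφe n s (hN.trans_le (by exact_mod_cast hn))
  have hlim : ∀ t : ℝ≥0, Tendsto (fun n => ∫ s, φ n s ∂(u t)) atTop (𝓝 (∫ s, θ s ∂(u t))) :=
    fun t => tendsto_integral_of_dominated_convergence (fun _ => K')
      (fun n => (hφ n).continuous.aestronglyMeasurable) (integrable_const _)
      (fun n => ae_of_all _ (hφb n))
      (ae_of_all _ fun s => tendsto_const_nhds.congr' ((hev s).mono fun n h => h.1.symm))
  have hlim2 : ∀ t : ℝ≥0, Tendsto (fun n => ∫ s, iteratedDeriv 2 (φ n) s ∂(u t)) atTop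
      (𝓝 (∫ s, iteratedDeriv 2 θ s ∂(u t))) :=
    fun t => tendsto_integral_of_dominated_convergence (fun _ => K')
      (fun n => (hφ n).iteratedDeriv_two.continuous.aestronglyMeasurable) (integrable_const _)
      (fun n => ae_of_all _ (hφb2 n))
      (ae_of_all _ fun s => tendsto_const_nhds.congr' ((hev s).mono fun n h => h.2.symm))
  have hmeas : ∀ φ : ℝ → ℝ, ContDiff ℝ (⊤ : ℕ∞) φ → HasCompactSupport φ →
      AEStronglyMeasurable (fun t : ℝ => ∫ s, φ s ∂(u t.toNNReal)) (volume.restrict (Ioi 0)) :=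
    fun φ h1 h2 => ((hu.regular φ h1 h2).continuousOn.mono Ioi_subset_Ici_self).aestronglyMeasurable
      measurableSet_Ioi
  refine ⟨aestronglyMeasurable_of_tendsto_ae atTop (fun n => hmeas _ (hφ n) (hφc n))
    (ae_of_all _ fun t => hlim t.toNNReal), fun t ht => ?_⟩
  refine tendsto_nhds_unique (hlim t.toNNReal) ?_
  have h0 : Tendsto (fun n => φ n 0) atTop (𝓝 (θ 0)) :=
    tendsto_const_nhds.congr' ((hev 0).mono fun n h => h.1.symm)
  have hf : Tendsto (fun n => fracInt (2 * ν)
      (fun t => ∫ s, iteratedDeriv 2 (φ n) s ∂(u t.toNNReal)) t) atTop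
      (𝓝 (fracInt (2 * ν) (fun t => ∫ s, iteratedDeriv 2 θ s ∂(u t.toNNReal)) t)) := by
    refine Tendsto.const_mul _ ?_
    have hm := fun n => hmeas _ (hφ n).iteratedDeriv_two (hφc n).iteratedDeriv_two
    have hb : ∀ n, ∀ t > (0 : ℝ), |∫ s, iteratedDeriv 2 (φ n) s ∂(u t.toNNReal)| ≤ K' :=
      fun n t _ => abs_integral_le_of_bounded (hφb2 n)
    refine intervalIntegral.tendsto_integral_filter_of_dominated_convergence
      (fun s => K' * (t - s) ^ (2 * ν - 1)) (Eventually.of_forall fun n => ?_)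
      (Eventually.of_forall fun n => ae_of_all _ fun s hs => ?_)
      ((intervalIntegrable_const_sub_rpow (by linarith)).const_mul _)
      (ae_of_all _ fun s hs => (hlim2 s.toNNReal).mul_const _)
    · rw [uIoc_of_le ht.le]
      exact ((intervalIntegrable_iff_integrableOn_Ioc_of_le ht.le).1
        (intervalIntegrable_fracInt_integrand (by linarith) ht.le (hm n) (hb n))).1
    · rw [uIoc_of_le ht.le] at hs
      have : 0 ≤ (t - s) ^ (2 * ν - 1) := Real.rpow_nonneg (by linarith [hs.2]) _
      rw [norm_mul, Real.norm_of_nonneg this]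
      exact mul_le_mul_of_nonneg_right (hb n s hs.1) this
  refine (h0.add hf).congr fun n => ?_
  rw [hu.eq_add_fracInt hν hν' (hφ n) (hφc n) ht]

/-- On an eigenfunction of the second derivative the equation closes up: the difference of the two
pairings is a bounded solution of a scalar homogeneous Volterra equation, hence zero. -/
theorem IsFractionalDiffusion.integral_unique (hν : 0 < ν) (hν' : ν ≤ 1) {v : ℝ≥0 → Measure ℝ}
    (hu : IsFractionalDiffusion ν u) (hv : IsFractionalDiffusion ν v) {θ : ℝ → ℝ}
    (hθ : ContDiff ℝ (⊤ : ℕ∞) θ) {K c : ℝ} (hK : ∀ i ≤ 2, ∀ s, |iteratedDeriv i θ s| ≤ K)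
    (hc : 0 ≤ c) (h2 : ∀ s, iteratedDeriv 2 θ s = -c * θ s) {t : ℝ≥0} (ht : 0 < t) :
    ∫ s, θ s ∂(u t) = ∫ s, θ s ∂(v t) := by
  obtain ⟨hum, hue⟩ := hu.eq_add_fracInt_of_bounded hν hν' hθ hK
  obtain ⟨hvm, hve⟩ := hv.eq_add_fracInt_of_bounded hν hν' hθ hK
  have := hu.isProbabilityMeasure
  have := hv.isProbabilityMeasure
  have hα : 0 < 2 * ν := by linarith
  simp only [h2, integral_const_mul, fracInt_const_mul] at hue hve
  have hb0 : ∀ s, |θ s| ≤ K := fun s => by simpa using hK 0 (by norm_num) s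
  have hub : ∀ t > 0, |∫ s, θ s ∂(u (Real.toNNReal t))| ≤ K :=
    fun t _ => abs_integral_le_of_bounded hb0
  have hvb : ∀ t > 0, |∫ s, θ s ∂(v (Real.toNNReal t))| ≤ K :=
    fun t _ => abs_integral_le_of_bounded hb0
  have key := eq_zero_of_eq_neg_mul_fracInt (C := K + K) hα hc (hum.sub hvm)
    (fun t ht => (abs_sub _ _).trans (add_le_add (hub t ht) (hvb t ht))) (fun t ht => by
      simp only [Pi.sub_apply]
      rw [hue t ht, hve t ht]
      have : fracInt (2 * ν) ((fun t : ℝ => ∫ s, θ s ∂(u t.toNNReal)) -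
          fun t : ℝ => ∫ s, θ s ∂(v t.toNNReal)) t =
          fracInt (2 * ν) (fun t : ℝ => ∫ s, θ s ∂(u t.toNNReal)) t -
          fracInt (2 * ν) (fun t : ℝ => ∫ s, θ s ∂(v t.toNNReal)) t := by
        simp only [fracInt, Pi.sub_apply, sub_mul]
        rw [intervalIntegral.integral_sub
          (intervalIntegrable_fracInt_integrand hα ht.le hum hub)
          (intervalIntegrable_fracInt_integrand hα ht.le hvm hvb), mul_sub]
      rw [this]
      ring)
  have := key t ht
  simp only [Pi.sub_apply, Real.toNNReal_coe] at this
  linarith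

/-- The Cauchy problem for the fractional diffusion equation has at most one solution. -/
theorem IsFractionalDiffusion.unique (hν : 0 < ν) (hν' : ν ≤ 1) {v : ℝ≥0 → Measure ℝ}
    (hu : IsFractionalDiffusion ν u) (hv : IsFractionalDiffusion ν v) : u = v := by
  have := hu.isProbabilityMeasure
  have := hv.isProbabilityMeasure
  funext t
  rcases eq_zero_or_pos t with rfl | ht
  · rw [hu.initial, hv.initial]
  refine Measure.ext_of_charFun (funext fun ξ => ?_)
  -- The real and imaginary parts of the characteristic function are pairings with eigenfunctions,
  -- with `c = ξ ^ 2`; `K` dominates `|ξ| ^ i` for `i ≤ 2`.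
  have hcos : ∫ s, Real.cos (ξ * s) ∂(u t) = ∫ s, Real.cos (ξ * s) ∂(v t) := by
    have hd : ∀ i, iteratedDeriv i (fun s => Real.cos (ξ * s)) =
        fun s => ξ ^ i * iteratedDeriv i Real.cos (ξ * s) := fun i => by
      have := iteratedDeriv_comp_const_mul (n := i) (f := Real.cos) Real.contDiff_cos ξ
      simpa only [smul_eq_mul] using this
    refine hu.integral_unique hν hν' hv (θ := fun s => Real.cos (ξ * s)) (K := 1 + |ξ| + |ξ| ^ 2) (c := ξ ^ 2)
      (Real.contDiff_cos.comp (by fun_prop)) (fun i hi s => ?_) (sq_nonneg _) (fun s => ?_) ht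
    · rw [hd, abs_mul, abs_pow]
      have h1 := Real.abs_cos_le_one (ξ * s)
      have h2 := Real.abs_sin_le_one (ξ * s)
      have := abs_nonneg ξ
      interval_cases i <;> simp [iteratedDeriv_succ] <;> nlinarith
    · rw [hd]; simp [iteratedDeriv_succ]
  have hsin : ∫ s, Real.sin (ξ * s) ∂(u t) = ∫ s, Real.sin (ξ * s) ∂(v t) := by
    have hd : ∀ i, iteratedDeriv i (fun s => Real.sin (ξ * s)) =
        fun s => ξ ^ i * iteratedDeriv i Real.sin (ξ * s) := fun i => by
      have := iteratedDeriv_comp_const_mul (n := i) (f := Real.sin) Real.contDiff_sin ξ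
      simpa only [smul_eq_mul] using this
    refine hu.integral_unique hν hν' hv (θ := fun s => Real.sin (ξ * s)) (K := 1 + |ξ| + |ξ| ^ 2) (c := ξ ^ 2)
      (Real.contDiff_sin.comp (by fun_prop)) (fun i hi s => ?_) (sq_nonneg _) (fun s => ?_) ht
    · rw [hd, abs_mul, abs_pow]
      have h1 := Real.abs_cos_le_one (ξ * s)
      have h2 := Real.abs_sin_le_one (ξ * s)
      have := abs_nonneg ξ
      interval_cases i <;> simp [iteratedDeriv_succ] <;> nlinarith
    · rw [hd]; simp [iteratedDeriv_succ]
  have hdecomp : ∀ m : Measure ℝ, IsProbabilityMeasure m → charFun m ξ =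
      ((∫ s, Real.cos (ξ * s) ∂m : ℝ) : ℂ) + ((∫ s, Real.sin (ξ * s) ∂m : ℝ) : ℂ) * Complex.I := by
    intro m _
    have e1 := integral_ofReal (𝕜 := ℂ) (μ := m) (f := fun s => Real.cos (ξ * s))
    have e2 := integral_ofReal (𝕜 := ℂ) (μ := m) (f := fun s => Real.sin (ξ * s))
    simp only [Complex.coe_algebraMap] at e1 e2
    rw [charFun_apply_real, ← e1, ← e2, ← integral_mul_const, ← integral_add]
    · refine integral_congr_ae (ae_of_all _ fun s => ?_)
      beta_reduce
      rw [← Complex.ofReal_mul, Complex.exp_mul_I]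
      simp
    · refine Integrable.of_bound (C := 1) (by fun_prop) (ae_of_all _ fun s => ?_)
      rw [Complex.norm_real]; exact Real.abs_cos_le_one (ξ * s)
    · refine Integrable.of_bound (C := 1) (by fun_prop) (ae_of_all _ fun s => ?_)
      rw [norm_mul, Complex.norm_I, mul_one, Complex.norm_real]; exact Real.abs_sin_le_one (ξ * s)
  rw [hdecomp _ inferInstance, hdecomp _ inferInstance, hcos, hsin]

end

/-! ### One-sided stable laws as limits of sums of Sibuya variables -/

noncomputable section

/-- `G` is given on the closed unit disc by a power series with nonnegative coefficients. -/
def IsGeneratingFunction (G : ℂ → ℂ) : Prop :=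
  ∃ p : ℕ → ℝ, (∀ k, 0 ≤ p k) ∧ ∀ s : ℂ, ‖s‖ ≤ 1 → HasSum (fun k => (p k : ℂ) * s ^ k) (G s)

theorem summable_coeff_of_hasSum_one {p : ℕ → ℝ} {G : ℂ → ℂ}
    (h : ∀ s : ℂ, ‖s‖ ≤ 1 → HasSum (fun k => (p k : ℂ) * s ^ k) (G s)) : Summable p := by
  have := (h 1 (by simp)).summable
  simpa only [one_pow, mul_one, Complex.summable_ofReal] using this

theorem norm_coeff_mul_pow_le {p : ℕ → ℝ} (hp : ∀ k, 0 ≤ p k) {s : ℂ} (hs : ‖s‖ ≤ 1) (k : ℕ) :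
    ‖(p k : ℂ) * s ^ k‖ ≤ p k := by
  rw [norm_mul, norm_pow, Complex.norm_real, Real.norm_of_nonneg (hp k)]
  exact mul_le_of_le_one_right (hp k) (pow_le_one₀ (norm_nonneg _) hs)

theorem IsGeneratingFunction.mul {G H : ℂ → ℂ} (hG : IsGeneratingFunction G)
    (hH : IsGeneratingFunction H) : IsGeneratingFunction (fun s => G s * H s) := by
  obtain ⟨p, hp, hpG⟩ := hG
  obtain ⟨q, hq, hqH⟩ := hH
  have hps := summable_coeff_of_hasSum_one hpG
  have hqs := summable_coeff_of_hasSum_one hqH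
  refine ⟨fun n => ∑ kl ∈ Finset.HasAntidiagonal.antidiagonal n, p kl.1 * q kl.2,
    fun n => Finset.sum_nonneg fun kl _ => mul_nonneg (hp _) (hq _), fun s hs => ?_⟩
  have h1 : Summable fun k => ‖(p k : ℂ) * s ^ k‖ :=
    Summable.of_nonneg_of_le (fun _ => norm_nonneg _) (norm_coeff_mul_pow_le hp hs) hps
  have h2 : Summable fun k => ‖(q k : ℂ) * s ^ k‖ :=
    Summable.of_nonneg_of_le (fun _ => norm_nonneg _) (norm_coeff_mul_pow_le hq hs) hqs
  have h3 := tsum_mul_tsum_eq_tsum_sum_antidiagonal_of_summable_norm h1 h2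
  have h4 := (summable_norm_sum_mul_antidiagonal_of_summable_norm h1 h2).of_norm
  rw [(hpG s hs).tsum_eq, (hqH s hs).tsum_eq] at h3
  beta_reduce
  rw [h3]
  refine (congrArg (fun f => HasSum f _) (funext fun n => ?_)).mpr h4.hasSum
  push_cast
  rw [Finset.sum_mul]
  refine Finset.sum_congr rfl fun kl hkl => ?_
  rw [← Finset.HasAntidiagonal.mem_antidiagonal.1 hkl, pow_add]
  ring

/-- Probabilistically, powers correspond to sums of independent copies; working with power series
avoids constructing them. -/
theorem IsGeneratingFunction.pow {G : ℂ → ℂ} (hG : IsGeneratingFunction G) (n : ℕ) :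
    IsGeneratingFunction (fun s => G s ^ n) := by
  induction n with
  | zero =>
    refine ⟨fun k => if k = 0 then 1 else 0, fun k => by positivity, fun s _ => ?_⟩
    convert hasSum_ite_eq (0 : ℕ) (1 : ℂ) using 2 with k
    · rcases eq_or_ne k 0 with rfl | h <;> simp [*]
    · simp
  | succ n ih => simpa only [pow_succ] using ih.mul hG

theorem choose_succ_mul (a : ℝ) (k : ℕ) :
    Ring.choose a (k + 1) * (k + 1) = Ring.choose a k * (a - k) := by
  have := Ring.choose_smul_choose a (Nat.le_succ k)
  simp only [Nat.succ_eq_add_one, Nat.choose_succ_self_right, Nat.add_sub_cancel_left,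
    Ring.choose_one_right, nsmul_eq_mul] at this
  push_cast at this
  rw [mul_comm, this]

/-- The Sibuya distribution: `1 - (1 - s) ^ ν` is a probability generating function. -/
theorem isGeneratingFunction_sibuya {ν : ℝ} (hν : 0 < ν) (hν' : ν < 1) :
    IsGeneratingFunction (fun s => 1 - (1 - s) ^ (ν : ℂ)) := by
  set p : ℕ → ℝ := fun k => (if k = 0 then 1 else 0) - (-1) ^ k * Ring.choose ν k with hpdef
  have hp : ∀ k, 0 ≤ p k := by
    -- The first coefficient is `ν`, and consecutive ones have ratio `(k + 1 - ν) / (k + 2)`,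
    -- nonnegative because `ν < 1`.
    have : ∀ k, 0 ≤ -((-1) ^ (k + 1) * Ring.choose ν (k + 1)) := by
      intro k
      induction k with
      | zero => simp [hν.le]
      | succ k ih =>
        have h1 := choose_succ_mul ν (k + 1)
        have h2 : -((-1) ^ (k + 1 + 1) * Ring.choose ν (k + 1 + 1)) =
            -((-1) ^ (k + 1) * Ring.choose ν (k + 1)) * (((k + 1 : ℕ) : ℝ) - ν) /
              (((k + 1 : ℕ) : ℝ) + 1) := by
          rw [eq_div_iff (by positivity), pow_succ (-1 : ℝ) (k + 1)]
          linear_combination (-1 : ℝ) ^ (k + 1) * h1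
        rw [h2]
        have : ν ≤ ((k + 1 : ℕ) : ℝ) := by push_cast; linarith [(Nat.cast_nonneg k : (0 : ℝ) ≤ k)]
        exact div_nonneg (mul_nonneg ih (by linarith)) (by positivity)
    intro k
    cases k with
    | zero => simp [hpdef]
    | succ k => simpa [hpdef] using this k
  have hsum : ∀ s : ℂ, ‖s‖ < 1 → HasSum (fun k => (p k : ℂ) * s ^ k) (1 - (1 - s) ^ (ν : ℂ)) := by
    intro s hs
    have h1 := (Complex.one_add_cpow_hasFPowerSeriesOnBall_zero (a := ν)).hasSum (y := -s) (by
      rw [Metric.mem_eball, edist_zero_right, enorm_neg, ← ofReal_norm]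
      exact ENNReal.ofReal_lt_one.2 hs)
    simp only [binomialSeries_apply, List.ofFn_const, List.prod_replicate, smul_eq_mul,
      ← sub_eq_add_neg, zero_sub] at h1
    have h2 := (hasSum_ite_eq (0 : ℕ) (1 : ℂ)).sub h1
    refine (congrArg (fun f => HasSum f _) (funext fun k => ?_)).mpr h2
    rw [← Complex.ofReal_choose]
    push_cast [hpdef]
    rw [sub_mul, neg_pow s k]
    congr 1
    · rcases eq_or_ne k 0 with rfl | h <;> simp [*]
    · ring
  -- For `r < 1` the series at `r` sums to `1 - (1 - r) ^ ν ≤ 1`; letting `r` increase to `1` bounds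
  -- the partial sums of the coefficients.
  have hps : Summable p := by
    refine summable_of_sum_range_le (c := 1) hp fun n => ?_
    have hle : ∀ r ∈ Ioo (0 : ℝ) 1, ∑ k ∈ Finset.range n, p k * r ^ k ≤ 1 := by
      intro r hr
      have h1 := hsum r (by rw [Complex.norm_real, Real.norm_of_nonneg hr.1.le]; exact hr.2)
      have h2 : HasSum (fun k => p k * r ^ k) (1 - (1 - r) ^ ν) := by
        rw [← Complex.hasSum_ofReal]
        rw [Complex.ofReal_sub, Complex.ofReal_cpow (by linarith [hr.2])]
        simpa using h1
      have h3 := sum_le_hasSum (Finset.range n)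
        (fun k _ => mul_nonneg (hp k) (pow_nonneg hr.1.le k)) h2
      have : 0 ≤ (1 - r) ^ ν := Real.rpow_nonneg (by linarith [hr.2]) _
      linarith
    have hlim : Tendsto (fun r : ℝ => ∑ k ∈ Finset.range n, p k * r ^ k) (𝓝[<] 1)
        (𝓝 (∑ k ∈ Finset.range n, p k * 1 ^ k)) :=
      ((by fun_prop : Continuous fun r : ℝ => ∑ k ∈ Finset.range n, p k * r ^ k).tendsto 1).mono_left
        nhdsWithin_le_nhds
    simp only [one_pow, mul_one] at hlim
    refine le_of_tendsto hlim ?_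
    filter_upwards [Ioo_mem_nhdsLT (show (0 : ℝ) < 1 by norm_num)] with r hr using hle r hr
  refine ⟨p, hp, fun s hs => ?_⟩
  have hsm : Summable fun k => (p k : ℂ) * s ^ k :=
    Summable.of_norm_bounded hps (norm_coeff_mul_pow_le hp hs)
  -- The identity extends to the unit circle by radial limits, the summable coefficients dominating.
  -- The circle is what characteristic functions need.
  have hL : Tendsto (fun r : ℝ => ∑' k, (p k : ℂ) * ((r : ℂ) * s) ^ k) (𝓝[Ioo 0 1] 1)
      (𝓝 (∑' k, (p k : ℂ) * s ^ k)) := by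
    refine tendsto_tsum_of_dominated_convergence hps (fun k => ?_) ?_
    · have : Continuous fun r : ℝ => (p k : ℂ) * ((r : ℂ) * s) ^ k := by fun_prop
      simpa using (this.tendsto 1).mono_left nhdsWithin_le_nhds
    · filter_upwards [self_mem_nhdsWithin] with r hr k
      refine norm_coeff_mul_pow_le hp ?_ k
      rw [norm_mul, Complex.norm_real, Real.norm_of_nonneg hr.1.le]
      exact mul_le_one₀ hr.2.le (norm_nonneg _) hs
  have hR : Tendsto (fun r : ℝ => 1 - (1 - (r : ℂ) * s) ^ (ν : ℂ)) (𝓝[Ioo 0 1] 1)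
      (𝓝 (1 - (1 - s) ^ (ν : ℂ))) := by
    have h1 : ContinuousAt (fun x : ℂ => x ^ (ν : ℂ)) (1 - s) := by
      refine Complex.continuousAt_cpow_const_of_re_pos (Or.inl ?_) (by simpa)
      have := (Complex.re_le_norm s).trans hs
      simp; linarith
    have h2 : Tendsto (fun r : ℝ => 1 - (r : ℂ) * s) (𝓝[Ioo 0 1] 1) (𝓝 (1 - s)) := by
      have : Continuous fun r : ℝ => 1 - (r : ℂ) * s := by fun_prop
      simpa using (this.tendsto 1).mono_left nhdsWithin_le_nhds
    exact tendsto_const_nhds.sub (h1.tendsto.comp h2)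
  have hne : (𝓝[Ioo (0 : ℝ) 1] 1).NeBot := by
    rw [← mem_closure_iff_nhdsWithin_neBot, closure_Ioo zero_ne_one]
    simp
  have heq : ∑' k, (p k : ℂ) * s ^ k = 1 - (1 - s) ^ (ν : ℂ) := by
    refine tendsto_nhds_unique (hL.congr' ?_) hR
    filter_upwards [self_mem_nhdsWithin] with r hr
    refine (hsum _ ?_).tsum_eq
    rw [norm_mul, Complex.norm_real, Real.norm_of_nonneg hr.1.le]
    exact (mul_le_of_le_one_right hr.1.le hs).trans_lt hr.2
  have := hsm.hasSum
  rwa [heq] at this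

/-- The law on the lattice `h ℕ` with a given probability generating function. -/
theorem IsGeneratingFunction.exists_lattice_measure {G : ℂ → ℂ} (hG : IsGeneratingFunction G)
    (hG1 : G 1 = 1) {h : ℝ} (hh : 0 ≤ h) :
    ∃ μ : Measure ℝ, IsProbabilityMeasure μ ∧ (∀ᵐ x ∂μ, 0 ≤ x) ∧
      (∀ ξ : ℝ, charFun μ ξ = G (Complex.exp (-(-(ξ * Complex.I)) * h))) ∧
      ∀ w : ℝ, 0 ≤ w → ((∫ x, Real.exp (-w * max x 0) ∂μ : ℝ) : ℂ) = G (Complex.exp (-w * h)) := by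
  obtain ⟨p, hp, hpG⟩ := hG
  have hps := summable_coeff_of_hasSum_one hpG
  let μ : Measure ℝ := Measure.sum fun k : ℕ => ENNReal.ofReal (p k) • Measure.dirac ((k : ℝ) * h)
  have hμ1 : μ univ = 1 := by
    simp only [μ, Measure.sum_apply _ MeasurableSet.univ, Measure.smul_apply, measure_univ,
      smul_eq_mul, mul_one]
    rw [← ENNReal.ofReal_tsum_of_nonneg hp hps, ENNReal.ofReal_eq_one]
    have := hpG 1 (by simp)
    simp only [one_pow, mul_one, hG1] at this
    exact (Complex.hasSum_ofReal.1 (by simpa using this)).tsum_eq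
  have hprob : IsProbabilityMeasure μ := ⟨hμ1⟩
  have hint : ∀ f : ℝ → ℂ, Continuous f → (∃ C, ∀ᵐ x ∂μ, ‖f x‖ ≤ C) →
      HasSum (fun k : ℕ => (p k : ℂ) * f (k * h)) (∫ x, f x ∂μ) := by
    rintro f hf ⟨C, hC⟩
    have h1 : Integrable f μ := Integrable.of_bound hf.aestronglyMeasurable C hC
    have h2 := hasSum_integral_measure (f := f) h1
    simp only [integral_smul_measure, integral_dirac, ENNReal.toReal_ofReal (hp _)] at h2
    simpa using h2
  have hpos : ∀ᵐ x ∂μ, 0 ≤ x := by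
    rw [Measure.ae_sum_iff]
    intro k
    refine Measure.ae_smul_measure ?_ _
    rw [ae_dirac_iff measurableSet_Ici]
    positivity
  refine ⟨μ, hprob, hpos, fun ξ => ?_, fun w hw => ?_⟩
  · rw [charFun_apply_real]
    refine (hint _ (by fun_prop) ⟨1, ae_of_all _ fun x => ?_⟩).unique ?_
    · rw [← Complex.ofReal_mul, Complex.norm_exp_ofReal_mul_I]
    · have hs : ‖Complex.exp (-(-(ξ * Complex.I)) * h)‖ ≤ 1 := by
        rw [Complex.norm_exp]; simp
      convert hpG _ hs using 3 with k
      rw [← Complex.exp_nat_mul]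
      congr 1
      push_cast
      ring
  · have e1 := integral_ofReal (𝕜 := ℂ) (μ := μ) (f := fun x => Real.exp (-w * max x 0))
    simp only [Complex.coe_algebraMap] at e1
    rw [← e1]
    refine (hint _ (by fun_prop) ⟨1, ae_of_all _ fun x => ?_⟩).unique ?_
    · rw [Complex.norm_real, Real.norm_of_nonneg (Real.exp_pos _).le]
      rw [Real.exp_le_one_iff]
      have := mul_nonneg hw (le_max_right x 0)
      linarith
    · have hs : ‖Complex.exp (-(w : ℂ) * h)‖ ≤ 1 := by
        rw [Complex.norm_exp]
        simp
        positivity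
      convert hpG _ hs using 3 with k
      rw [← Complex.exp_nat_mul, max_eq_left (by positivity : 0 ≤ (k : ℝ) * h)]
      push_cast
      congr 1
      ring

theorem Complex.ofReal_mul_cpow {r : ℝ} (hr : 0 < r) {ν : ℝ} (hν : ν ≠ 0) (x : ℂ) :
    ((r : ℂ) * x) ^ (ν : ℂ) = ((r ^ ν : ℝ) : ℂ) * x ^ (ν : ℂ) := by
  have hν0 : (ν : ℂ) ≠ 0 := by exact_mod_cast hν
  rcases eq_or_ne x 0 with rfl | hx
  · simp [Complex.zero_cpow hν0]
  · have hr0 : (r : ℂ) ≠ 0 := by exact_mod_cast hr.ne'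
    rw [Complex.cpow_def_of_ne_zero (mul_ne_zero hr0 hx), Complex.log_ofReal_mul hr hx, add_mul,
      Complex.exp_add, Complex.cpow_def_of_ne_zero hx, Complex.ofReal_cpow hr.le,
      Complex.cpow_def_of_ne_zero hr0, Complex.ofReal_log hr.le]

/-- With mesh `h = n ^ (-1/ν)` one has `n = (1/h) ^ ν`, so `n (1 - exp (-ζ h)) ^ ν = ((1 - exp (-ζ
h)) / h) ^ ν`, which tends to `ζ ^ ν`; then `(1 + x_n / n) ^ n → exp x`. Real `ζ` gives Laplace
transforms, imaginary `ζ` characteristic functions. -/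
theorem tendsto_sibuya_scaling {ν : ℝ} (hν : 0 < ν) {ζ : ℂ} (hζ : 0 ≤ ζ.re) :
    Tendsto (fun n : ℕ =>
      (1 - (1 - Complex.exp (-ζ * (((n : ℝ) ^ (-(1 / ν)) : ℝ) : ℂ))) ^ (ν : ℂ)) ^ n) atTop
      (𝓝 (Complex.exp (-ζ ^ (ν : ℂ)))) := by
  set h : ℕ → ℝ := fun n => (n : ℝ) ^ (-(1 / ν)) with hh
  have hpos : ∀ᶠ n : ℕ in atTop, 0 < h n := by
    filter_upwards [eventually_gt_atTop 0] with n hn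
    exact Real.rpow_pos_of_pos (by exact_mod_cast hn) _
  have hlim : Tendsto h atTop (𝓝[≠] 0) := by
    rw [tendsto_nhdsWithin_iff]
    refine ⟨(tendsto_rpow_neg_atTop (by positivity)).comp tendsto_natCast_atTop_atTop, ?_⟩
    filter_upwards [hpos] with n hn using hn.ne'
  have hder : HasDerivAt (fun x : ℝ => Complex.exp (-ζ * (x : ℂ))) (-ζ) 0 := by
    have h1 : HasDerivAt (fun x : ℂ => Complex.exp (-ζ * x)) (-ζ) ((0 : ℝ) : ℂ) := by
      have := ((hasDerivAt_id (((0 : ℝ) : ℂ))).const_mul (-ζ)).cexp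
      simpa using this
    exact h1.comp_ofReal
  have hslope := (hasDerivAt_iff_tendsto_slope.1 hder).comp hlim
  have hcont : ContinuousAt (fun x : ℂ => x ^ (ν : ℂ)) ζ :=
    Complex.continuousAt_cpow_const_of_re_pos (Or.inl hζ) (by simpa)
  have h3 : Tendsto (fun n : ℕ => (n : ℂ) *
      -(1 - Complex.exp (-ζ * (h n : ℂ))) ^ (ν : ℂ)) atTop (𝓝 (-ζ ^ (ν : ℂ))) := by
    have h4 : Tendsto (fun n => -slope (fun x : ℝ => Complex.exp (-ζ * (x : ℂ))) 0 (h n)) atTop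
        (𝓝 ζ) := by simpa using hslope.neg
    refine ((hcont.tendsto.comp h4).neg).congr' ?_
    filter_upwards [hpos, eventually_gt_atTop 0] with n hn hn0
    have hn0' : (0 : ℝ) < n := by exact_mod_cast hn0
    have e : -slope (fun x : ℝ => Complex.exp (-ζ * (x : ℂ))) 0 (h n) =
        (((h n)⁻¹ : ℝ) : ℂ) * (1 - Complex.exp (-ζ * (h n : ℂ))) := by
      rw [slope_def_module]
      simp only [sub_zero, Complex.ofReal_zero, mul_zero, Complex.exp_zero, Complex.real_smul]
      ring
    have e2 : ((h n)⁻¹) ^ ν = n := by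
      simp only [hh]
      rw [← Real.rpow_neg hn0'.le, ← Real.rpow_mul hn0'.le]
      field_simp
      simp
    simp only [Function.comp]
    rw [e, Complex.ofReal_mul_cpow (by positivity) hν.ne', e2]
    push_cast
    ring
  refine (Complex.tendsto_one_add_pow_exp_of_tendsto h3).congr fun n => ?_
  rw [← sub_eq_add_neg]

/-- The one-sided stable distributions. -/
theorem exists_stable_law {ν : ℝ} (hν : 0 < ν) (hν' : ν < 1) :
    ∃ σ : Measure ℝ, IsProbabilityMeasure σ ∧ (∀ᵐ x ∂σ, 0 ≤ x) ∧
      (∀ ξ : ℝ, charFun σ ξ = Complex.exp (-(-(ξ * Complex.I)) ^ (ν : ℂ))) ∧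
      ∀ w : ℝ, 0 ≤ w → ∫ x, Real.exp (-w * max x 0) ∂σ = Real.exp (-w ^ ν) := by
  have hG := fun n : ℕ => (isGeneratingFunction_sibuya hν hν').pow n
  have hν0 : (ν : ℂ) ≠ 0 := by exact_mod_cast hν.ne'
  choose m hmp hm0 hmc hml using fun n : ℕ => (hG n).exists_lattice_measure
    (by simp [Complex.zero_cpow hν0]) (h := (n : ℝ) ^ (-(1 / ν))) (by positivity)
  have hc : ∀ ξ : ℝ, Tendsto (fun n => charFun (m n) ξ) atTop
      (𝓝 (Complex.exp (-(-(ξ * Complex.I)) ^ (ν : ℂ)))) := fun ξ => by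
    simp only [hmc]
    exact tendsto_sibuya_scaling hν (by simp)
  have hcont : ContinuousAt (fun ξ : ℝ => Complex.exp (-(-(ξ * Complex.I)) ^ (ν : ℂ))) 0 := by
    have h1 : ContinuousAt (fun x : ℂ => x ^ (ν : ℂ)) (-(((0 : ℝ) : ℂ) * Complex.I)) :=
      Complex.continuousAt_cpow_const_of_re_pos (Or.inl (by simp)) (by simpa)
    have h2 : ContinuousAt (fun ξ : ℝ => -((ξ : ℂ) * Complex.I)) 0 := by fun_prop
    exact (ContinuousAt.comp (f := fun ξ : ℝ => -((ξ : ℂ) * Complex.I)) h1 h2).neg.cexp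
  -- Continuity of the limit at `0` gives tightness, hence relative compactness. A limit along an
  -- ultrafilter finer than `atTop` replaces the choice of a subsequence.
  have htight := isTightMeasureSet_of_tendsto_charFun hcont hc
  let M : ℕ → ProbabilityMeasure ℝ := fun n => ⟨m n, hmp n⟩
  have hcomp : IsCompact (closure (range M)) := by
    refine isCompact_closure_of_isTightMeasureSet ?_
    convert htight using 1
    ext μ
    simp only [mem_ofPred_eq, mem_range, M]
    constructor
    · rintro ⟨_, ⟨n, rfl⟩, rfl⟩; exact ⟨n, rfl⟩
    · rintro ⟨n, rfl⟩; exact ⟨_, ⟨n, rfl⟩, rfl⟩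
  let U : Ultrafilter ℕ := Ultrafilter.of atTop
  have hU : (U : Filter ℕ) ≤ atTop := Ultrafilter.of_le atTop
  obtain ⟨σ, -, hσ⟩ := hcomp.ultrafilter_le_nhds (U.map M) (by
    rw [le_principal_iff]
    exact mem_map.2 (Filter.univ_mem' fun n => subset_closure (mem_range_self n)))
  have hT : Tendsto M U (𝓝 σ) := hσ
  have hlim := fun f => ProbabilityMeasure.tendsto_iff_forall_integral_tendsto.1 hT f
  refine ⟨σ, inferInstance, ?_, fun ξ => ?_, fun w hw => ?_⟩
  -- This function is positive exactly on the negative half-line, so a zero integral in the limit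
  -- excludes negative values.
  · let f : BoundedContinuousFunction ℝ ℝ := BoundedContinuousFunction.ofNormedAddCommGroup
      (fun x => min 1 (max 0 (-x))) (by fun_prop) 1 (fun x => by
        rw [Real.norm_of_nonneg (by positivity)]; exact min_le_left _ _)
    have h0 : ∀ n, ∫ x, f x ∂(m n) = 0 := fun n => by
      refine integral_eq_zero_of_ae ?_
      filter_upwards [hm0 n] with x hx
      simp [f, hx]
    have h1 := hlim f
    simp only [M, ProbabilityMeasure.coe_mk, h0] at h1
    have h2 := tendsto_nhds_unique h1 tendsto_const_nhds
    rw [integral_eq_zero_iff_of_nonneg (fun x => by simp [f]) (f.integrable _)] at h2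
    filter_upwards [h2] with x hx
    by_contra hneg
    have : 0 < min 1 (max 0 (-x)) := lt_min one_pos (lt_max_of_lt_right (by linarith))
    exact this.ne' hx
  · refine tendsto_nhds_unique ?_ ((hc ξ).mono_left hU)
    simp_rw [charFun_eq_integral_innerProbChar]
    exact (ProbabilityMeasure.tendsto_iff_forall_integral_rclike_tendsto ℂ).1 hT
      (BoundedContinuousFunction.innerProbChar ξ)
  -- The truncation `max x 0` makes the exponential bounded on the whole line, as weak convergence
  -- requires.
  · let f : BoundedContinuousFunction ℝ ℝ := BoundedContinuousFunction.ofNormedAddCommGroup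
      (fun x => Real.exp (-w * max x 0)) (by fun_prop) 1 (fun x => by
        rw [Real.norm_of_nonneg (Real.exp_pos _).le, Real.exp_le_one_iff]
        have := mul_nonneg hw (le_max_right x 0)
        linarith)
    have h2 : Tendsto (fun n => ((∫ x, Real.exp (-w * max x 0) ∂(m n) : ℝ) : ℂ)) U
        (𝓝 (Complex.exp (-(w : ℂ) ^ (ν : ℂ)))) := by
      simp only [hml _ w hw]
      exact (tendsto_sibuya_scaling hν (by simpa)).mono_left hU
    have h3 : Complex.exp (-(w : ℂ) ^ (ν : ℂ)) = ((Real.exp (-w ^ ν) : ℝ) : ℂ) := by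
      rw [← Complex.ofReal_cpow hw]; push_cast; rfl
    rw [h3] at h2
    have h4 := (Complex.continuous_re.tendsto _).comp h2
    simp only [Complex.ofReal_re] at h4
    exact tendsto_nhds_unique (hlim f) h4

end

/-! ### Density of the stable law -/

noncomputable section

/-- Lebesgue outer measure is the largest outer measure dominated by length on intervals, so a bound
on intervals passes to all sets. -/
theorem absolutelyContinuous_of_measure_Ioc_le {μ : Measure ℝ} {C : ℝ≥0}
    (h : ∀ a b, a < b → μ (Ioc a b) ≤ C * ENNReal.ofReal (b - a)) : μ ≪ volume := by
  -- A nonzero finite constant can be moved through the infima that define the outer measure; `C`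
  -- itself might be zero.
  have h0 : ((C + 1 : ℝ≥0) : ℝ≥0∞) ≠ 0 := by simp
  have htop : ((C + 1 : ℝ≥0) : ℝ≥0∞) ≠ ∞ := ENNReal.coe_ne_top
  have key : μ.toOuterMeasure ≤ ((C + 1 : ℝ≥0) : ℝ≥0∞) • StieltjesFunction.id.outer := by
    rw [StieltjesFunction.outer, OuterMeasure.smul_ofFunction htop, OuterMeasure.le_ofFunction]
    intro s
    rw [Pi.smul_apply, smul_eq_mul, StieltjesFunction.length, if_neg (not_isEmpty_of_nonempty ℝ),
      ENNReal.mul_iInf_of_ne h0 htop]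
    refine le_iInf fun a => ?_
    rw [ENNReal.mul_iInf_of_ne h0 htop]
    refine le_iInf fun b => ?_
    rw [ENNReal.mul_iInf_of_ne h0 htop]
    refine le_iInf fun hs => ?_
    have hs' : s ⊆ Ioc a b := fun x hx => hs ⟨hx, notMem_botSet_of_lt (sub_one_lt x)⟩
    refine (measure_mono hs').trans ?_
    rcases lt_or_ge a b with hab | hab
    · refine (h a b hab).trans ?_
      simp only [StieltjesFunction.id_apply, id]
      gcongr
      simp
    · simp [Ioc_eq_empty_of_le hab]
  intro s hs
  rw [Real.volume_eq_stieltjes_id, StieltjesFunction.measure_def] at hs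
  have hs' : StieltjesFunction.id.outer s = 0 := hs
  have h1 := key s
  rw [smul_apply, hs', smul_zero] at h1
  exact le_antisymm h1 zero_le

/-- The integrand is the characteristic function of a Gaussian of variance `v` at `x - a`. Fubini
moves the transform onto `μ`, and the Gaussian density is at most `1 / √(2πv)`. -/
theorem integral_exp_neg_sq_le {μ : Measure ℝ} [IsProbabilityMeasure μ]
    (h : Integrable (charFun μ)) {v : ℝ≥0} (hv : v ≠ 0) (a : ℝ) :
    ∫ x, Real.exp (-(v * (x - a) ^ 2 / 2)) ∂μ ≤
      (√(2 * Real.pi * v))⁻¹ * ∫ ξ, ‖charFun μ ξ‖ := by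
  have e1 := integral_ofReal (𝕜 := ℂ) (μ := μ) (f := fun x => Real.exp (-(v * (x - a) ^ 2 / 2)))
  simp only [Complex.coe_algebraMap] at e1
  have h1 : ((∫ x, Real.exp (-(v * (x - a) ^ 2 / 2)) ∂μ : ℝ) : ℂ) =
      ∫ ξ, Complex.exp (-(ξ * a * Complex.I)) * charFun μ ξ ∂(gaussianReal 0 v) := by
    rw [← e1]
    have e2 : ∀ x : ℝ, ((Real.exp (-(v * (x - a) ^ 2 / 2)) : ℝ) : ℂ) =
        ∫ ξ, Complex.exp (-(ξ * a * Complex.I)) * Complex.exp (ξ * x * Complex.I)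
          ∂(gaussianReal 0 v) := by
      intro x
      have := charFun_gaussianReal (μ := 0) (v := v) (x - a)
      rw [charFun_apply_real] at this
      push_cast at this ⊢
      rw [show -((v : ℂ) * ((x : ℂ) - a) ^ 2 / 2) = ((x : ℂ) - a) * 0 * Complex.I -
        (v : ℂ) * ((x : ℂ) - a) ^ 2 / 2 by ring]
      rw [← this]
      refine integral_congr_ae (ae_of_all _ fun ξ => ?_)
      beta_reduce
      rw [← Complex.exp_add]
      congr 1
      ring
    simp only [e2]
    rw [integral_integral_swap]
    · refine integral_congr_ae (ae_of_all _ fun ξ => ?_)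
      beta_reduce
      rw [integral_const_mul, charFun_apply_real]
    · refine Integrable.of_bound (C := 1) (Continuous.aestronglyMeasurable (by
        simp only [Function.uncurry_def]; fun_prop)) (ae_of_all _ fun p => ?_)
      simp [Function.uncurry_def, Complex.norm_exp]
  have h2 : ‖∫ ξ, Complex.exp (-(ξ * a * Complex.I)) * charFun μ ξ ∂(gaussianReal 0 v)‖ ≤
      (√(2 * Real.pi * v))⁻¹ * ∫ ξ, ‖charFun μ ξ‖ := by
    rw [integral_gaussianReal_eq_integral_smul hv, ← integral_const_mul]
    refine norm_integral_le_of_norm_le (h.norm.const_mul _) (ae_of_all _ fun ξ => ?_)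
    have : ‖Complex.exp (-((ξ : ℂ) * a * Complex.I))‖ = 1 := by simp [Complex.norm_exp]
    rw [norm_smul, norm_mul, this, one_mul, Real.norm_of_nonneg (gaussianPDFReal_nonneg _ _ _)]
    refine mul_le_mul_of_nonneg_right ?_ (norm_nonneg _)
    rw [gaussianPDFReal_def]
    refine mul_le_of_le_one_right (by positivity) ?_
    rw [Real.exp_le_one_iff]
    have : 0 ≤ (ξ - 0) ^ 2 / (2 * (v : ℝ)) := by positivity
    rw [neg_div]; linarith
  rw [← h1, Complex.norm_real] at h2
  exact (le_abs_self _).trans h2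

/-- A probability measure with integrable characteristic function is absolutely continuous. -/
theorem absolutelyContinuous_of_integrable_charFun {μ : Measure ℝ} [IsProbabilityMeasure μ]
    (h : Integrable (charFun μ)) : μ ≪ volume := by
  set A := ∫ ξ, ‖charFun μ ξ‖ with hA
  have hA0 : 0 ≤ A := integral_nonneg fun _ => norm_nonneg _
  refine absolutelyContinuous_of_measure_Ioc_le (C := Real.toNNReal (Real.exp 1 * A))
    fun a b hab => ?_
  set c := (a + b) / 2 with hc
  have hba : 0 < b - a := by linarith
  -- At this scale the Gaussian bump is at least `exp (-1)` on the interval, while its integral is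
  -- bounded by a multiple of `b - a`.
  let v : ℝ≥0 := ⟨((b - a) ^ 2)⁻¹, by positivity⟩
  have hv : v ≠ 0 := by
    intro h0
    have : ((b - a) ^ 2)⁻¹ = 0 := congrArg NNReal.toReal h0
    have h2 : 0 < ((b - a) ^ 2)⁻¹ := by positivity
    exact h2.ne' this
  have h1 := integral_exp_neg_sq_le h hv c
  have hvr : (v : ℝ) = ((b - a) ^ 2)⁻¹ := rfl
  rw [hvr] at h1
  have hint : Integrable (fun x => Real.exp (-(((b - a) ^ 2)⁻¹ * (x - c) ^ 2 / 2))) μ := by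
    refine Integrable.of_bound (C := 1) (by fun_prop) (ae_of_all _ fun x => ?_)
    rw [Real.norm_of_nonneg (Real.exp_pos _).le, Real.exp_le_one_iff]
    have : 0 ≤ ((b - a) ^ 2)⁻¹ * (x - c) ^ 2 / 2 := by positivity
    linarith
  have h2 : Real.exp (-1) * μ.real (Ioc a b) ≤
      ∫ x, Real.exp (-(((b - a) ^ 2)⁻¹ * (x - c) ^ 2 / 2)) ∂μ := by
    calc Real.exp (-1) * μ.real (Ioc a b) = ∫ x in Ioc a b, Real.exp (-1) ∂μ := by
          rw [setIntegral_const, smul_eq_mul, mul_comm]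
      _ ≤ ∫ x in Ioc a b, Real.exp (-(((b - a) ^ 2)⁻¹ * (x - c) ^ 2 / 2)) ∂μ := by
          refine setIntegral_mono_on (integrable_const _).integrableOn hint.integrableOn
            measurableSet_Ioc fun x hx => ?_
          refine Real.exp_le_exp.2 (neg_le_neg ?_)
          have h3 : (x - c) ^ 2 ≤ (b - a) ^ 2 := by
            refine sq_le_sq' ?_ ?_ <;> rw [hc] <;> linarith [hx.1, hx.2]
          have : ((b - a) ^ 2)⁻¹ * (x - c) ^ 2 ≤ 1 := by
            rw [inv_mul_le_iff₀ (by positivity)]; linarith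
          linarith
      _ ≤ _ := setIntegral_le_integral hint (ae_of_all _ fun x => (Real.exp_pos _).le)
  have h3 : (√(2 * Real.pi * ((b - a) ^ 2)⁻¹))⁻¹ ≤ b - a := by
    rw [inv_le_comm₀ (by positivity) hba]
    refine Real.le_sqrt_of_sq_le ?_
    rw [inv_pow]
    have : (0 : ℝ) < ((b - a) ^ 2)⁻¹ := by positivity
    nlinarith [Real.pi_gt_three]
  have h4 : μ.real (Ioc a b) ≤ Real.exp 1 * A * (b - a) := by
    have h5 : Real.exp (-1) * μ.real (Ioc a b) ≤ (b - a) * A :=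
      (h2.trans h1).trans (mul_le_mul_of_nonneg_right h3 hA0)
    have h6 : Real.exp 1 * Real.exp (-1) = 1 := by rw [← Real.exp_add]; simp
    calc μ.real (Ioc a b) = Real.exp 1 * (Real.exp (-1) * μ.real (Ioc a b)) := by
          rw [← mul_assoc, h6, one_mul]
      _ ≤ Real.exp 1 * ((b - a) * A) := mul_le_mul_of_nonneg_left h5 (Real.exp_pos _).le
      _ = _ := by ring
  rw [← ofReal_measureReal (measure_ne_top _ _)]
  refine (ENNReal.ofReal_le_ofReal h4).trans ?_
  rw [ENNReal.ofReal_mul (by positivity)]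
  rfl

/-- For `ξ ≠ 0` the argument of `-iξ` is `±π/2`, so its power has real part `cos (πν/2) |ξ| ^ ν`.
For `ν < 1` the cosine is positive and the characteristic function decays integrably. -/
theorem norm_exp_neg_cpow {ν : ℝ} (hν : 0 < ν) (ξ : ℝ) :
    ‖Complex.exp (-(-(ξ * Complex.I)) ^ (ν : ℂ))‖ =
      Real.exp (-Real.cos (Real.pi / 2 * ν) * |ξ| ^ ν) := by
  rw [Complex.norm_exp, Complex.neg_re]
  congr 1
  have hI : ∀ ε : ℝ, Complex.exp ((ε * (Real.pi / 2) * Complex.I) * ν) =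
      Complex.exp ((ε * (Real.pi / 2 * ν) : ℝ) * Complex.I) := fun ε => by
    congr 1; push_cast; ring
  rcases lt_trichotomy ξ 0 with h | rfl | h
  · have : -((ξ : ℂ) * Complex.I) = ((-ξ : ℝ) : ℂ) * Complex.I := by push_cast; ring
    rw [this, Complex.ofReal_mul_cpow (by linarith) hν.ne', Complex.re_ofReal_mul,
      Complex.cpow_def_of_ne_zero Complex.I_ne_zero, Complex.log_I, abs_of_neg h]
    have := hI 1
    simp only [Complex.ofReal_one, one_mul] at this
    rw [this, Complex.exp_ofReal_mul_I_re]
    ring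
  · simp [Complex.zero_cpow (show (ν : ℂ) ≠ 0 by exact_mod_cast hν.ne'), Real.zero_rpow hν.ne']
  · have : -((ξ : ℂ) * Complex.I) = (ξ : ℂ) * (-Complex.I) := by ring
    rw [this, Complex.ofReal_mul_cpow h hν.ne', Complex.re_ofReal_mul,
      Complex.cpow_def_of_ne_zero (neg_ne_zero.2 Complex.I_ne_zero), Complex.log_neg_I,
      abs_of_pos h]
    have := hI (-1)
    simp only [Complex.ofReal_neg, Complex.ofReal_one, neg_mul, one_mul] at this
    rw [neg_mul, neg_mul, this, ← neg_mul (Complex.ofReal _), ← Complex.ofReal_neg, Complex.exp_ofReal_mul_I_re,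
      Real.cos_neg]
    ring

theorem integrable_exp_neg_mul_abs_rpow {ν c : ℝ} (hν : 0 < ν) (hc : 0 < c) :
    Integrable fun ξ : ℝ => Real.exp (-c * |ξ| ^ ν) := by
  have h1 : IntegrableOn (fun ξ : ℝ => Real.exp (-c * |ξ| ^ ν)) (Ioi 0) := by
    have := integrableOn_rpow_mul_exp_neg_mul_rpow (s := 0) (by norm_num) hν hc
    refine this.congr_fun (fun ξ hξ => ?_) measurableSet_Ioi
    simp [abs_of_pos (show 0 < ξ from hξ)]
  have h2 : IntegrableOn (fun ξ : ℝ => Real.exp (-c * |ξ| ^ ν)) (Iic 0) := by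
    rw [integrableOn_Iic_iff_integrableOn_Iio]
    have := h1.comp_neg
    simpa using this
  rw [← integrableOn_univ, ← Iic_union_Ioi (a := (0 : ℝ))]
  exact h2.union h1

/-- The one-sided stable distribution of index `ν` has a density `g`; the Laplace transform of
`τ g(τ)` is minus the derivative of `exp (-w ^ ν)`. -/
theorem exists_stable_density {ν : ℝ} (hν : 0 < ν) (hν' : ν < 1) :
    ∃ g : ℝ → ℝ, Measurable g ∧ (∀ τ, 0 ≤ g τ) ∧ ∀ w > 0,
      IntegrableOn (fun τ => Real.exp (-w * τ) * (τ * g τ)) (Ioi 0) ∧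
      ∫ τ in Ioi (0 : ℝ), Real.exp (-w * τ) * (τ * g τ) =
        ν * w ^ (ν - 1) * Real.exp (-w ^ ν) := by
  obtain ⟨σ, hσ, hpos, hchar, hlap⟩ := exists_stable_law hν hν'
  have hcos : 0 < Real.cos (Real.pi / 2 * ν) := by
    refine Real.cos_pos_of_mem_Ioo ⟨?_, ?_⟩ <;> nlinarith [Real.pi_pos]
  have hci : Integrable (charFun σ) := by
    refine (integrable_exp_neg_mul_abs_rpow hν hcos).mono'
      (by fun_prop) (ae_of_all _ fun ξ => ?_)
    rw [hchar, norm_exp_neg_cpow hν]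
  have hac := absolutelyContinuous_of_integrable_charFun hci
  refine ⟨fun τ => (σ.rnDeriv volume τ).toReal, (Measure.measurable_rnDeriv _ _).ennreal_toReal,
    fun _ => ENNReal.toReal_nonneg, fun w hw => ?_⟩
  have hmem : ∀ t : ℝ, t ≤ 0 → t ∈ integrableExpSet id σ := fun t ht => by
    refine Integrable.of_bound (C := 1) (by fun_prop) ?_
    filter_upwards [hpos] with x hx
    rw [Real.norm_of_nonneg (Real.exp_pos _).le, Real.exp_le_one_iff]
    exact mul_nonpos_of_nonpos_of_nonneg ht hx
  have hint : -w ∈ interior (integrableExpSet id σ) := by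
    refine mem_interior.2 ⟨Iio 0, fun t ht => hmem t (le_of_lt ht), isOpen_Iio, ?_⟩
    simpa using hw
  have hmgf : ∀ t : ℝ, t ≤ 0 → mgf id σ t = Real.exp (-(-t) ^ ν) := fun t ht => by
    rw [← hlap (-t) (by linarith), mgf]
    refine integral_congr_ae ?_
    filter_upwards [hpos] with x hx
    simp [max_eq_left hx]
  -- The derivative of the moment generating function at `-w` is computed twice: as the integral of
  -- `x * exp (-w x)` and from the explicit formula.
  have hd1 := hasDerivAt_mgf hint
  have hd2 : HasDerivAt (mgf id σ) (ν * w ^ (ν - 1) * Real.exp (-w ^ ν)) (-w) := by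
    have h1 : HasDerivAt (fun t : ℝ => Real.exp (-(-t) ^ ν))
        (ν * w ^ (ν - 1) * Real.exp (-w ^ ν)) (-w) := by
      have h2 : HasDerivAt (fun t : ℝ => (-t) ^ ν) (-1 * ν * (- -w) ^ (ν - 1)) (-w) :=
        (hasDerivAt_neg (-w)).rpow_const (Or.inl (by simpa using hw.ne'))
      have h3 := h2.neg.exp
      rw [Pi.neg_apply, neg_neg] at h3
      exact h3.congr_deriv (by ring)
    refine h1.congr_of_eventuallyEq ?_
    filter_upwards [Iio_mem_nhds (show -w < 0 by linarith)] with t ht using hmgf t (le_of_lt ht)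
  have heq := hd1.unique hd2
  -- Absolute continuity excludes an atom at `0`, so restricting to `(0, ∞)` loses nothing.
  have hpos' : ∀ᵐ x ∂σ, x ∈ Ioi (0 : ℝ) := by
    have h0 : ∀ᵐ x ∂σ, x ≠ 0 := by
      rw [ae_iff]; simp only [not_not]
      exact hac (by simp)
    filter_upwards [hpos, h0] with x hx hx0 using lt_of_le_of_ne hx (Ne.symm hx0)
  have hi := integrable_pow_mul_exp_of_mem_interior_integrableExpSet hint 1
  have hfun : (fun τ => Real.exp (-w * τ) * (τ * (σ.rnDeriv volume τ).toReal)) =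
      fun τ => (σ.rnDeriv volume τ).toReal • (id τ ^ 1 * Real.exp (-w * id τ)) := by
    funext τ; simp; ring
  rw [hfun]
  refine ⟨((integrable_rnDeriv_smul_iff hac).2 hi).integrableOn, ?_⟩
  rw [setIntegral_rnDeriv_smul hac measurableSet_Ioi, ← heq,
    Measure.restrict_eq_self_of_ae_mem hpos']
  simp

end

/-! ### The inverse stable law and its moments -/

noncomputable section

/-- `m` is the law of a variable `X` such that `t ^ ν * X` is distributed like the inverse at `t` of
the stable subordinator of index `ν`, expressed through the Laplace transform in `t`. -/
def IsMittagLefflerLaw (ν : ℝ) (m : Measure ℝ) : Prop :=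
  ∀ h : ℝ → ℝ≥0∞, Measurable h → ∀ z > 0,
    ∫⁻ t in Ioi (0 : ℝ), ENNReal.ofReal (Real.exp (-z * t)) * ∫⁻ x, h (t ^ ν * x) ∂m =
      ∫⁻ s in Ioi (0 : ℝ), h s * ENNReal.ofReal (z ^ (ν - 1) * Real.exp (-s * z ^ ν))

theorem lintegral_exp_neg_mul {z : ℝ} (hz : 0 < z) :
    ∫⁻ t in Ioi (0 : ℝ), ENNReal.ofReal (Real.exp (-z * t)) = ENNReal.ofReal (1 / z) := by
  rw [← integral_exp_neg_mul_Ioi hz, ofReal_integral_eq_lintegral_ofReal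
    (integrableOn_exp_neg_mul hz) (ae_of_all _ fun _ => (Real.exp_pos _).le)]

theorem IsMittagLefflerLaw.isProbabilityMeasure {ν : ℝ} {m : Measure ℝ}
    (hm : IsMittagLefflerLaw ν m) : IsProbabilityMeasure m := by
  have h := hm (fun _ => 1) measurable_const 1 one_pos
  simp only [lintegral_const, one_mul, Real.one_rpow, mul_one] at h
  have e : ∀ s : ℝ, Real.exp (-s) = Real.exp (-1 * s) := fun s => by rw [neg_one_mul]
  rw [lintegral_mul_const _ (by fun_prop), lintegral_exp_neg_mul one_pos] at h
  simp only [e] at h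
  rw [lintegral_exp_neg_mul one_pos] at h
  exact ⟨by simpa using h⟩

theorem lintegral_comp_const_mul {c : ℝ} (hc : 0 < c) {F : ℝ → ℝ≥0∞} (hF : Measurable F) :
    ENNReal.ofReal c * ∫⁻ x, F (c * x) = ∫⁻ x, F x := by
  rw [← lintegral_map hF (measurable_const_mul c), Real.map_volume_mul_left hc.ne',
    lintegral_smul_measure, smul_eq_mul, ← mul_assoc, ← ENNReal.ofReal_mul hc.le,
    abs_of_pos (inv_pos.2 hc), mul_inv_cancel₀ hc.ne', ENNReal.ofReal_one, one_mul]

/-- For `ν < 1` the law of the inverse stable subordinator has a density. -/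
theorem exists_isMittagLefflerLaw_density {ν : ℝ} (hν : 0 < ν) (hν' : ν < 1) :
    ∃ (m : Measure ℝ) (q : ℝ → ℝ → ℝ), IsMittagLefflerLaw ν m ∧
      Measurable (Function.uncurry q) ∧ (∀ s t, 0 ≤ q s t) ∧
      (∀ t : ℝ, 0 < t → m.map (fun x => t ^ ν * x) =
        (volume.restrict (Ioi (0 : ℝ))).withDensity (fun s => ENNReal.ofReal (q s t))) ∧
      ∀ s > 0, ∀ z > 0,
        IntegrableOn (fun t : ℝ => Real.exp (-z * t) * q s t) (Ioi 0) ∧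
        ∫ t in Ioi (0 : ℝ), Real.exp (-z * t) * q s t = z ^ (ν - 1) * Real.exp (-s * z ^ ν) := by
  obtain ⟨g, hgm, hg0, hg⟩ := exists_stable_density hν hν'
  let G : ℝ → ℝ := fun τ => τ * g τ
  have hGm : Measurable G := measurable_id.mul hgm
  -- If `Y` has density `g`, the inverse subordinator exceeds `s` at time `t` with probability `P(s
  -- ^ (1/ν) Y < t)`. Minus the derivative in `s` of this is `G(τ) / (ν s)` with `τ = t s ^ (-1/ν)`.
  let q : ℝ → ℝ → ℝ := fun s t =>
    if 0 < s ∧ 0 < t then G (t * s ^ (-(1 / ν))) * (ν * s)⁻¹ else 0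
  have hqm : Measurable (Function.uncurry q) := by
    refine Measurable.ite ((measurableSet_lt measurable_const measurable_fst).inter
      (measurableSet_lt measurable_const measurable_snd)) ?_ measurable_const
    exact (hGm.comp (by fun_prop)).mul (by fun_prop)
  have hq0 : ∀ s t, 0 ≤ q s t := fun s t => by
    simp only [q]
    split_ifs with h
    · have h1 := h.1
      have h2 : 0 < t * s ^ (-(1 / ν)) := mul_pos h.2 (Real.rpow_pos_of_pos h1 _)
      exact mul_nonneg (mul_nonneg h2.le (hg0 _)) (by positivity)
    · exact le_rfl
  have hqneg : ∀ s t, s ≤ 0 → q s t = 0 := fun s t h => if_neg fun h' => absurd h'.1 (not_lt.2 h)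
  have hqs : ∀ t, Measurable fun s => q s t := fun t =>
    hqm.comp (measurable_id.prodMk measurable_const)
  have hqt : ∀ s, Measurable fun t => q s t := fun s =>
    hqm.comp (measurable_const.prodMk measurable_id)
  have hind : ∀ (t : ℝ) (F : ℝ → ℝ≥0∞), ∫⁻ s in Ioi (0 : ℝ), F s * ENNReal.ofReal (q s t) =
      ∫⁻ s, F s * ENNReal.ofReal (q s t) := fun t F => by
    rw [← lintegral_indicator measurableSet_Ioi]
    refine lintegral_congr fun s => ?_
    by_cases hs : s ∈ Ioi (0 : ℝ)
    · rw [indicator_of_mem hs]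
    · rw [indicator_of_notMem hs, hqneg s t (not_lt.1 hs)]; simp
  let m : Measure ℝ := (volume.restrict (Ioi (0 : ℝ))).withDensity fun s => ENNReal.ofReal (q s 1)
  -- Self-similarity: `t ^ ν * q (t ^ ν * x) t = q x 1`, so the law at time `t` is the law at time
  -- `1` scaled by `t ^ ν`.
  have hmint : ∀ h : ℝ → ℝ≥0∞, Measurable h → ∀ t > 0, ∫⁻ x, h (t ^ ν * x) ∂m =
      ∫⁻ s in Ioi (0 : ℝ), h s * ENNReal.ofReal (q s t) := by
    intro h hh t ht
    have hc : 0 < t ^ ν := Real.rpow_pos_of_pos ht ν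
    rw [lintegral_withDensity_eq_lintegral_mul₀ (g := fun x => h (t ^ ν * x))
      (hqs 1).ennreal_ofReal.aemeasurable (hh.comp (measurable_const_mul _)).aemeasurable]
    simp only [Pi.mul_apply]
    have e1 : ∀ x, ENNReal.ofReal (q x 1) * h (t ^ ν * x) =
        h (t ^ ν * x) * ENNReal.ofReal (q x 1) := fun x => mul_comm _ _
    simp only [e1]
    rw [hind 1 (fun x => h (t ^ ν * x)), hind t h,
      ← lintegral_comp_const_mul (F := fun s => h s * ENNReal.ofReal (q s t)) hc
        (hh.mul (hqs t).ennreal_ofReal),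
      ← lintegral_const_mul (f := fun x => h (t ^ ν * x) * ENNReal.ofReal (q (t ^ ν * x) t)) _
        ((hh.mul (hqs t).ennreal_ofReal).comp (measurable_const_mul _))]
    refine lintegral_congr fun x => ?_
    rw [mul_left_comm, ← ENNReal.ofReal_mul hc.le]
    congr 2
    rcases le_or_gt x 0 with hx | hx
    · rw [hqneg x 1 hx, hqneg _ t (mul_nonpos_of_nonneg_of_nonpos hc.le hx), mul_zero]
    · simp only [q]
      rw [if_pos ⟨hx, one_pos⟩, if_pos ⟨mul_pos hc hx, ht⟩, one_mul]
      have : t * (t ^ ν * x) ^ (-(1 / ν)) = x ^ (-(1 / ν)) := by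
        rw [Real.mul_rpow hc.le hx.le, ← Real.rpow_mul ht.le,
          show ν * -(1 / ν) = -1 by field_simp, Real.rpow_neg_one]
        field_simp
      rw [this]
      field_simp
  have hlap : ∀ s > 0, ∀ z > 0,
      IntegrableOn (fun t : ℝ => Real.exp (-z * t) * q s t) (Ioi 0) ∧
      ∫ t in Ioi (0 : ℝ), Real.exp (-z * t) * q s t = z ^ (ν - 1) * Real.exp (-s * z ^ ν) := by
    intro s hs z hz
    have hb : 0 < s ^ (-(1 / ν)) := Real.rpow_pos_of_pos hs _
    set b := s ^ (-(1 / ν)) with hbdef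
    have hw : 0 < z / b := div_pos hz hb
    obtain ⟨hi, he⟩ := hg (z / b) hw
    -- The substitution `τ = b t` reduces to the transform of `τ g(τ)` at `w = z / b`, and `w ^ ν =
    -- s * z ^ ν`.
    have hfun : ∀ t ∈ Ioi (0 : ℝ), Real.exp (-z * t) * q s t =
        (fun τ => Real.exp (-(z / b) * τ) * (τ * g τ)) (b * t) * (ν * s)⁻¹ := by
      intro t ht
      simp only [q, G]
      rw [if_pos ⟨hs, ht⟩, mul_comm t b, show -(z / b) * (b * t) = -z * t by field_simp]
      ring
    have hi2 := (integrableOn_Ioi_comp_mul_left_iff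
      (fun τ => Real.exp (-(z / b) * τ) * (τ * g τ)) 0 hb).2 (by simpa using hi)
    constructor
    · exact (IntegrableOn.congr_fun (hi2.mul_const ((ν * s)⁻¹)) (fun t ht => (hfun t ht).symm)
        measurableSet_Ioi)
    · rw [setIntegral_congr_fun measurableSet_Ioi hfun, integral_mul_const,
        integral_comp_mul_left_Ioi (fun τ => Real.exp (-(z / b) * τ) * (τ * g τ)) 0 hb, mul_zero,
        he, smul_eq_mul]
      have h1 : (z / b) ^ ν = s * z ^ ν := by
        rw [Real.div_rpow hz.le hb.le, hbdef, ← Real.rpow_mul hs.le,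
          show -(1 / ν) * ν = -1 by field_simp, Real.rpow_neg_one]
        field_simp
      rw [Real.rpow_sub_one hw.ne', Real.rpow_sub_one hz.ne', h1, neg_mul]
      field_simp
  refine ⟨m, q, fun h hh z hz => ?_, hqm, hq0, fun t ht => ?_, hlap⟩
  · have hz1 : Measurable fun t : ℝ => ENNReal.ofReal (Real.exp (-z * t)) := by fun_prop
    have e1 : ∫⁻ t in Ioi (0 : ℝ), ENNReal.ofReal (Real.exp (-z * t)) * ∫⁻ x, h (t ^ ν * x) ∂m =
        ∫⁻ t in Ioi (0 : ℝ), ∫⁻ s in Ioi (0 : ℝ),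
          h s * ENNReal.ofReal (Real.exp (-z * t) * q s t) := by
      refine setLIntegral_congr_fun measurableSet_Ioi fun t ht => ?_
      rw [hmint h hh t ht, ← lintegral_const_mul (f := fun s => h s * ENNReal.ofReal (q s t)) _
        (hh.mul (hqs t).ennreal_ofReal)]
      refine lintegral_congr fun s => ?_
      rw [ENNReal.ofReal_mul (Real.exp_pos _).le]
      ring
    rw [e1, lintegral_lintegral_swap]
    · refine setLIntegral_congr_fun measurableSet_Ioi fun s hs => ?_
      rw [lintegral_const_mul _ (by have := hqt s; fun_prop), ← (hlap s hs z hz).2,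
        ofReal_integral_eq_lintegral_ofReal (hlap s hs z hz).1
          (ae_of_all _ fun t => mul_nonneg (Real.exp_pos _).le (hq0 s t))]
    · have h2 : Measurable fun p : ℝ × ℝ => q p.2 p.1 := hqm.comp measurable_swap
      refine Measurable.aemeasurable ?_
      simp only [Function.uncurry_def]
      exact (hh.comp measurable_snd).mul (Measurable.ennreal_ofReal (by fun_prop))
  · refine Measure.ext_of_lintegral _ fun h hh => ?_
    rw [lintegral_map hh (measurable_const_mul _), hmint h hh t ht,
      lintegral_withDensity_eq_lintegral_mul₀ (hqs t).ennreal_ofReal.aemeasurable hh.aemeasurable]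
    simp only [Pi.mul_apply, mul_comm]

theorem isMittagLefflerLaw_one : IsMittagLefflerLaw 1 (Measure.dirac 1) := by
  intro h hh z hz
  refine setLIntegral_congr_fun measurableSet_Ioi fun t ht => ?_
  have : Measurable fun x : ℝ => h (t ^ (1 : ℝ) * x) := hh.comp (measurable_const_mul _)
  rw [lintegral_dirac' _ this, Real.rpow_one, Real.rpow_one, sub_self, Real.rpow_zero, mul_one,
    one_mul, mul_comm, show -z * t = -t * z by ring]

theorem exists_isMittagLefflerLaw {ν : ℝ} (hν : 0 < ν) (hν' : ν ≤ 1) :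
    ∃ m, IsMittagLefflerLaw ν m := by
  rcases hν'.eq_or_lt with rfl | h
  · exact ⟨_, isMittagLefflerLaw_one⟩
  · obtain ⟨m, _, hm, _⟩ := exists_isMittagLefflerLaw_density hν h
    exact ⟨m, hm⟩

namespace IsMittagLefflerLaw

variable {ν : ℝ} {m : Measure ℝ}

theorem ae_nonneg (hm : IsMittagLefflerLaw ν m) : ∀ᵐ x ∂m, 0 ≤ x := by
  have h := hm (indicator (Iio 0) fun _ => 1) (measurable_const.indicator measurableSet_Iio) 1
    one_pos
  have h1 : ∀ t ∈ Ioi (0 : ℝ), ∫⁻ x, indicator (Iio 0) (fun _ => (1 : ℝ≥0∞)) (t ^ ν * x) ∂m =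
      m (Iio 0) := by
    intro t ht
    have hc : 0 < t ^ ν := Real.rpow_pos_of_pos ht ν
    rw [← lintegral_indicator_one measurableSet_Iio]
    refine lintegral_congr fun x => ?_
    simp only [indicator, mem_Iio, mul_neg_iff, hc, hc.not_gt, true_and, false_and, or_false,
      Pi.one_apply]
  have h2 : ∫⁻ s in Ioi (0 : ℝ), indicator (Iio 0) (fun _ => (1 : ℝ≥0∞)) s *
      ENNReal.ofReal (1 ^ (ν - 1) * Real.exp (-s * 1 ^ ν)) = 0 := by
    rw [← lintegral_zero (μ := volume.restrict (Ioi (0 : ℝ)))]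
    refine setLIntegral_congr_fun measurableSet_Ioi fun s hs => ?_
    rw [indicator_of_notMem (by simpa using le_of_lt hs), zero_mul]
  rw [h2, setLIntegral_congr_fun measurableSet_Ioi fun t ht => by rw [h1 t ht],
    lintegral_mul_const _ (by fun_prop), lintegral_exp_neg_mul one_pos] at h
  have h3 : m (Iio 0) = 0 := by simpa using h
  rw [ae_iff]
  simp only [not_le]
  exact h3

/-- For `h x = x ^ 2` the left side of the defining identity factors as a nonzero constant times the
second moment, and the right side is a finite Gamma integral. Two moments are needed to
differentiate twice in the scale `t ^ ν`. -/
theorem integrable_sq (hm : IsMittagLefflerLaw ν m) :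
    Integrable (fun x => x ^ 2) m := by
  have h := hm (fun x => ENNReal.ofReal (x ^ 2)) (by fun_prop) 1 one_pos
  have hfin : ∫⁻ s in Ioi (0 : ℝ), ENNReal.ofReal (s ^ 2) *
      ENNReal.ofReal (1 ^ (ν - 1) * Real.exp (-s * 1 ^ ν)) < ∞ := by
    have hi := integrableOn_rpow_mul_exp_neg_mul_rpow (s := 2) (p := 1) (b := 1) (by norm_num)
      one_pos one_pos
    have := hi.lintegral_lt_top
    refine lt_of_eq_of_lt (lintegral_congr fun s => ?_) this
    rw [← ENNReal.ofReal_mul (sq_nonneg s)]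
    simp
  rw [← h] at hfin
  have e : ∀ t ∈ Ioi (0 : ℝ), ENNReal.ofReal (Real.exp (-1 * t)) *
      ∫⁻ x, ENNReal.ofReal ((t ^ ν * x) ^ 2) ∂m =
      ENNReal.ofReal (Real.exp (-1 * t) * (t ^ ν) ^ 2) * ∫⁻ x, ENNReal.ofReal (x ^ 2) ∂m := by
    intro t ht
    simp only [mul_pow]
    simp only [ENNReal.ofReal_mul (sq_nonneg (t ^ ν)), ENNReal.ofReal_mul (Real.exp_pos _).le]
    rw [lintegral_const_mul _ (by fun_prop), mul_assoc]
  rw [setLIntegral_congr_fun measurableSet_Ioi e, lintegral_mul_const _ (by fun_prop)] at hfin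
  have hne : ∫⁻ t in Ioi (0 : ℝ), ENNReal.ofReal (Real.exp (-1 * t) * (t ^ ν) ^ 2) ≠ 0 := by
    intro h0
    rw [lintegral_eq_zero_iff (by fun_prop), EventuallyEq, ae_restrict_iff' measurableSet_Ioi] at h0
    have : volume (Ioi (0 : ℝ)) = 0 := by
      refine measure_mono_null (fun t ht => ?_) h0
      simp only [mem_compl_iff]
      intro h1
      have h2 := h1 ht
      simp only [Pi.zero_apply, ENNReal.ofReal_eq_zero] at h2
      have : 0 < Real.exp (-1 * t) * (t ^ ν) ^ 2 :=
        mul_pos (Real.exp_pos _) (pow_pos (Real.rpow_pos_of_pos ht ν) 2)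
      linarith
    simp at this
  refine ⟨by fun_prop, ?_⟩
  rw [hasFiniteIntegral_iff_ofReal (ae_of_all _ fun x => sq_nonneg x)]
  by_contra htop
  rw [not_lt, top_le_iff] at htop
  rw [htop, ENNReal.mul_top hne] at hfin
  exact lt_irrefl _ hfin

theorem integrable_id (hm : IsMittagLefflerLaw ν m) : Integrable (fun x => x) m := by
  have := hm.isProbabilityMeasure
  refine ((hm.integrable_sq).add (integrable_const (1 : ℝ))).mono' (by fun_prop)
    (ae_of_all _ fun x => ?_)
  simp only [Pi.add_apply, Real.norm_eq_abs]
  nlinarith [sq_nonneg (|x| - 1), sq_abs x]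

/-- Recasting the defining identity as an equality of measures carries it over from nonnegative
functions to signed Bochner integrals. -/
theorem map_prod_eq (hm : IsMittagLefflerLaw ν m) {z : ℝ} (hz : 0 < z) :
    (((volume.restrict (Ioi (0 : ℝ))).withDensity
      fun t => ENNReal.ofReal (Real.exp (-z * t))).prod m).map (fun p => p.1 ^ ν * p.2) =
    (volume.restrict (Ioi (0 : ℝ))).withDensity
      fun s => ENNReal.ofReal (z ^ (ν - 1) * Real.exp (-s * z ^ ν)) := by
  have := hm.isProbabilityMeasure
  refine Measure.ext_of_lintegral _ fun h hh => ?_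
  have h1 : Measurable fun p : ℝ × ℝ => h (p.1 ^ ν * p.2) := hh.comp (by fun_prop)
  rw [lintegral_map hh (by fun_prop), lintegral_prod _ h1.aemeasurable,
    lintegral_withDensity_eq_lintegral_mul₀ (by fun_prop) h1.lintegral_prod_right'.aemeasurable,
    lintegral_withDensity_eq_lintegral_mul₀ (by fun_prop) hh.aemeasurable]
  simp only [Pi.mul_apply]
  rw [hm h hh z hz]
  simp only [mul_comm]

theorem laplace (hm : IsMittagLefflerLaw ν m) {z : ℝ} (hz : 0 < z) {h : ℝ → ℝ}
    (hh : Measurable h) {C : ℝ} (hC : ∀ s, |h s| ≤ C) :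
    ∫ t in Ioi (0 : ℝ), Real.exp (-z * t) * ∫ x, h (t ^ ν * x) ∂m =
      ∫ s in Ioi (0 : ℝ), z ^ (ν - 1) * Real.exp (-s * z ^ ν) * h s := by
  have := hm.isProbabilityMeasure
  have hfin : IsFiniteMeasure ((volume.restrict (Ioi (0 : ℝ))).withDensity
      fun t => ENNReal.ofReal (Real.exp (-z * t))) :=
    isFiniteMeasure_withDensity_ofReal (integrableOn_exp_neg_mul hz).2
  have h1 := congrArg (fun μ => ∫ x, h x ∂μ) (hm.map_prod_eq hz)
  rw [integral_map (by fun_prop) hh.aestronglyMeasurable, integral_prod,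
    integral_withDensity_eq_integral_toReal_smul (by fun_prop) (by simp),
    integral_withDensity_eq_integral_toReal_smul (by fun_prop) (by simp)] at h1
  · refine Eq.trans ?_ (h1.trans ?_)
    · refine integral_congr_ae (ae_of_all _ fun t => ?_)
      beta_reduce
      rw [ENNReal.toReal_ofReal (Real.exp_pos _).le, smul_eq_mul]
    · refine integral_congr_ae (ae_of_all _ fun t => ?_)
      beta_reduce
      rw [ENNReal.toReal_ofReal (mul_nonneg (Real.rpow_nonneg hz.le _) (Real.exp_pos _).le),
        smul_eq_mul]
  · exact Integrable.of_bound (C := C) (hh.comp (by fun_prop)).aestronglyMeasurable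
      (ae_of_all _ fun p => hC _)

end IsMittagLefflerLaw

end

/-! ### Fractional integrals of functions with a power singularity at zero -/

noncomputable section

/-- The substitution `s = t r` fixes the domain of integration, so that dependence on `t` can be
treated by dominated convergence. -/
theorem fracInt_scale {a t : ℝ} (ht : 0 < t) (g : ℝ → ℝ) :
    fracInt a g t = 1 / Real.Gamma a *
      ∫ r in Ioo (0 : ℝ) 1, t ^ a * g (t * r) * (1 - r) ^ (a - 1) := by
  unfold fracInt
  congr 1
  have h := intervalIntegral.integral_comp_mul_left (a := 0) (b := 1)
    (fun s => g s * (t - s) ^ (a - 1)) ht.ne'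
  rw [mul_zero, mul_one] at h
  have h2 : ∫ s in (0 : ℝ)..t, g s * (t - s) ^ (a - 1) =
      t * ∫ r in (0 : ℝ)..1, g (t * r) * (t - t * r) ^ (a - 1) := by
    rw [h, smul_eq_mul, ← mul_assoc, mul_inv_cancel₀ ht.ne', one_mul]
  rw [h2, intervalIntegral.integral_of_le zero_le_one, integral_Ioc_eq_integral_Ioo,
    ← integral_const_mul]
  refine setIntegral_congr_fun measurableSet_Ioo fun r hr => ?_
  rw [show t - t * r = t * (1 - r) by ring, Real.mul_rpow ht.le (by linarith [hr.2]),
    Real.rpow_sub_one ht.ne']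
  field_simp

theorem integrableOn_beta_Ioo {a : ℝ} (ha : 0 < a) (ha1 : a < 1) :
    IntegrableOn (fun r : ℝ => r ^ (-a) * (1 - r) ^ (a - 1)) (Ioo 0 1) := by
  have h := intervalIntegrable_beta ha (show 0 < 1 - a by linarith) one_pos
  rw [intervalIntegrable_iff_integrableOn_Ioo_of_le zero_le_one] at h
  simpa using h

section Singular

variable {a C : ℝ} {g : ℝ → ℝ}

/-- The factor `t ^ a` exactly cancels the singularity in `t`, leaving a beta integrand as a
majorant uniform in `t`. -/
theorem abs_scale_le (hg : ∀ s > 0, |g s| ≤ C * s ^ (-a)) {t r : ℝ} (ht : 0 < t)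
    (hr : r ∈ Ioo (0 : ℝ) 1) :
    |t ^ a * g (t * r) * (1 - r) ^ (a - 1)| ≤ C * (r ^ (-a) * (1 - r) ^ (a - 1)) := by
  have h1 := hg (t * r) (mul_pos ht hr.1)
  have h2 : 0 ≤ (1 - r) ^ (a - 1) := Real.rpow_nonneg (by linarith [hr.2]) _
  have h3 : 0 < t ^ a := Real.rpow_pos_of_pos ht a
  rw [abs_mul, abs_mul, abs_of_pos h3, abs_of_nonneg h2, ← mul_assoc]
  refine mul_le_mul_of_nonneg_right ?_ h2
  calc t ^ a * |g (t * r)| ≤ t ^ a * (C * (t * r) ^ (-a)) := mul_le_mul_of_nonneg_left h1 h3.le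
    _ = C * r ^ (-a) := by
      rw [Real.mul_rpow ht.le hr.1.le, Real.rpow_neg ht.le]
      field_simp

theorem abs_fracInt_le_of_singular (ha : 0 < a) (ha1 : a < 1)
    (hg : ∀ s > 0, |g s| ≤ C * s ^ (-a)) :
    ∃ K, ∀ t > 0, |fracInt a g t| ≤ K := by
  refine ⟨|1 / Real.Gamma a| * ∫ r in Ioo (0 : ℝ) 1, C * (r ^ (-a) * (1 - r) ^ (a - 1)),
    fun t ht => ?_⟩
  rw [fracInt_scale ht, abs_mul]
  refine mul_le_mul_of_nonneg_left ?_ (abs_nonneg _)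
  refine (Real.norm_eq_abs _).symm.le.trans
    (norm_integral_le_of_norm_le ((integrableOn_beta_Ioo ha ha1).const_mul C) ?_)
  filter_upwards [ae_restrict_mem measurableSet_Ioo] with r hr using abs_scale_le hg ht hr

theorem continuousOn_fracInt_of_singular (ha : 0 < a) (ha1 : a < 1)
    (hgc : ContinuousOn g (Ioi 0)) (hg : ∀ s > 0, |g s| ≤ C * s ^ (-a)) :
    ContinuousOn (fracInt a g) (Ioi 0) := by
  have h : ContinuousOn (fun t => 1 / Real.Gamma a *
      ∫ r in Ioo (0 : ℝ) 1, t ^ a * g (t * r) * (1 - r) ^ (a - 1)) (Ioi 0) := by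
    refine continuousOn_const.mul (continuousOn_of_dominated
      (bound := fun r => C * (r ^ (-a) * (1 - r) ^ (a - 1))) (fun t ht => ?_) (fun t ht => ?_)
      ((integrableOn_beta_Ioo ha ha1).const_mul C) ?_)
    · refine ContinuousOn.aestronglyMeasurable ?_ measurableSet_Ioo
      refine (continuousOn_const.mul (hgc.comp (by fun_prop)
        fun r hr => mul_pos ht hr.1)).mul ?_
      exact ContinuousOn.rpow_const (by fun_prop) fun r hr => Or.inl (by linarith [hr.2])
    · filter_upwards [ae_restrict_mem measurableSet_Ioo] with r hr using abs_scale_le hg ht hr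
    · filter_upwards [ae_restrict_mem measurableSet_Ioo] with r hr
      refine ((ContinuousOn.rpow_const continuousOn_id fun t ht => Or.inl (ne_of_gt ht)).mul
        (hgc.comp (by fun_prop) fun t ht => mul_pos ht hr.1)).mul continuousOn_const
  exact h.congr fun t ht => fracInt_scale ht g

theorem intervalIntegrable_of_singular (ha1 : a < 1) (hgc : ContinuousOn g (Ioi 0))
    (hg : ∀ s > 0, |g s| ≤ C * s ^ (-a)) {t : ℝ} (ht : 0 < t) :
    IntervalIntegrable g volume 0 t := by
  have h := (intervalIntegral.intervalIntegrable_rpow' (a := 0) (b := t) (r := -a)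
    (by linarith)).const_mul C
  rw [intervalIntegrable_iff_integrableOn_Ioc_of_le ht.le] at h ⊢
  refine Integrable.mono' h ((hgc.mono fun s hs => hs.1).aestronglyMeasurable measurableSet_Ioc) ?_
  filter_upwards [ae_restrict_mem measurableSet_Ioc] with s hs using hg s hs.1

theorem intervalIntegrable_kernel_of_singular (ha : 0 < a) (ha1 : a < 1)
    (hgc : ContinuousOn g (Ioi 0)) (hg : ∀ s > 0, |g s| ≤ C * s ^ (-a)) {t : ℝ} (ht : 0 < t) :
    IntervalIntegrable (fun s => g s * (t - s) ^ (a - 1)) volume 0 t := by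
  have h := (intervalIntegrable_beta ha (show 0 < 1 - a by linarith) ht).const_mul C
  rw [intervalIntegrable_iff_integrableOn_Ioo_of_le ht.le] at h ⊢
  refine Integrable.mono' h (ContinuousOn.aestronglyMeasurable ?_ measurableSet_Ioo) ?_
  · refine (hgc.mono fun s hs => hs.1).mul ?_
    exact ContinuousOn.rpow_const (by fun_prop) fun r hr => Or.inl (by linarith [hr.2])
  · filter_upwards [ae_restrict_mem measurableSet_Ioo] with s hs
    have h2 : 0 ≤ (t - s) ^ (a - 1) := Real.rpow_nonneg (by linarith [hs.2]) _
    rw [norm_mul, Real.norm_of_nonneg h2, ← mul_assoc, show 1 - a - 1 = -a by ring]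
    exact mul_le_mul_of_nonneg_right (hg s hs.1) h2

end Singular

/-- A function whose derivative of order `n = ⌈α⌉` is continuous on `(0, ∞)` and `O(t ^ (α - n))`
has a bounded continuous Caputo derivative of order `α`. -/
theorem CaputoDifferentiable.of_bound {α C : ℝ} (hα : 0 < α) {F : ℝ → ℝ}
    (hF : ContinuousOn F (Ici 0))
    (hd : ∀ k < ⌈α⌉₊, DifferentiableOn ℝ (iteratedDeriv k F) (Ioi 0))
    (hc : ContinuousOn (iteratedDeriv ⌈α⌉₊ F) (Ioi 0))
    (hb : ∀ t > 0, |iteratedDeriv ⌈α⌉₊ F t| ≤ C * t ^ (α - ⌈α⌉₊)) :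
    CaputoDifferentiable α F ∧ ContinuousOn (caputoDeriv α F) (Ioi 0) ∧
      ∃ K, ∀ t > 0, |caputoDeriv α F t| ≤ K := by
  have hlt : (⌈α⌉₊ : ℝ) - α < 1 := by linarith [Nat.ceil_lt_add_one hα.le]
  have hb' : ∀ t > 0, |iteratedDeriv ⌈α⌉₊ F t| ≤ C * t ^ (-((⌈α⌉₊ : ℝ) - α)) := by
    simpa only [neg_sub] using hb
  have hpos : α ≠ ⌈α⌉₊ → 0 < (⌈α⌉₊ : ℝ) - α := fun h =>
    sub_pos.2 (lt_of_le_of_ne (Nat.le_ceil α) h)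
  refine ⟨⟨hF, hd, fun t ht => intervalIntegrable_of_singular hlt hc hb' ht,
    fun h t ht => intervalIntegrable_kernel_of_singular (hpos h) hlt hc hb' ht⟩, ?_⟩
  by_cases h : α = ⌈α⌉₊
  · refine ⟨hc.congr fun t _ => caputoDeriv_of_eq h F t, C, fun t ht => ?_⟩
    rw [caputoDeriv_of_eq h]
    have := hb t ht
    rwa [sub_eq_zero.2 h, Real.rpow_zero, mul_one] at this
  · have he : caputoDeriv α F = fracInt (⌈α⌉₊ - α) (iteratedDeriv ⌈α⌉₊ F) :=
      funext fun t => caputoDeriv_of_ne h F t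
    rw [he]
    exact ⟨continuousOn_fracInt_of_singular (hpos h) hlt hc hb',
      abs_fracInt_le_of_singular (hpos h) hlt hb'⟩

end

/-! ### The symmetrized law and integrals in a scaled variable -/

noncomputable section

/-- The law of `± t ^ ν X` with a symmetric random sign, where `X` has law `m`. -/
def diffusionLaw (ν : ℝ) (m : Measure ℝ) (t : ℝ≥0) : Measure ℝ :=
  (2⁻¹ : ℝ≥0∞) • (m.map (fun x => (t : ℝ) ^ ν * x) + m.map (fun x => -((t : ℝ) ^ ν * x)))

/-- The even part of a function. -/
def evenPart (φ : ℝ → ℝ) (s : ℝ) : ℝ := (φ s + φ (-s)) / 2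

theorem contDiff_evenPart {φ : ℝ → ℝ} (hφ : ContDiff ℝ (⊤ : ℕ∞) φ) :
    ContDiff ℝ (⊤ : ℕ∞) (evenPart φ) := by
  unfold evenPart
  exact (hφ.add (hφ.comp contDiff_neg)).div_const 2

theorem hasCompactSupport_evenPart {φ : ℝ → ℝ} (hφ : HasCompactSupport φ) :
    HasCompactSupport (evenPart φ) := by
  have h : HasCompactSupport fun s => φ (-s) := hφ.comp_homeomorph (Homeomorph.neg ℝ)
  exact (hφ.add h).comp_left (g := fun y : ℝ => y / 2) (by simp)

theorem hasDerivAt_comp_neg {φ : ℝ → ℝ} (hφ : Differentiable ℝ φ) (s : ℝ) :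
    HasDerivAt (fun s => φ (-s)) (-deriv φ (-s)) s :=
  ((hφ (-s)).hasDerivAt.comp s (hasDerivAt_neg s)).congr_deriv (by ring)

theorem iteratedDeriv_two_evenPart {φ : ℝ → ℝ} (hφ : ContDiff ℝ (⊤ : ℕ∞) φ) :
    iteratedDeriv 2 (evenPart φ) = evenPart (iteratedDeriv 2 φ) := by
  have hd := contDiff_infty_iff_deriv.1 hφ
  have hd2 := contDiff_infty_iff_deriv.1 hd.2
  have h1 : deriv (evenPart φ) = fun s => (deriv φ s - deriv φ (-s)) / 2 := by
    funext s
    have := (((hd.1 s).hasDerivAt).add (hasDerivAt_comp_neg hd.1 s)).div_const 2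
    exact this.deriv.trans (by ring)
  have h2 : deriv (deriv (evenPart φ)) = evenPart (deriv (deriv φ)) := by
    rw [h1]
    funext s
    have := (((hd2.1 s).hasDerivAt).sub (hasDerivAt_comp_neg hd2.1 s)).div_const 2
    exact this.deriv.trans (by simp [evenPart])
  simpa only [iteratedDeriv_succ, iteratedDeriv_zero] using h2

theorem deriv_evenPart_zero {φ : ℝ → ℝ} (hφ : ContDiff ℝ (⊤ : ℕ∞) φ) :
    deriv (evenPart φ) 0 = 0 := by
  have hd := contDiff_infty_iff_deriv.1 hφ
  have := (((hd.1 0).hasDerivAt).add (hasDerivAt_comp_neg hd.1 0)).div_const 2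
  exact this.deriv.trans (by simp)

section

variable {ν : ℝ} {m : Measure ℝ}

theorem isProbabilityMeasure_diffusionLaw [IsProbabilityMeasure m] (t : ℝ≥0) :
    IsProbabilityMeasure (diffusionLaw ν m t) := by
  have h1 := Measure.isProbabilityMeasure_map (μ := m) (f := fun x => (t : ℝ) ^ ν * x)
    (by fun_prop)
  have h2 := Measure.isProbabilityMeasure_map (μ := m) (f := fun x => -((t : ℝ) ^ ν * x))
    (by fun_prop)
  constructor
  rw [diffusionLaw, Measure.smul_apply, Measure.add_apply, h1.measure_univ, h2.measure_univ,
    smul_eq_mul, one_add_one_eq_two, ENNReal.inv_mul_cancel two_ne_zero ENNReal.ofNat_ne_top]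

theorem integral_diffusionLaw [IsProbabilityMeasure m] {φ : ℝ → ℝ} (hφ : Continuous φ) {C : ℝ}
    (hC : ∀ s, |φ s| ≤ C) (t : ℝ≥0) :
    ∫ s, φ s ∂(diffusionLaw ν m t) = ∫ x, evenPart φ ((t : ℝ) ^ ν * x) ∂m := by
  have hi : ∀ f : ℝ → ℝ, Continuous f → Integrable (fun x => φ (f x)) m := fun f hf =>
    Integrable.of_bound (C := C) (hφ.comp hf).aestronglyMeasurable (ae_of_all _ fun x => hC _)
  have hi2 : ∀ f : ℝ → ℝ, Continuous f → Integrable φ (m.map f) := fun f hf =>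
    (integrable_map_measure hφ.aestronglyMeasurable hf.aemeasurable).2 (hi f hf)
  rw [diffusionLaw, integral_smul_measure, integral_add_measure (hi2 _ (by fun_prop))
    (hi2 _ (by fun_prop)), integral_map (by fun_prop) hφ.aestronglyMeasurable,
    integral_map (by fun_prop) hφ.aestronglyMeasurable, ← integral_add (hi _ (by fun_prop))
    (hi _ (by fun_prop))]
  simp only [evenPart, integral_div, smul_eq_mul, ENNReal.toReal_inv, ENNReal.toReal_ofNat]
  ring

theorem diffusionLaw_zero [IsProbabilityMeasure m] (hν : 0 < ν) :
    diffusionLaw ν m 0 = Measure.dirac 0 := by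
  simp only [diffusionLaw, NNReal.coe_zero, Real.zero_rpow hν.ne', zero_mul, neg_zero,
    Measure.map_const, measure_univ, one_smul]
  rw [← two_smul ℝ≥0∞, smul_smul, ENNReal.inv_mul_cancel two_ne_zero ENNReal.ofNat_ne_top,
    one_smul]

theorem folded_diffusionLaw (hm : IsMittagLefflerLaw ν m) (t : ℝ≥0) :
    folded (diffusionLaw ν m t) = m.map (fun x => (t : ℝ) ^ ν * x) := by
  have h0 : 0 ≤ (t : ℝ) ^ ν := Real.rpow_nonneg t.2 ν
  have e : ∀ x ∈ Ici (0 : ℝ), |(t : ℝ) ^ ν * x| = (t : ℝ) ^ ν * x := fun x hx =>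
    abs_of_nonneg (mul_nonneg h0 hx)
  have h1 : m.map (fun x => |(t : ℝ) ^ ν * x|) = m.map (fun x => (t : ℝ) ^ ν * x) :=
    Measure.map_congr (hm.ae_nonneg.mono fun x hx => e x hx)
  have hm1 : Measurable fun s : ℝ => |s| := continuous_abs.measurable
  rw [folded, diffusionLaw, Measure.map_smul, Measure.map_add _ _ hm1,
    Measure.map_map hm1 (by fun_prop), Measure.map_map hm1 (by fun_prop)]
  simp only [Function.comp_def, abs_neg]
  rw [h1, ← two_smul ℝ≥0∞, smul_smul, ENNReal.inv_mul_cancel two_ne_zero ENNReal.ofNat_ne_top,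
    one_smul]

theorem lintegral_folded_diffusionLaw (hm : IsMittagLefflerLaw ν m) {z : ℝ} (hz : 0 < z)
    {B : Set ℝ} (hB : MeasurableSet B) :
    ∫⁻ t in Ioi (0 : ℝ), ENNReal.ofReal (Real.exp (-z * t)) *
        folded (diffusionLaw ν m t.toNNReal) B =
      ∫⁻ s in B ∩ Ioi 0, ENNReal.ofReal (z ^ (ν - 1) * Real.exp (-s * z ^ ν)) := by
  have h := hm (indicator B 1) (measurable_one.indicator hB) z hz
  rw [← Measure.restrict_restrict hB, ← lintegral_indicator hB]
  refine Eq.trans ?_ (h.trans ?_)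
  · refine setLIntegral_congr_fun measurableSet_Ioi fun t ht => ?_
    have ht' : 0 < t := ht
    rw [folded_diffusionLaw hm, Real.coe_toNNReal _ ht'.le, ← lintegral_indicator_one hB,
      lintegral_map (measurable_one.indicator hB) (measurable_const_mul _)]
  · refine lintegral_congr fun s => ?_
    by_cases hs : s ∈ B <;> simp [hs]

/-- Integrals of functions of a scaled variable are differentiable in the scale. -/
theorem hasDerivAt_integral_scale {h h' : ℝ → ℝ} {w : ℝ → ℝ} {K K' : ℝ}
    (hd : ∀ s, HasDerivAt h (h' s) s)
    (hh' : Continuous h') (hK : ∀ s, |h s| ≤ K) (hK' : ∀ s, |h' s| ≤ K') (hw : Continuous w)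
    (hwi : Integrable w m) (hwi' : Integrable (fun x => w x * x) m) (r : ℝ) :
    HasDerivAt (fun r => ∫ x, w x * h (r * x) ∂m) (∫ x, w x * x * h' (r * x) ∂m) r := by
  have hc : Continuous h := continuous_iff_continuousAt.2 fun s => (hd s).continuousAt
  have := hasDerivAt_integral_of_dominated_loc_of_deriv_le (μ := m) (s := univ) (x₀ := r)
    (F := fun r x => w x * h (r * x)) (F' := fun r x => w x * x * h' (r * x))
    (bound := fun x => ‖w x * x‖ * K') univ_mem
    (Eventually.of_forall fun r => (hw.mul (hc.comp (by fun_prop))).aestronglyMeasurable)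
    (hwi.mul_bdd (c := K) (hc.comp (by fun_prop)).aestronglyMeasurable (ae_of_all _ fun x => hK _))
    ((hw.mul continuous_id).mul (hh'.comp (by fun_prop))).aestronglyMeasurable
    (ae_of_all _ fun x r _ => ?_) (hwi'.norm.mul_const K') (ae_of_all _ fun x r _ => ?_)
  · exact this.2
  · rw [norm_mul]
    exact mul_le_mul_of_nonneg_left (hK' _) (norm_nonneg _)
  · have h1 : HasDerivAt (fun r => h (r * x)) (h' (r * x) * x) r := by
      have h2 : HasDerivAt (fun r : ℝ => r * x) x r := by
        simpa using (hasDerivAt_id r).mul_const x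
      exact (hd (r * x)).comp r h2
    exact (h1.const_mul (w x)).congr_deriv (by ring)

theorem continuous_integral_scale {h : ℝ → ℝ} {w : ℝ → ℝ} {K : ℝ} (hh : Continuous h)
    (hK : ∀ s, |h s| ≤ K) (hw : Continuous w) (hwi : Integrable w m) :
    Continuous fun r => ∫ x, w x * h (r * x) ∂m := by
  refine continuous_of_dominated (bound := fun x => ‖w x‖ * K) (fun r => ?_) (fun r => ?_)
    (hwi.norm.mul_const K) (ae_of_all _ fun x => ?_)
  · exact (hw.mul (hh.comp (by fun_prop))).aestronglyMeasurable
  · refine ae_of_all _ fun x => ?_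
    rw [norm_mul]
    exact mul_le_mul_of_nonneg_left (hK _) (norm_nonneg _)
  · exact continuous_const.mul (hh.comp (by fun_prop))

end

/-- Two integrations by parts at once: `exp (-κ s) (h' + κ h)` is a primitive of `exp (-κ s) (h'' -
κ² h)`, and `h' 0 = 0` leaves a single boundary term. -/
theorem integral_exp_mul_deriv_deriv {h h' h'' : ℝ → ℝ} {κ K : ℝ} (hκ : 0 < κ)
    (h1 : ∀ s, HasDerivAt h (h' s) s) (h2 : ∀ s, HasDerivAt h' (h'' s) s) (hc : Continuous h'')
    (hK : ∀ s, |h s| ≤ K) (hK' : ∀ s, |h' s| ≤ K) (hK'' : ∀ s, |h'' s| ≤ K) (h0 : h' 0 = 0) :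
    ∫ s in Ioi (0 : ℝ), Real.exp (-κ * s) * h'' s =
      κ ^ 2 * (∫ s in Ioi (0 : ℝ), Real.exp (-κ * s) * h s) - κ * h 0 := by
  have hhc : Continuous h := continuous_iff_continuousAt.2 fun s => (h1 s).continuousAt
  have i0 := integrableOn_exp_neg_mul_of_bounded hκ hhc.aestronglyMeasurable fun s _ => hK s
  have i2 := integrableOn_exp_neg_mul_of_bounded hκ hc.aestronglyMeasurable fun s _ => hK'' s
  have hd : ∀ s : ℝ, HasDerivAt (fun s => Real.exp (-κ * s) * (h' s + κ * h s))
      (Real.exp (-κ * s) * h'' s - κ ^ 2 * (Real.exp (-κ * s) * h s)) s := fun s => by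
    have e1 : HasDerivAt (fun s : ℝ => Real.exp (-κ * s)) (Real.exp (-κ * s) * -κ) s := by
      have : HasDerivAt (fun s : ℝ => -κ * s) (-κ) s := by
        simpa using (hasDerivAt_id s).const_mul (-κ)
      exact this.exp
    exact (e1.mul ((h2 s).add ((h1 s).const_mul κ))).congr_deriv (by
      simp only [Pi.add_apply]; ring)
  have hexp : Tendsto (fun s : ℝ => Real.exp (-κ * s)) atTop (𝓝 0) := by
    refine Real.tendsto_exp_atBot.comp ?_
    exact tendsto_id.const_mul_atTop_of_neg (by linarith)
  have hlim : Tendsto (fun s => Real.exp (-κ * s) * (h' s + κ * h s)) atTop (𝓝 0) := by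
    refine squeeze_zero_norm (a := fun s => Real.exp (-κ * s) * (K + κ * K)) (fun s => ?_)
      (by simpa using hexp.mul_const (K + κ * K))
    rw [norm_mul, Real.norm_of_nonneg (Real.exp_pos _).le]
    refine mul_le_mul_of_nonneg_left ?_ (Real.exp_pos _).le
    refine (norm_add_le _ _).trans (add_le_add (hK' s) ?_)
    rw [norm_mul, Real.norm_of_nonneg hκ.le]
    exact mul_le_mul_of_nonneg_left (hK s) hκ.le
  have h3 := integral_Ioi_of_hasDerivAt_of_tendsto' (a := 0) (fun s _ => hd s)
    (i2.sub (i0.const_mul (κ ^ 2))) hlim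
  rw [integral_sub i2 (i0.const_mul _), integral_const_mul] at h3
  simp only [mul_zero, Real.exp_zero, h0, one_mul, zero_add, zero_sub] at h3
  linarith

end

/-! ### Existence for the fractional diffusion equation -/

noncomputable section

/-- Regularity in `t` of `H (t ^ ν)` for a `C²` function `H` with `H' (0) = 0`. -/
theorem regular_comp_rpow {ν B : ℝ} (hν : 0 < ν) (hν' : ν ≤ 1) {E H H1 H2 : ℝ → ℝ}
    (hE : ∀ t ≥ 0, E t = H (t ^ ν)) (h1 : ∀ r, HasDerivAt H (H1 r) r)
    (h2 : ∀ r, HasDerivAt H1 (H2 r) r) (hc : Continuous H2) (h0 : H1 0 = 0)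
    (hB : ∀ r, |H2 r| ≤ B) :
    ContinuousOn E (Ici 0) ∧ (∀ k < ⌈2 * ν⌉₊, DifferentiableOn ℝ (iteratedDeriv k E) (Ioi 0)) ∧
    ContinuousOn (iteratedDeriv ⌈2 * ν⌉₊ E) (Ioi 0) ∧
    (∃ C, ∀ t > 0, |iteratedDeriv ⌈2 * ν⌉₊ E t| ≤ C * t ^ (2 * ν - ⌈2 * ν⌉₊)) ∧
    ∃ C, ∀ t > 0, |deriv E t| ≤ C * t ^ (2 * ν - 1) := by
  have hHc : Continuous H := continuous_iff_continuousAt.2 fun r => (h1 r).continuousAt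
  have hH1c : Continuous H1 := continuous_iff_continuousAt.2 fun r => (h2 r).continuousAt
  -- Because `H1 0 = 0`, the factor `H1 (t ^ ν)` is `O(t ^ ν)` and softens the term `t ^ (ν - 2)` of
  -- the second derivative to `t ^ (2ν - 2)`, which is integrable at zero when `ν > 1/2`.
  have hH1b : ∀ r, |H1 r| ≤ B * |r| := fun r => by
    have := Convex.norm_image_sub_le_of_norm_hasDerivWithin_le (f := H1) (f' := H2) (C := B)
      (s := univ) (x := 0) (y := r) (fun x _ => (h2 x).hasDerivWithinAt) (fun x _ => hB x)
      convex_univ trivial trivial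
    simpa [h0] using this
  have hB0 : 0 ≤ B := (abs_nonneg _).trans (hB 0)
  have hpow : ∀ t > (0 : ℝ), HasDerivAt (fun t : ℝ => t ^ ν) (ν * t ^ (ν - 1)) t := fun t ht =>
    Real.hasDerivAt_rpow_const (Or.inl ht.ne')
  have hcomp1 : ∀ t > (0 : ℝ), HasDerivAt (fun t : ℝ => H (t ^ ν))
      (H1 (t ^ ν) * (ν * t ^ (ν - 1))) t := fun t ht => (h1 (t ^ ν)).comp t (hpow t ht)
  have hcomp2 : ∀ t > (0 : ℝ), HasDerivAt (fun t : ℝ => H1 (t ^ ν))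
      (H2 (t ^ ν) * (ν * t ^ (ν - 1))) t := fun t ht => (h2 (t ^ ν)).comp t (hpow t ht)
  have hd1 : ∀ t > 0, HasDerivAt E (H1 (t ^ ν) * (ν * t ^ (ν - 1))) t := fun t ht =>
    (hcomp1 t ht).congr_of_eventuallyEq (by
      filter_upwards [Ioi_mem_nhds ht] with s hs using hE s (le_of_lt hs))
  have hpow2 : ∀ t > (0 : ℝ), HasDerivAt (fun t : ℝ => ν * t ^ (ν - 1))
      (ν * ((ν - 1) * t ^ (ν - 1 - 1))) t := fun t ht =>
    (Real.hasDerivAt_rpow_const (Or.inl ht.ne')).const_mul ν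
  have hd2 : ∀ t > 0, HasDerivAt (deriv E) (H2 (t ^ ν) * (ν * t ^ (ν - 1)) * (ν * t ^ (ν - 1)) +
      H1 (t ^ ν) * (ν * ((ν - 1) * t ^ (ν - 1 - 1)))) t := fun t ht =>
    ((hcomp2 t ht).mul (hpow2 t ht)).congr_of_eventuallyEq (by
      filter_upwards [Ioi_mem_nhds ht] with s hs using (hd1 s hs).deriv)
  have hrc : ∀ a : ℝ, ContinuousOn (fun t : ℝ => t ^ a) (Ioi 0) := fun a =>
    ContinuousOn.rpow_const continuousOn_id fun t ht => Or.inl (ne_of_gt ht)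
  have hb1 : ∀ t > 0, |H1 (t ^ ν)| ≤ B * t ^ ν := fun t ht => by
    simpa only [abs_of_pos (Real.rpow_pos_of_pos ht ν)] using hH1b (t ^ ν)
  have hbound1 : ∀ t > 0, |deriv E t| ≤ B * ν * t ^ (2 * ν - 1) := fun t ht => by
    have hp : 0 < t ^ (ν - 1) := Real.rpow_pos_of_pos ht _
    rw [(hd1 t ht).deriv, abs_mul, abs_of_pos (mul_pos hν hp),
      show 2 * ν - 1 = ν + (ν - 1) by ring, Real.rpow_add ht]
    calc |H1 (t ^ ν)| * (ν * t ^ (ν - 1)) ≤ B * t ^ ν * (ν * t ^ (ν - 1)) :=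
          mul_le_mul_of_nonneg_right (hb1 t ht) (mul_pos hν hp).le
      _ = _ := by ring
  have hEc : ContinuousOn E (Ici 0) :=
    (hHc.comp_continuousOn (Continuous.continuousOn (Real.continuous_rpow_const hν.le))).congr
      fun t ht => hE t ht
  refine ⟨hEc, ?_⟩
  rcases le_or_gt (2 * ν) 1 with h | h
  · have hn : ⌈2 * ν⌉₊ = 1 := by
      rw [Nat.ceil_eq_iff one_ne_zero]; simpa using ⟨hν, h⟩
    rw [hn, iteratedDeriv_one]
    refine ⟨fun k hk => ?_, ?_, ⟨B * ν, by simpa using hbound1⟩, B * ν, hbound1⟩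
    · rw [Nat.lt_one_iff.1 hk, iteratedDeriv_zero]
      exact fun t ht => (hd1 t ht).differentiableAt.differentiableWithinAt
    · exact fun t ht => (hd2 t ht).continuousAt.continuousWithinAt
  · have hn : ⌈2 * ν⌉₊ = 2 := by
      rw [Nat.ceil_eq_iff two_ne_zero]; simpa using ⟨h, hν'⟩
    have h2E : iteratedDeriv 2 E = deriv (deriv E) := by
      rw [iteratedDeriv_succ, iteratedDeriv_one]
    rw [hn, h2E]
    refine ⟨fun k hk => ?_, ?_, ⟨B * ν ^ 2 + B * ν * (1 - ν), fun t ht => ?_⟩, B * ν, hbound1⟩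
    · interval_cases k
      · rw [iteratedDeriv_zero]
        exact fun t ht => (hd1 t ht).differentiableAt.differentiableWithinAt
      · rw [iteratedDeriv_one]
        exact fun t ht => (hd2 t ht).differentiableAt.differentiableWithinAt
    · refine ContinuousOn.congr ?_ fun t ht => (hd2 t ht).deriv
      have e1 := hc.comp_continuousOn (hrc ν)
      have e2 := hH1c.comp_continuousOn (hrc ν)
      exact ((e1.mul (continuousOn_const.mul (hrc _))).mul (continuousOn_const.mul (hrc _))).add
        (e2.mul (continuousOn_const.mul (continuousOn_const.mul (hrc _))))
    · have hp : 0 < t ^ (ν - 1) := Real.rpow_pos_of_pos ht _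
      have hp2 : 0 < t ^ (ν - 1 - 1) := Real.rpow_pos_of_pos ht _
      have hp0 : 0 < t ^ ν := Real.rpow_pos_of_pos ht _
      have q1 : t ^ (2 * ν - (2 : ℕ)) = t ^ (ν - 1) * t ^ (ν - 1) := by
        rw [← Real.rpow_add ht]; congr 1; push_cast; ring
      have q2 : t ^ (2 * ν - (2 : ℕ)) = t ^ ν * t ^ (ν - 1 - 1) := by
        rw [← Real.rpow_add ht]; congr 1; push_cast; ring
      rw [(hd2 t ht).deriv]
      refine (abs_add_le _ _).trans ?_
      rw [add_mul]
      refine add_le_add ?_ ?_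
      · rw [abs_mul, abs_mul, abs_of_pos (mul_pos hν hp), q1]
        have := mul_le_mul_of_nonneg_right (hB (t ^ ν))
          (mul_pos (mul_pos hν hp) (mul_pos hν hp)).le
        nlinarith
      · rw [abs_mul, abs_mul, abs_mul, abs_of_pos hν, abs_of_pos hp2,
          abs_of_nonpos (show ν - 1 ≤ 0 by linarith), q2]
        have h3 : 0 ≤ ν * (-(ν - 1) * t ^ (ν - 1 - 1)) :=
          mul_nonneg hν.le (mul_nonneg (by linarith) hp2.le)
        have := mul_le_mul_of_nonneg_right (hb1 t ht) h3
        nlinarith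

/-- Existence for the Cauchy problem of the fractional diffusion equation. -/
theorem isFractionalDiffusion_diffusionLaw {ν : ℝ} (hν : 0 < ν) (hν' : ν ≤ 1) {m : Measure ℝ}
    (hm : IsMittagLefflerLaw ν m) : IsFractionalDiffusion ν (diffusionLaw ν m) := by
  have hmp := hm.isProbabilityMeasure
  have hprob : ∀ t, IsProbabilityMeasure (diffusionLaw ν m t) := isProbabilityMeasure_diffusionLaw
  have hbd : ∀ f : ℝ → ℝ, Continuous f → HasCompactSupport f → ∃ K, ∀ s, |f s| ≤ K :=
    fun f hf hfc => hfc.exists_bound_of_continuous hf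
  have main : ∀ φ : ℝ → ℝ, ContDiff ℝ (⊤ : ℕ∞) φ → HasCompactSupport φ →
      CaputoDifferentiable (2 * ν) (fun t => ∫ s, φ s ∂(diffusionLaw ν m t.toNNReal)) ∧
      (1 / 2 < ν → Tendsto (deriv (fun t : ℝ => ∫ s, φ s ∂(diffusionLaw ν m t.toNNReal)))
        (𝓝[>] 0) (𝓝 0)) ∧
      ∀ t > 0, caputoDeriv (2 * ν) (fun t => ∫ s, φ s ∂(diffusionLaw ν m t.toNNReal)) t =
        ∫ s, iteratedDeriv 2 φ s ∂(diffusionLaw ν m t.toNNReal) := by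
    intro φ hφ hφc
    set ψ := evenPart φ with hψdef
    have hψ : ContDiff ℝ (⊤ : ℕ∞) ψ := contDiff_evenPart hφ
    have hψc : HasCompactSupport ψ := hasCompactSupport_evenPart hφc
    have hψ1 := contDiff_infty_iff_deriv.1 hψ
    have hψ2 := contDiff_infty_iff_deriv.1 hψ1.2
    obtain ⟨K0, hK0⟩ := hbd ψ hψ.continuous hψc
    obtain ⟨K1, hK1⟩ := hbd (deriv ψ) hψ1.2.continuous hψc.deriv
    obtain ⟨K2, hK2⟩ := hbd (deriv (deriv ψ)) hψ2.2.continuous hψc.deriv.deriv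
    obtain ⟨Kφ, hKφ⟩ := hbd φ hφ.continuous hφc
    obtain ⟨Kφ2, hKφ2⟩ := hbd (iteratedDeriv 2 φ) hφ.iteratedDeriv_two.continuous
      hφc.iteratedDeriv_two
    have hdψ : ∀ s, HasDerivAt ψ (deriv ψ s) s := fun s => (hψ1.1 s).hasDerivAt
    have hdψ1 : ∀ s, HasDerivAt (deriv ψ) (deriv (deriv ψ) s) s := fun s => (hψ2.1 s).hasDerivAt
    have i1 : Integrable (fun x => (1 : ℝ) * x) m := by simpa using hm.integrable_id
    have i2 : Integrable (fun x : ℝ => (1 : ℝ) * x * x) m := by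
      simpa [pow_two] using hm.integrable_sq
    have hE : ∀ t ≥ 0, ∫ s, φ s ∂(diffusionLaw ν m t.toNNReal) =
        (fun r => ∫ x, 1 * ψ (r * x) ∂m) (t ^ ν) := fun t ht => by
      rw [integral_diffusionLaw hφ.continuous hKφ, Real.coe_toNNReal t ht]
      simp only [one_mul, hψdef]
    -- Each derivative in the scale multiplies the weight by `x`: the weights are `1`, `x`, `x²`,
    -- integrable by `i1` and `i2`.
    have hH1 := hasDerivAt_integral_scale hdψ hψ1.2.continuous hK0 hK1 continuous_const
      (integrable_const _) i1
    have hH2 := hasDerivAt_integral_scale hdψ1 hψ2.2.continuous hK1 hK2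
      (by fun_prop : Continuous fun x : ℝ => (1 : ℝ) * x) i1 i2
    have hH2c := continuous_integral_scale hψ2.2.continuous hK2
      (by fun_prop : Continuous fun x : ℝ => (1 : ℝ) * x * x) i2
    have hψ10 : deriv ψ 0 = 0 := deriv_evenPart_zero hφ
    obtain ⟨r1, r2, r3, ⟨C, r4⟩, C', r5⟩ := regular_comp_rpow hν hν' hE hH1 hH2 hH2c
      (by simp [hψ10]) (B := ∫ x, ‖1 * x * x‖ * K2 ∂m) (fun r => by
        refine (Real.norm_eq_abs _).symm.le.trans (norm_integral_le_of_norm_le (i2.norm.mul_const K2) (ae_of_all _ fun x => ?_))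
        rw [norm_mul]
        exact mul_le_mul_of_nonneg_left (hK2 _) (norm_nonneg _))
    obtain ⟨c1, c2, K, c3⟩ := CaputoDifferentiable.of_bound (by linarith) r1 r2 r3 r4
    set E : ℝ → ℝ := fun t => ∫ s, φ s ∂(diffusionLaw ν m t.toNNReal) with hEdef
    have hlim : 1 / 2 < ν → Tendsto (deriv E) (𝓝[>] 0) (𝓝 0) := fun h => by
      have h1 : Tendsto (fun t : ℝ => C' * t ^ (2 * ν - 1)) (𝓝[>] 0) (𝓝 0) := by
        have h2 : Continuous fun t : ℝ => C' * t ^ (2 * ν - 1) :=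
          continuous_const.mul (Real.continuous_rpow_const (by linarith))
        have h3 := (h2.tendsto 0).mono_left (nhdsWithin_le_nhds (s := Ioi 0))
        rwa [Real.zero_rpow (by linarith), mul_zero] at h3
      refine squeeze_zero_norm' ?_ h1
      filter_upwards [self_mem_nhdsWithin] with t ht using r5 t ht
    refine ⟨c1, hlim, ?_⟩
    have hE0 : E 0 = ψ 0 := by
      rw [hEdef]
      simp [diffusionLaw_zero hν, hψdef, evenPart]
    have hE2 : ∀ t ≥ 0, ∫ s, iteratedDeriv 2 φ s ∂(diffusionLaw ν m t.toNNReal) =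
        ∫ x, deriv (deriv ψ) (t ^ ν * x) ∂m := fun t ht => by
      rw [integral_diffusionLaw hφ.iteratedDeriv_two.continuous hKφ2, Real.coe_toNNReal t ht,
        ← iteratedDeriv_two_evenPart hφ, iteratedDeriv_succ, iteratedDeriv_one]
    have hE2c : ContinuousOn (fun t : ℝ => ∫ s, iteratedDeriv 2 φ s ∂(diffusionLaw ν m t.toNNReal))
        (Ioi 0) := by
      have h1 := continuous_integral_scale (m := m) (w := fun _ => 1) hψ2.2.continuous hK2
        continuous_const (integrable_const _)
      refine ContinuousOn.congr (h1.comp_continuousOn (Continuous.continuousOn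
        (Real.continuous_rpow_const hν.le))) fun t ht => ?_
      rw [hE2 t (le_of_lt ht)]
      simp
    have hcm := c2.aestronglyMeasurable (μ := volume) measurableSet_Ioi
    -- Both sides of the equation are bounded and continuous on `(0, ∞)`, so it is enough to compare
    -- Laplace transforms. With `κ = z ^ ν`, `l2` and `l3` express the left one, `l4` and `l5` the
    -- right one, through the transform of `ψ` at `κ` and `ψ 0`.
    refine eq_of_laplace_eq (C := max K Kφ2) c2 hE2c (fun t ht => (c3 t ht).trans (le_max_left _ _))
      (fun t ht => (abs_integral_le_of_bounded hKφ2).trans (le_max_right _ _)) fun z hz => ?_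
    have hz0 := hz
    have hκ : 0 < z ^ ν := Real.rpow_pos_of_pos hz ν
    have hEm : AEStronglyMeasurable E (volume.restrict (Ioi 0)) :=
      (r1.mono Ioi_subset_Ici_self).aestronglyMeasurable measurableSet_Ioi
    have hEi := integrableOn_exp_neg_mul_of_bounded hz hEm
      fun t _ => (abs_integral_le_of_bounded hKφ : |E t| ≤ Kφ)
    have l1 := laplace_fracInt (a := 2 * ν) (by linarith) hz hcm c3
    have l2 : ∫ t in Ioi (0 : ℝ), Real.exp (-z * t) * fracInt (2 * ν) (caputoDeriv (2 * ν) E) t =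
        (∫ t in Ioi (0 : ℝ), Real.exp (-z * t) * E t) - 1 / z * ψ 0 := by
      rw [← integral_exp_neg_mul_Ioi hz, ← integral_mul_const, ← integral_sub hEi
        ((integrableOn_exp_neg_mul hz).mul_const _)]
      refine setIntegral_congr_fun measurableSet_Ioi fun t ht => ?_
      have := c1.eq_add_fracInt (by linarith) (by linarith) (fun h => hlim (by linarith)) ht
      rw [hE0] at this
      simp only [this]
      ring
    have l3 : ∫ t in Ioi (0 : ℝ), Real.exp (-z * t) * E t =
        z ^ (ν - 1) * ∫ s in Ioi (0 : ℝ), Real.exp (-(z ^ ν) * s) * ψ s := by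
      rw [← integral_const_mul]
      refine Eq.trans (setIntegral_congr_fun measurableSet_Ioi fun t ht => ?_)
        ((hm.laplace hz hψ.continuous.measurable hK0).trans
          (setIntegral_congr_fun measurableSet_Ioi fun s hs => ?_))
      · have := hE t (le_of_lt ht)
        simp only [one_mul] at this
        simp only [hEdef, this]
      · rw [mul_assoc, show -s * z ^ ν = -(z ^ ν) * s by ring]
    have l4 : ∫ t in Ioi (0 : ℝ), Real.exp (-z * t) *
        ∫ s, iteratedDeriv 2 φ s ∂(diffusionLaw ν m t.toNNReal) =
        z ^ (ν - 1) * ∫ s in Ioi (0 : ℝ), Real.exp (-(z ^ ν) * s) * deriv (deriv ψ) s := by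
      rw [← integral_const_mul]
      refine Eq.trans (setIntegral_congr_fun measurableSet_Ioi fun t ht => ?_)
        ((hm.laplace hz hψ2.2.continuous.measurable hK2).trans
          (setIntegral_congr_fun measurableSet_Ioi fun s hs => ?_))
      · simp only [hE2 t (le_of_lt ht)]
      · rw [mul_assoc, show -s * z ^ ν = -(z ^ ν) * s by ring]
    have l5 := integral_exp_mul_deriv_deriv (K := max K0 (max K1 K2)) hκ hdψ hdψ1 hψ2.2.continuous
      (fun s => (hK0 s).trans (le_max_left _ _))
      (fun s => (hK1 s).trans ((le_max_left _ _).trans (le_max_right _ _)))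
      (fun s => (hK2 s).trans ((le_max_right _ _).trans (le_max_right _ _))) hψ10
    rw [l4, l5]
    have l6 := l1.2
    rw [l2, l3, Real.rpow_neg hz.le] at l6
    have p1 : z ^ (2 * ν) = z ^ ν * z ^ ν := by rw [← Real.rpow_add hz]; congr 1; ring
    have p2 : z ^ (ν - 1) = z ^ ν / z := Real.rpow_sub_one hz.ne' ν
    rw [p1, p2] at l6
    rw [p2]
    field_simp at l6 ⊢
    linear_combination -l6
  exact ⟨hprob, diffusionLaw_zero hν, fun φ h1 h2 => (main φ h1 h2).1,
    fun h φ h1 h2 => (main φ h1 h2).2.1 h, fun φ h1 h2 => (main φ h1 h2).2.2⟩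

end

/-! ### Laplace transforms of the death probabilities -/

noncomputable section

namespace SolvesLinearDeathSystem

variable {ν μ : ℝ} {n₀ : ℕ} {p q : ℕ → ℝ → ℝ} {m : Measure ℝ}

theorem continuousOn (hp : SolvesLinearDeathSystem ν μ n₀ p) (k : ℕ) :
    ContinuousOn (p k) (Ici 0) := by
  rcases le_or_gt k n₀ with h | h
  · exact (hp.regular k h).continuousOn
  · exact continuousOn_const.congr fun t ht => hp.zero_above k h t ht

/-- Transforming the Volterra form of the system makes it algebraic and triangular: index `k` is
determined by index `k + 1`. -/
theorem laplace (hν : 0 < ν) (hν' : ν ≤ 1) (hp : SolvesLinearDeathSystem ν μ n₀ p)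
    (hC : ∀ k, ∀ t ≥ 0, |p k t| ≤ 1) {k : ℕ} (hk : k ≤ n₀) {z : ℝ} (hz : 0 < z) :
    (z ^ ν + μ * k) * ∫ t in Ioi (0 : ℝ), Real.exp (-z * t) * p k t =
      z ^ (ν - 1) * (if k = n₀ then 1 else 0) +
        μ * (k + 1) * ∫ t in Ioi (0 : ℝ), Real.exp (-z * t) * p (k + 1) t := by
  have hm : ∀ j, AEStronglyMeasurable (p j) (volume.restrict (Ioi 0)) := fun j =>
    ((hp.continuousOn j).mono Ioi_subset_Ici_self).aestronglyMeasurable measurableSet_Ioi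
  have hi : ∀ j, IntegrableOn (fun t => Real.exp (-z * t) * p j t) (Ioi 0) := fun j =>
    integrableOn_exp_neg_mul_of_bounded hz (hm j) fun t ht => hC j t (le_of_lt ht)
  set ψ : ℝ → ℝ := fun t => μ * ((k : ℝ) + 1) * p (k + 1) t - μ * (k : ℝ) * p k t with hψ
  have hψm : AEStronglyMeasurable ψ (volume.restrict (Ioi 0)) :=
    ((hm (k + 1)).const_mul _).sub ((hm k).const_mul _)
  have l1 := (laplace_fracInt (C := |μ * ((k : ℝ) + 1)| + |μ * (k : ℝ)|) hν hz hψm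
    fun t ht => by
        refine (abs_sub _ _).trans (add_le_add ?_ ?_) <;> rw [abs_mul] <;>
        exact mul_le_of_le_one_right (abs_nonneg _) (hC _ t (le_of_lt ht))).2
  have l2 : ∫ t in Ioi (0 : ℝ), Real.exp (-z * t) * fracInt ν ψ t =
      (∫ t in Ioi (0 : ℝ), Real.exp (-z * t) * p k t) - 1 / z * (if k = n₀ then 1 else 0) := by
    rw [← integral_exp_neg_mul_Ioi hz, ← integral_mul_const, ← integral_sub (hi k)
      ((integrableOn_exp_neg_mul hz).mul_const _)]
    refine setIntegral_congr_fun measurableSet_Ioi fun t ht => ?_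
    have h := (hp.regular k hk).eq_add_fracInt hν (by linarith)
      (fun h => absurd h (not_lt.2 hν')) ht
    rw [fracInt_congr (le_of_lt ht) (fun s hs => hp.equation k hk s hs.1),
      hp.initial k hk] at h
    simp only [h, hψ]
    ring
  have l3 : ∫ t in Ioi (0 : ℝ), Real.exp (-z * t) * ψ t =
      μ * ((k : ℝ) + 1) * (∫ t in Ioi (0 : ℝ), Real.exp (-z * t) * p (k + 1) t) -
        μ * (k : ℝ) * ∫ t in Ioi (0 : ℝ), Real.exp (-z * t) * p k t := by
    rw [← integral_const_mul, ← integral_const_mul, ← integral_sub ((hi _).const_mul _)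
      ((hi _).const_mul _)]
    refine integral_congr_ae (ae_of_all _ fun t => ?_)
    simp only [hψ]
    ring
  rw [l2, l3, Real.rpow_neg hz.le] at l1
  have hκ : 0 < z ^ ν := Real.rpow_pos_of_pos hz ν
  rw [Real.rpow_sub_one hz.ne']
  field_simp at l1 ⊢
  linear_combination l1

/-- The Laplace transforms of the state probabilities of order `ν` at `z` are those of order `1`
at `z ^ ν`. -/
theorem laplace_eq (hν : 0 < ν) (hν' : ν ≤ 1) (hμ : 0 < μ)
    (hp : SolvesLinearDeathSystem ν μ n₀ p) (hC : ∀ k, ∀ t ≥ 0, |p k t| ≤ 1)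
    (hq : SolvesLinearDeathSystem 1 μ n₀ q) (hD : ∀ k, ∀ t ≥ 0, |q k t| ≤ 1) (k : ℕ)
    {z : ℝ} (hz : 0 < z) :
    ∫ t in Ioi (0 : ℝ), Real.exp (-z * t) * p k t =
      z ^ (ν - 1) * ∫ t in Ioi (0 : ℝ), Real.exp (-(z ^ ν) * t) * q k t := by
  have hκ : 0 < z ^ ν := Real.rpow_pos_of_pos hz ν
  have above : ∀ k > n₀, ∫ t in Ioi (0 : ℝ), Real.exp (-z * t) * p k t =
      z ^ (ν - 1) * ∫ t in Ioi (0 : ℝ), Real.exp (-(z ^ ν) * t) * q k t := fun k hk => by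
    rw [setIntegral_congr_fun (g := fun _ => 0) measurableSet_Ioi (fun t ht => by
        simp [hp.zero_above k hk t (le_of_lt ht)]),
      setIntegral_congr_fun (f := fun t => Real.exp (-(z ^ ν) * t) * q k t) (g := fun _ => 0)
        measurableSet_Ioi (fun t ht => by simp [hq.zero_above k hk t (le_of_lt ht)])]
    simp
  rcases lt_or_ge n₀ k with hk | hk
  · exact above k hk
  have hk' : k ≤ n₀ + 1 := Nat.le_succ_of_le hk
  clear hk
  -- Descend from `n₀ + 1`, where both transforms vanish. The order-one recursion taken at `z ^ ν`
  -- has the same coefficients as the fractional one, up to the factor `z ^ (ν - 1)` in the source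
  -- term.
  induction hk' using Nat.decreasingInduction with
  | self => exact above _ (Nat.lt_succ_self n₀)
  | of_succ k h ih =>
    have hk : k ≤ n₀ := Nat.lt_succ_iff.1 h
    have l1 := hp.laplace hν hν' hC hk hz
    have l2 := hq.laplace one_pos le_rfl hD hk hκ
    simp only [Real.rpow_one, sub_self, Real.rpow_zero] at l2
    rw [ih] at l1
    have hpos : z ^ ν + μ * k ≠ 0 := by positivity
    refine mul_left_cancel₀ hpos ?_
    linear_combination l1 - z ^ (ν - 1) * l2

/-- Subordination of the state probabilities. -/
theorem eq_integral (hν : 0 < ν) (hν' : ν ≤ 1) (hμ : 0 < μ) (hm : IsMittagLefflerLaw ν m)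
    (hp : SolvesLinearDeathSystem ν μ n₀ p) (hC : ∀ k, ∀ t ≥ 0, |p k t| ≤ 1)
    (hq : SolvesLinearDeathSystem 1 μ n₀ q) (hD : ∀ k, ∀ t ≥ 0, |q k t| ≤ 1) (k : ℕ)
    {t : ℝ} (ht : 0 < t) : p k t = ∫ x, q k (max (t ^ ν * x) 0) ∂m := by
  have := hm.isProbabilityMeasure
  -- Nothing is known about `q` at negative times; `max s 0` extends it continuously.
  have hc : Continuous fun s : ℝ => q k (max s 0) :=
    (hq.continuousOn k).comp_continuous (by fun_prop) fun s => le_max_right s 0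
  have hb : ∀ s : ℝ, |q k (max s 0)| ≤ 1 := fun s => hD k _ (le_max_right s 0)
  refine eq_of_laplace_eq (C := 1) (G := fun t => ∫ x, q k (max (t ^ ν * x) 0) ∂m)
    ((hp.continuousOn k).mono Ioi_subset_Ici_self) ?_ (fun t ht => hC k t (le_of_lt ht))
    (fun t _ => abs_integral_le_of_bounded fun s => hb _) (fun z hz => ?_) t ht
  · have h1 := continuous_integral_scale (m := m) (w := fun _ => 1) hc hb
      continuous_const (integrable_const _)
    refine ContinuousOn.congr (h1.comp_continuousOn (Continuous.continuousOn
      (Real.continuous_rpow_const hν.le))) fun t _ => ?_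
    simp
  · rw [hp.laplace_eq hν hν' hμ hC hq hD k hz, hm.laplace hz hc.measurable hb,
      ← integral_const_mul]
    refine setIntegral_congr_fun measurableSet_Ioi fun s hs => ?_
    have hs' : 0 ≤ s := le_of_lt (mem_Ioi.1 hs)
    simp only [max_eq_left hs', neg_mul]
    rw [mul_assoc, mul_comm s]

end SolvesLinearDeathSystem

/-! ### Evaluation of a right-continuous process at an independent time -/

section Evaluation

variable {Ω : Type*} [MeasurableSpace Ω] {P : Measure Ω}

theorem measurable_eval_nat {Y : ℕ → Ω → ℕ} (hY : ∀ j, Measurable (Y j)) {J : Ω → ℕ}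
    (hJ : Measurable J) : Measurable fun ω => Y (J ω) ω :=
  (measurable_from_prod_countable_right (f := fun x : ℕ × Ω => Y x.1 x.2) hY).comp
    (hJ.prodMk measurable_id)

/-- Split according to the countably many values of `J` and use independence on each piece. -/
theorem measure_eval_nat {Y : ℕ → Ω → ℕ} (hY : ∀ j, Measurable (Y j)) {J : Ω → ℕ}
    (hJ : Measurable J) (hind : IndepFun (fun ω j => Y j ω) J P) (k : ℕ) :
    P {ω | Y (J ω) ω = k} = ∫⁻ ω, P {ω' | Y (J ω) ω' = k} ∂P := by
  have h1 : {ω | Y (J ω) ω = k} = ⋃ j, {ω | Y j ω = k} ∩ {ω | J ω = j} := by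
    ext ω
    simp
  have hmeas : ∀ j, MeasurableSet ({ω | Y j ω = k} ∩ {ω | J ω = j}) := fun j =>
    (hY j (measurableSet_singleton k)).inter (hJ (measurableSet_singleton j))
  rw [h1, measure_iUnion (fun i j hij => Set.disjoint_left.2 fun ω hi hj =>
    hij (hi.2.symm.trans hj.2)) hmeas,
    ← lintegral_map (f := fun j => P {ω' | Y j ω' = k}) measurable_from_nat hJ, lintegral_countable']
  refine tsum_congr fun j => ?_
  rw [Measure.map_apply hJ (measurableSet_singleton j)]
  exact hind.measure_inter_preimage_eq_mul (s := {y : ℕ → ℕ | y j = k})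
    (t := {j}) ((measurable_pi_apply j : Measurable fun y : ℕ → ℕ => y j)
      (measurableSet_singleton k)) (measurableSet_singleton j)

/-- The grid of mesh `1 / (n + 1)` in the positive times. -/
def gridTime (n j : ℕ) : ℝ≥0 := (j + 1) / (n + 1)

/-- The `j + 1` in the numerator of `gridTime` makes the approximation come from above, as
right-continuity of the paths demands. -/
theorem lt_gridTime (n : ℕ) (x : ℝ≥0) : x < gridTime n ⌊(n + 1) * x⌋₊ := by
  rw [gridTime, lt_div_iff₀ (by positivity), mul_comm]
  exact Nat.lt_floor_add_one _

theorem gridTime_le (n : ℕ) (x : ℝ≥0) : gridTime n ⌊(n + 1) * x⌋₊ ≤ x + 1 / (n + 1) := by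
  have h : (0 : ℝ≥0) < n + 1 := by positivity
  rw [gridTime, add_div]
  gcongr
  rw [div_le_iff₀ h, mul_comm]
  exact Nat.floor_le zero_le

theorem tendsto_gridTime (x : ℝ≥0) :
    Tendsto (fun n : ℕ => gridTime n ⌊(n + 1) * x⌋₊) atTop (𝓝[≥] x) := by
  refine tendsto_nhdsWithin_iff.2 ⟨?_, Eventually.of_forall fun n => (lt_gridTime n x).le⟩
  refine tendsto_of_tendsto_of_tendsto_of_le_of_le tendsto_const_nhds
    (h := fun n : ℕ => x + 1 / (n + 1)) ?_ (fun n => (lt_gridTime n x).le) (gridTime_le · x)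
  have h : Tendsto (fun n : ℕ => 1 / ((n : ℝ≥0) + 1)) atTop (𝓝 0) :=
    tendsto_one_div_add_atTop_nhds_zero_nat
  simpa using tendsto_const_nhds.add h

variable {X : ℝ≥0 → Ω → ℕ} {T : Ω → ℝ≥0}

theorem measurable_eval_gridTime (hX : ∀ t, Measurable (X t)) (hT : Measurable T) (n : ℕ) :
    Measurable fun ω => X (gridTime n ⌊(n + 1) * T ω⌋₊) ω :=
  measurable_eval_nat (fun j => hX (gridTime n j)) (J := fun ω => ⌊(n + 1) * T ω⌋₊)
    (Nat.measurable_floor.comp (hT.const_mul _))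

theorem ae_tendsto_eval_gridTime
    (hr : ∀ᵐ ω ∂P, ∀ t, ContinuousWithinAt (fun s => X s ω) (Ici t) t) :
    ∀ᵐ ω ∂P, Tendsto (fun n : ℕ => X (gridTime n ⌊(n + 1) * T ω⌋₊) ω) atTop
      (𝓝 (X (T ω) ω)) :=
  hr.mono fun ω h => (h (T ω)).tendsto.comp (tendsto_gridTime (T ω))

theorem aemeasurable_eval (hX : ∀ t, Measurable (X t))
    (hr : ∀ᵐ ω ∂P, ∀ t, ContinuousWithinAt (fun s => X s ω) (Ici t) t) (hT : Measurable T) :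
    AEMeasurable (fun ω => X (T ω) ω) P :=
  aemeasurable_of_tendsto_metrizable_ae atTop
    (fun n => (measurable_eval_gridTime hX hT n).aemeasurable) (ae_tendsto_eval_gridTime hr)

/-- The law of a right-continuous integer-valued process at an independent random time. -/
theorem measure_eval [IsProbabilityMeasure P] (hX : ∀ t, Measurable (X t))
    (hr : ∀ᵐ ω ∂P, ∀ t, ContinuousWithinAt (fun s => X s ω) (Ici t) t) (hT : Measurable T)
    (hind : IndepFun (fun ω s => X s ω) T P) {k : ℕ}
    (hc : Continuous fun t => P {ω | X t ω = k}) :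
    P {ω | X (T ω) ω = k} = ∫⁻ ω, P {ω' | X (T ω) ω' = k} ∂P := by
  have h1 : ∀ n : ℕ, P {ω | X (gridTime n ⌊(n + 1) * T ω⌋₊) ω = k} =
      ∫⁻ ω, P {ω' | X (gridTime n ⌊(n + 1) * T ω⌋₊) ω' = k} ∂P := fun n => by
    have hf : Measurable fun t : ℝ≥0 => ⌊(n + 1) * t⌋₊ :=
      Nat.measurable_floor.comp (measurable_id.const_mul _)
    have hφ : Measurable fun (y : ℝ≥0 → ℕ) (j : ℕ) => y (gridTime n j) :=
      measurable_pi_lambda _ fun j => measurable_pi_apply _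
    exact measure_eval_nat (fun j => hX (gridTime n j)) (hf.comp hT) (hind.comp hφ hf) k
  have h2 : Tendsto (fun n : ℕ => ∫⁻ ω, P {ω' | X (gridTime n ⌊(n + 1) * T ω⌋₊) ω' = k} ∂P)
      atTop (𝓝 (∫⁻ ω, P {ω' | X (T ω) ω' = k} ∂P)) := by
    refine tendsto_lintegral_of_dominated_convergence (fun _ => 1) (fun n => ?_)
      (fun n => ae_of_all _ fun ω => prob_le_one) (by simp) (ae_of_all _ fun ω => ?_)
    · have hf : Measurable fun t : ℝ≥0 => gridTime n ⌊(n + 1) * t⌋₊ :=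
        (measurable_from_nat (f := gridTime n)).comp
          (Nat.measurable_floor.comp (measurable_id.const_mul _))
      exact hc.measurable.comp (hf.comp hT)
    · exact (hc.tendsto _).comp ((tendsto_gridTime (T ω)).mono_right nhdsWithin_le_nhds)
  refine tendsto_nhds_unique ?_ (h2.congr fun n => (h1 n).symm)
  -- Right-continuity holds only almost surely, so the evaluated process is only almost everywhere
  -- measurable.
  have h3 : NullMeasurableSet {ω | X (T ω) ω = k} P :=
    (aemeasurable_eval hX hr hT).nullMeasurableSet_preimage (measurableSet_singleton k)
  have h4 : ∀ n : ℕ, MeasurableSet {ω | X (gridTime n ⌊(n + 1) * T ω⌋₊) ω = k} := fun n =>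
    measurable_eval_gridTime hX hT n (measurableSet_singleton k)
  simp only [← lintegral_indicator_one (h4 _)]
  rw [← lintegral_indicator_one₀ h3]
  refine tendsto_lintegral_of_dominated_convergence (fun _ => 1)
    (fun n => measurable_one.indicator (h4 n))
    (fun n => ae_of_all _ (indicator_le_self' (fun _ _ => zero_le))) (by simp) ?_
  filter_upwards [ae_tendsto_eval_gridTime (T := T) hr] with ω hω
  -- In `ℕ` convergence is eventual equality, so the indicators converge as well.
  rw [nhds_discrete, tendsto_pure] at hω
  refine tendsto_const_nhds.congr' (hω.mono fun n hn => ?_)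
  by_cases hk : X (T ω) ω = k <;> simp [indicator, hn, hk]

end Evaluation

/-! ### Subordination and the main theorem -/

theorem IsLinearDeathProcess.exists_solves {Ω : Type*} [MeasurableSpace Ω] {P : Measure Ω}
    [IsProbabilityMeasure P] {μ : ℝ} {n₀ : ℕ} {M : ℝ≥0 → Ω → ℕ}
    (hM : IsLinearDeathProcess μ n₀ M P) :
    ∃ q, SolvesLinearDeathSystem 1 μ n₀ q ∧ ∀ k (t : ℝ≥0), P.real {ω | M t ω = k} = q k t := by
  obtain ⟨p, hp, h⟩ := hM.markov
  refine ⟨p n₀, hp n₀, fun k t => ?_⟩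
  -- The one-time case of the Markov formula has an empty product and gives the initial state; the
  -- case of the times `0` and `t` then gives the state probabilities.
  have h0 : P.real {ω | M 0 ω = n₀} = 1 := by
    simpa using h 0 (fun _ => 0) (fun _ => n₀) monotone_const rfl
  have h1 := h 1 ![0, t] ![n₀, k] (by
    intro i j hij
    fin_cases i <;> fin_cases j <;> simp_all) rfl
  simp [Fin.forall_fin_two] at h1
  rw [← h1]
  have h0' : ∀ᵐ ω ∂P, M 0 ω = n₀ := by
    refine (mem_ae_iff_prob_eq_one (hM.measurable 0 (measurableSet_singleton n₀))).2 ?_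
    exact (ENNReal.toReal_eq_one_iff _).1 h0
  refine measureReal_congr (h0'.mono fun ω hω => propext ?_)
  exact ⟨fun h => ⟨hω, h⟩, fun h => h.2⟩

theorem abs_measureReal_le_one {Ω : Type*} [MeasurableSpace Ω] {P : Measure Ω}
    [IsProbabilityMeasure P] (A : Set Ω) : |P.real A| ≤ 1 := by
  rw [abs_of_nonneg measureReal_nonneg]
  exact measureReal_le_one

/-- The fractional linear death process is the classical one at an independent random time which
is distributed as `t ^ ν` times a Mittag-Leffler variable. -/
theorem identDistrib_linearDeathProcess_eval {ν μ : ℝ} {n₀ : ℕ} {m : Measure ℝ} (hν : 0 < ν)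
    (hν' : ν ≤ 1) (hμ : 0 < μ) (hm : IsMittagLefflerLaw ν m)
    {Ω' : Type*} [MeasurableSpace Ω'] {P' : Measure Ω'} [IsProbabilityMeasure P']
    {Mν : ℝ≥0 → Ω' → ℕ} (hMν : IsFractionalLinearDeathProcess ν μ n₀ Mν P')
    {Ω : Type*} [MeasurableSpace Ω] {P : Measure Ω} [IsProbabilityMeasure P]
    {M : ℝ≥0 → Ω → ℕ} {T : Ω → ℝ≥0} (hM : IsLinearDeathProcess μ n₀ M P) (hT : Measurable T)
    (hind : IndepFun (fun ω s => M s ω) T P) {t : ℝ≥0} (ht : 0 < t)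
    (hlaw : P.map (fun ω => (T ω : ℝ)) = m.map (fun x => (t : ℝ) ^ ν * x)) :
    IdentDistrib (Mν t) (fun ω => M (T ω) ω) P' P := by
  have := hm.isProbabilityMeasure
  have hae := aemeasurable_eval hM.measurable hM.right_continuous hT
  refine ⟨(hMν.measurable t).aemeasurable, hae, Measure.ext_of_singleton fun k => ?_⟩
  rw [Measure.map_apply (hMν.measurable t) (measurableSet_singleton k),
    Measure.map_apply_of_aemeasurable hae (measurableSet_singleton k)]
  change P' {ω | Mν t ω = k} = P {ω | M (T ω) ω = k}
  obtain ⟨q, hq, hqM⟩ := hM.exists_solves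
  have hqM' : ∀ j, ∀ s ≥ 0, q j s = P.real {ω | M s.toNNReal ω = j} := fun j s hs => by
    rw [hqM, Real.coe_toNNReal s hs]
  have hq1 : ∀ j, ∀ s ≥ 0, |q j s| ≤ 1 := fun j s hs => by
    rw [hqM' j s hs]
    exact abs_measureReal_le_one _
  have hPq : ∀ s : ℝ≥0, P {ω | M s ω = k} = ENNReal.ofReal (q k s) := fun s => by
    rw [← hqM, ofReal_measureReal]
  have hc : Continuous fun s : ℝ => q k (max s 0) :=
    (hq.continuousOn k).comp_continuous (by fun_prop) fun s => le_max_right s 0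
  have hc' : Continuous fun s : ℝ≥0 => P {ω | M s ω = k} := by
    simp only [hPq]
    exact ENNReal.continuous_ofReal.comp
      ((hq.continuousOn k).comp_continuous NNReal.continuous_coe fun s => s.2)
  -- Both probabilities equal the average of `q k` over the law of `t ^ ν X`: this one by Laplace
  -- transforms, the other by independence and `hlaw`.
  have hsub := hMν.state_prob.eq_integral hν hν' hμ hm
    (fun j s _ => abs_measureReal_le_one _) hq hq1 k (NNReal.coe_pos.2 ht)
  rw [Real.toNNReal_coe] at hsub
  rw [measure_eval hM.measurable hM.right_continuous hT hind hc', ← ofReal_measureReal, hsub,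
    ofReal_integral_eq_lintegral_ofReal]
  · have h1 := congrArg (fun ρ => ∫⁻ s, ENNReal.ofReal (q k (max s 0)) ∂ρ) hlaw
    have h2 : Measurable fun s : ℝ => ENNReal.ofReal (q k (max s 0)) :=
      hc.measurable.ennreal_ofReal
    rw [lintegral_map h2 hT.coe_nnreal_real, lintegral_map h2 (by fun_prop)] at h1
    rw [← h1]
    refine lintegral_congr fun ω => ?_
    rw [hPq, max_eq_left (NNReal.coe_nonneg (T ω))]
  · exact Integrable.of_bound (hc.comp (by fun_prop)).aestronglyMeasurable 1
      (ae_of_all _ fun x => hq1 k _ (le_max_right _ _))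
  · refine ae_of_all _ fun x => ?_
    exact measureReal_nonneg.trans_eq (hqM' k _ (le_max_right _ _)).symm

end

theorem theorem2p2 (ν : ℝ) (hν : 0 < ν) (hν' : ν ≤ 1) :
    -- the Cauchy problem for the fractional diffusion equation has one and only one solution
    (∃! u : ℝ≥0 → Measure ℝ, IsFractionalDiffusion ν u) ∧
    ∀ u : ℝ≥0 → Measure ℝ, IsFractionalDiffusion ν u →
      -- for `ν < 1` the folded solution has a density, with the stated Laplace transform in time
      (ν < 1 → ∃ q : ℝ → ℝ → ℝ, Measurable (Function.uncurry q) ∧ (∀ s t, 0 ≤ q s t) ∧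
        (∀ t : ℝ≥0, 0 < t → folded (u t) =
          (volume.restrict (Ioi (0 : ℝ))).withDensity (fun s => ENNReal.ofReal (q s t))) ∧
        ∀ s > 0, ∀ z > 0,
          IntegrableOn (fun t : ℝ => Real.exp (-z * t) * q s t) (Ioi 0) ∧
          ∫ t in Ioi (0 : ℝ), Real.exp (-z * t) * q s t =
            z ^ (ν - 1) * Real.exp (-s * z ^ ν)) ∧
      -- for all `ν`, the Laplace transform as an identity between measures in `s`
      (∀ z > 0, ∀ B : Set ℝ, MeasurableSet B →
        ∫⁻ t in Ioi (0 : ℝ), ENNReal.ofReal (Real.exp (-z * t)) * folded (u t.toNNReal) B =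
          ∫⁻ s in B ∩ Ioi 0, ENNReal.ofReal (z ^ (ν - 1) * Real.exp (-s * z ^ ν))) ∧
      -- the subordination relation, for the one-dimensional distributions
      ∀ (μ : ℝ) (n₀ : ℕ), 0 < μ →
        ∀ (Ω' : Type*) [MeasurableSpace Ω'] (P' : Measure Ω') [IsProbabilityMeasure P']
          (Mν : ℝ≥0 → Ω' → ℕ), IsFractionalLinearDeathProcess ν μ n₀ Mν P' →
        ∀ (Ω : Type*) [MeasurableSpace Ω] (P : Measure Ω) [IsProbabilityMeasure P]
          (M : ℝ≥0 → Ω → ℕ) (T : ℝ≥0 → Ω → ℝ≥0), IsLinearDeathProcess μ n₀ M P →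
          (∀ t, Measurable (T t)) →
          (∀ t, 0 < t → IndepFun (fun ω s => M s ω) (T t) P) →
          (∀ t, 0 < t → P.map (fun ω => (T t ω : ℝ)) = folded (u t)) →
        ∀ t, 0 < t → IdentDistrib (Mν t) (fun ω => M (T t ω) ω) P' P := by
  -- Uniqueness identifies an arbitrary solution with the explicit one, for any choice of `m`; in
  -- particular the law that comes with a density may be used for the first claim.
  have key : ∀ m, IsMittagLefflerLaw ν m → ∀ u, IsFractionalDiffusion ν u →
      u = diffusionLaw ν m := fun m hm u hu =>
    hu.unique hν hν' (isFractionalDiffusion_diffusionLaw hν hν' hm)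
  obtain ⟨m, hm⟩ := exists_isMittagLefflerLaw hν hν'
  refine ⟨⟨_, isFractionalDiffusion_diffusionLaw hν hν' hm, key m hm⟩, fun u hu =>
    ⟨fun h => ?_, fun z hz B hB => ?_, ?_⟩⟩
  · obtain ⟨m', q, hm', hq, hq0, hqd, hql⟩ := exists_isMittagLefflerLaw_density hν h
    refine ⟨q, hq, hq0, fun t ht => ?_, hql⟩
    rw [key m' hm' u hu, folded_diffusionLaw hm', hqd t (NNReal.coe_pos.2 ht)]
  · rw [key m hm u hu]
    exact lintegral_folded_diffusionLaw hm hz hB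
  · intro μ n₀ hμ Ω' _ P' _ Mν hMν Ω _ P _ M T hM hT hind hlaw t ht
    refine identDistrib_linearDeathProcess_eval hν hν' hμ hm hMν hM (hT t) (hind t ht) ht ?_
    rw [hlaw t ht, key m hm u hu, folded_diffusionLaw hm]
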